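/- Let $R$ be a commutative ring. All graded modules are non-negatively graded. **Categorical coalgebras.** A *categorical coalgebra* over $R$ is a graded coassociative counital coalgebra $(C,\Delta,\varepsilon)$, flat over $R$, with a coderivation $\partial$ of degree $-1$, a linear map $h\colon C\to R$ of degree $-2$ with $h\partial=0$ and $\partial^2=(h\otimes\mathrm{id})(\Delta-\Delta^{op})$, and a non-empty set $\mathcal S(C)$ of set-like elements ($\Delta x=x\otimes x$, $\varepsilon(x)=1$), called objects, that is a basis of $C_0$; moreover the $C_0$-component of $\partial$ is zero. Thus $C$ is a $C_0$-bicomodule; $\square$ denotes the cotensor product over $C_0$, and $C=\bigoplus_{x,y}C(x,y)$ over pairs of objects. A *morphism* $f=(f_0,f_1)\colon C\to C'$ consists of a map $f_0$ of graded coalgebras with $f_0(\mathcal S(C))\subset\mathcal S(C')$ and a $C_0'$-bicomodule map $f_1\colon C\to C_0'$ of degree $-1$ such that, with $\bar f_1=\varepsilon' f_1$, $$f_0\partial=\partial' f_0+(\bar f_1\otimes f_0)(\Delta-\Delta^{op}),\qquad h'f_0=h-\bar f_1\partial+(\bar f_1\cdot\bar f_1)\Delta ,$$ where $(\bar f_1\cdot\bar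 f_1)(a\otimes b)=\bar f_1(a)\bar f_1(b)$. **Cobar construction.** $\mathbf\Omega C$ is the dg category with objects $\mathcal S(C)$, in which $\mathbf\Omega C(x,y)$ is spanned by the monomials $\{c_1|\cdots|c_p\}$, $p\ge 0$, with $c_i\in C(x_{i-1},x_i)$ of positive degree, $x_0=x$, $x_p=y$, of degree $\sum(|c_i|-1)$. Composition is concatenation (diagrammatic order), and $D$ is the derivation with $D\{c\}=h(c)-\{\partial c\}-\sum(-1)^{|c'|}\{c'|c''\}$ (with $\{c\}=0$ for $c\in C_0$). $\mathbf\Omega f$ is multiplicative with $\{c\}\mapsto\{f_0c\}+f_1(c)$. Write $\mathcal M=\mathcal M(\mathbf\Omega C)=\bigoplus_{x,y}\mathbf\Omega C(x,y)$ and $\overline{\mathcal M}=\mathcal M/\langle\mathrm{id}_x\rangle$. **The two complexes.** $\mathcal B=\mathcal B(\mathcal M,\mathcal M,\mathcal M)=\bigoplus_{p}\mathcal M\,\square\,(s\overline{\mathcal M})^{\square p}\,\square\,\mathcal M$ is spanned by composable $a_0[a_1|\cdots|a_p]b$, of degree $|a_0|+|b|+\sum(|a_i|+1)$. With $\eta_i=|a_0|+\sum_{1\le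 j\le i}(|a_j|+1)$ its differential $\delta$ sends $a_0[a_1|\cdots|a_p]b$ to $$Da_0[\cdots]b-\sum_i(-1)^{\eta_{i-1}}a_0[\cdots|Da_i|\cdots]b+(-1)^{\eta_p}a_0[\cdots]Db$$ $$-(-1)^{\eta_0}a_0a_1[a_2|\cdots|a_p]b-\sum_{0<i<p}(-1)^{\eta_i}a_0[\cdots|a_ia_{i+1}|\cdots]b+(-1)^{\eta_{p-1}}a_0[a_1|\cdots|a_{p-1}]a_pb$$ (the last line is absent for $p=0$). $\mathcal Q=\mathcal Q(\mathcal M,C,\mathcal M)=\mathcal M\,\square\,C\,\square\,\mathcal M$ has the differential $$d(a\square c\square b)=Da\square c\square b+(-1)^{|a|}a\square\partial c\square b+(-1)^{|a|+|c|}a\square c\square Db-(-1)^{|a|}\sum a\{c'\}\square c''\square b+(-1)^{|a|}\sum(-1)^{|c'|}a\square c'\square\{c''\}b .$$ Both are $\mathcal M$-bimodules, and $\mathrm{Hoch}(\mathbf\Omega C)$ and $\mathrm{coHoch}(C)$ are the tensor products of $\mathcal B$ and of $\mathcal Q$ with $\mathcal M$ over $\mathcal M\otimes\mathcal M^{op}$: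 the quotients of $\bigoplus_{x,y}\mathcal B(x,y)\otimes\mathbf\Omega C(y,x)$ and $\bigoplus_{x,y}\mathcal Q(x,y)\otimes\mathbf\Omega C(y,x)$ by $ua\otimes m=u\otimes am$ and $au\otimes m=(-1)^{|a|(|u|+|m|)}u\otimes ma$, with the induced differentials. **The maps.** $\pi\colon\mathcal B\to\mathcal Q$, $\alpha\colon\mathcal Q\to\mathcal B$ and $H\colon\mathcal B\to\mathcal B$ of degree $+1$ are given by: * $\pi(a[\,]b)=a\square y\square b$, where the object $y$ is the target of $a$; $\pi(a[\{c_1|\cdots|c_q\}]b)=\sum_{i=1}^q(-1)^{\sum_{j<i}(|c_j|-1)}a\{c_1|\cdots|c_{i-1}\}\square c_i\square\{c_{i+1}|\cdots|c_q\}b$; and $\pi(a[a_1|\cdots|a_p]b)=0$ for $p>1$. * $\alpha(a\square c\square b)=a[\{c\}]b+\sum a[\{c'\}|\{c''\}]b+\sum a[\{c'\}|\{c''\}|\{c'''\}]b+\cdots$ for $|c|>0$, and $\alpha(a\square x\square b)=a[\,]b$ for an object $x$. * For $a_1=\{c_1|\cdots|c_m\}$, $$H(a_0[a_1|\cdots|a_p]b)=\sum_{0<i<m}(-1)^{|a_0|+|c_i|}\sum_{n\ge1}\sum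 a_0\{c_1|\cdots|c_{i-1}\}\big[\{c_i^{(1)}\}|\cdots|\{c_i^{(n)}\}|\{c_{i+1}|\cdots|c_m\}|a_2|\cdots|a_p\big]b,$$ where $\sum c_i^{(1)}\otimes\cdots\otimes c_i^{(n)}$ is the $n$-fold iterated coproduct of $c_i$; and $H(a_0[\,]b)=0$. **Theorem.** 1. For every categorical coalgebra $C$ the pairs $(\mathcal B,\delta)$ and $(\mathcal Q,d)$ are chain complexes, the maps $\pi$ and $\alpha$ are chain maps, $\pi\alpha=\mathrm{id}_{\mathcal Q}$, and $H$ is a chain homotopy between $\alpha\pi$ and $\mathrm{id}_{\mathcal B}$, namely $\delta H+H\delta=\alpha\pi-\mathrm{id}_{\mathcal B}$. That is, $(\pi,\alpha,H)$ is a chain contraction. All of this respects the decompositions of $\mathcal B$ and $\mathcal Q$ by the pair of outer objects $(x,y)$. 2. The contraction is natural: for every morphism $f=(f_0,f_1)\colon C\to C'$ the maps $a_0[a_1|\cdots|a_p]b\mapsto\mathbf\Omega f(a_0)[\mathbf\Omega f(a_1)|\cdots|\mathbf\Omega f(a_p)]\mathbf\Omega f(b)$ and $a\square c\square b\mapsto\mathbf\Omega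 f(a)\square f_0(c)\square\mathbf\Omega f(b)$ are chain maps that commute with $\pi$, $\alpha$ and $H$. 3. The maps $\bar\pi=\pi\otimes\mathrm{id}_{\mathcal M}$, $\bar\alpha=\alpha\otimes\mathrm{id}_{\mathcal M}$ and $\bar H=H\otimes\mathrm{id}_{\mathcal M}$ are well defined on $\mathrm{Hoch}(\mathbf\Omega C)$ and $\mathrm{coHoch}(C)$, which are chain complexes, and form a chain contraction between them in the same sense ($\bar\pi\bar\alpha=\mathrm{id}$, $\delta\bar H+\bar H\delta=\bar\alpha\bar\pi-\mathrm{id}$). 4. The contraction in 3 is natural: every morphism $f$ induces chain maps $\mathrm{Hoch}(\mathbf\Omega C)\to\mathrm{Hoch}(\mathbf\Omega C')$ and $\mathrm{coHoch}(C)\to\mathrm{coHoch}(C')$ (the maps of 2 tensored with $\mathbf\Omega f$) that commute with $\bar\pi$, $\bar\alpha$ and $\bar H$. -/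

import Mathlib

set_option maxSynthPendingDepth 4

open scoped TensorProduct

universe u v

/-! ### Graded modules and the Koszul sign rule -/

namespace Graded

variable {R : Type u} [CommRing R] {M : Type v} [AddCommGroup M] [Module R M]
  (gr : ℕ → Submodule R M) [DirectSum.Decomposition gr]

/-- The linear endomorphism of a graded module that multiplies the elements of degree `n`
by `f n`. -/
noncomputable def scale (f : ℕ → R) : M →ₗ[R] M :=
  (DirectSum.toModule R ℕ M fun n => f n • (gr n).subtype) ∘ₗ
    (DirectSum.decomposeLinearEquiv gr).toLinearMap

/-- The parity operator `c ↦ (-1)^|c| c`. -/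
noncomputable def sgn : M →ₗ[R] M := scale gr fun n => (-1) ^ n

/-- The projection onto degree zero. -/
noncomputable def zeroPart : M →ₗ[R] M := scale gr fun n => if n = 0 then 1 else 0

/-- The projection onto the positive degrees. -/
noncomputable def posPart : M →ₗ[R] M := scale gr fun n => if n = 0 then 0 else 1

/-- The symmetry `a ⊗ b ↦ (-1)^(|a||b|) b ⊗ a` of graded modules (`b` is split into its even
and its odd part; the odd part contributes the sign `(-1)^|a|`). -/
noncomputable def swap : M ⊗[R] M →ₗ[R] M ⊗[R] M :=
  (TensorProduct.map (scale gr fun n => if Even n then 1 else 0) LinearMap.id +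
    TensorProduct.map (scale gr fun n => if Even n then 0 else 1) (sgn gr)) ∘ₗ
      (TensorProduct.comm R M M).toLinearMap

/-- The degree `n` part of the tensor product of two graded modules. -/
def tensorGr (n : ℕ) : Submodule R (M ⊗[R] M) :=
  Submodule.span R {t | ∃ (i j : ℕ) (a b : M), a ∈ gr i ∧ b ∈ gr j ∧ i + j = n ∧ t = a ⊗ₜ b}

/-- The family `gr` shifted down by one: `lower gr 0 = 0` and `lower gr (n + 1) = gr n`. -/
def lower {N : Type*} [AddCommGroup N] [Module R N] (gr : ℕ → Submodule R N) :
    ℕ → Submodule R N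
  | 0 => ⊥
  | n + 1 => gr n

end Graded

/-! ### Categorical coalgebras -/

/-- A categorical coalgebra over `R`: a non-negatively graded coassociative counital coalgebra
`(C, Δ, ε)`, flat over `R`, with a coderivation `∂` of degree `-1`, a curvature `h` of
degree `-2`, and a non-empty set of set-like elements (the objects) that is a basis of `C₀`.

If the set of all set-like elements of `C` is a basis of `C₀`, then it can serve as `objects`.
Conversely, if `R` has no idempotents besides `0` and `1`, then a basis of `C₀` consisting of
set-like elements contains every set-like element of `C₀`. -/
structure CategoricalCoalgebra (R : Type u) [CommRing R] where
  carrier : Type v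
  [addCommGroup : AddCommGroup carrier]
  [module : Module R carrier]
  [coalgebra : Coalgebra R carrier]
  flat : Module.Flat R carrier
  gr : ℕ → Submodule R carrier
  [decomposition : DirectSum.Decomposition gr]
  comul_mem : ∀ {n : ℕ} {c : carrier}, c ∈ gr n →
    (Coalgebra.comul c : carrier ⊗[R] carrier) ∈ Graded.tensorGr gr n
  counit_eq_zero : ∀ {n : ℕ} {c : carrier}, c ∈ gr n → n ≠ 0 → Coalgebra.counit (R := R) c = 0
  /-- the boundary map -/
  bd : carrier →ₗ[R] carrier
  bd_mem : ∀ {n : ℕ} {c : carrier}, c ∈ gr n → bd c ∈ Graded.lower gr n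
  /-- `Δ ∂ = (∂ ⊗ id + id ⊗ ∂) Δ` -/
  comul_bd : (Coalgebra.comul : carrier →ₗ[R] carrier ⊗[R] carrier) ∘ₗ bd =
    (TensorProduct.map bd LinearMap.id + TensorProduct.map (Graded.sgn gr) bd) ∘ₗ
      Coalgebra.comul
  /-- the curvature -/
  curv : carrier →ₗ[R] R
  curv_eq_zero : ∀ {n : ℕ} {c : carrier}, c ∈ gr n → n ≠ 2 → curv c = 0
  curv_bd : curv ∘ₗ bd = 0
  /-- `∂ ∂ = (h ⊗ id) (Δ - Δᵒᵖ)` -/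
  bd_bd : bd ∘ₗ bd = (TensorProduct.lid R carrier).toLinearMap ∘ₗ
    TensorProduct.map curv LinearMap.id ∘ₗ
      (Coalgebra.comul - Graded.swap gr ∘ₗ Coalgebra.comul)
  /-- the set of objects -/
  objects : Set carrier
  objects_nonempty : objects.Nonempty
  comul_object : ∀ {x : carrier}, x ∈ objects →
    (Coalgebra.comul x : carrier ⊗[R] carrier) = x ⊗ₜ x
  counit_object : ∀ {x : carrier}, x ∈ objects → Coalgebra.counit (R := R) x = 1
  linearIndependent_objects : LinearIndependent R ((↑) : objects → carrier)
  span_objects : Submodule.span R objects = gr 0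
  /-- the boundary of an element of degree one vanishes -/
  zeroPart_bd : Graded.zeroPart gr ∘ₗ bd = 0

namespace CategoricalCoalgebra

attribute [instance] addCommGroup module coalgebra decomposition

variable {R : Type u} [CommRing R]

/-- A morphism `(f₀, f₁)` of categorical coalgebras. -/
structure Hom (C D : CategoricalCoalgebra.{u, v} R) where
  /-- the morphism of graded coalgebras -/
  f₀ : C.carrier →ₗc[R] D.carrier
  f₀_mem : ∀ {n : ℕ} {c : C.carrier}, c ∈ C.gr n → f₀ c ∈ D.gr n
  f₀_object : ∀ {x : C.carrier}, x ∈ C.objects → f₀ x ∈ D.objects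
  /-- the map of degree `-1` to `D₀` -/
  f₁ : C.carrier →ₗ[R] D.carrier
  f₁_mem : ∀ {c : C.carrier}, c ∈ C.gr 1 → f₁ c ∈ D.gr 0
  f₁_eq_zero : ∀ {n : ℕ} {c : C.carrier}, c ∈ C.gr n → n ≠ 1 → f₁ c = 0
  /-- `f₁` is a map of right `D₀`-comodules -/
  comul_f₁_right : ∀ c : C.carrier, (Coalgebra.comul (f₁ c) : D.carrier ⊗[R] D.carrier) =
    TensorProduct.map f₁ ((f₀ : C.carrier →ₗ[R] D.carrier) ∘ₗ Graded.zeroPart C.gr)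
      (Coalgebra.comul c)
  /-- `f₁` is a map of left `D₀`-comodules -/
  comul_f₁_left : ∀ c : C.carrier, (Coalgebra.comul (f₁ c) : D.carrier ⊗[R] D.carrier) =
    TensorProduct.map ((f₀ : C.carrier →ₗ[R] D.carrier) ∘ₗ Graded.zeroPart C.gr) f₁
      (Coalgebra.comul c)
  /-- `f₀ ∂ = ∂ f₀ + (ε f₁ ⊗ f₀) (Δ - Δᵒᵖ)` -/
  f₀_bd : (f₀ : C.carrier →ₗ[R] D.carrier) ∘ₗ C.bd =
    D.bd ∘ₗ (f₀ : C.carrier →ₗ[R] D.carrier) +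
      (TensorProduct.lid R D.carrier).toLinearMap ∘ₗ
        TensorProduct.map (Coalgebra.counit ∘ₗ f₁) (f₀ : C.carrier →ₗ[R] D.carrier) ∘ₗ
          (Coalgebra.comul - Graded.swap C.gr ∘ₗ Coalgebra.comul)
  /-- `h f₀ = h - ε f₁ ∂ + (ε f₁ · ε f₁) Δ` -/
  curv_f₀ : D.curv ∘ₗ (f₀ : C.carrier →ₗ[R] D.carrier) =
    C.curv - (Coalgebra.counit ∘ₗ f₁) ∘ₗ C.bd +
      LinearMap.mul' R R ∘ₗ
        TensorProduct.map (Coalgebra.counit ∘ₗ f₁) (Coalgebra.counit ∘ₗ f₁) ∘ₗ Coalgebra.comul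

variable (C : CategoricalCoalgebra.{u, v} R)

/-- The type of objects. -/
abbrev Obj : Type v := C.objects

/-- `Rₓ □ C □ R_y`: the elements with left coaction `x ⊗ c` and right coaction `c ⊗ y`. As `C₀` is
free on the objects, `C` is the direct sum of these submodules. -/
def hom (x y : C.Obj) : Submodule R C.carrier where
  carrier := {c | TensorProduct.map (Graded.zeroPart C.gr) LinearMap.id (Coalgebra.comul c) =
      (x : C.carrier) ⊗ₜ[R] c ∧
    TensorProduct.map LinearMap.id (Graded.zeroPart C.gr) (Coalgebra.comul c) =
      c ⊗ₜ[R] (y : C.carrier)}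
  add_mem' := by
    rintro a b ⟨ha, ha'⟩ ⟨hb, hb'⟩
    simp only [Set.mem_ofPred_eq, map_add, ha, ha', hb, hb', TensorProduct.tmul_add,
      TensorProduct.add_tmul, and_self]
  zero_mem' := by simp
  smul_mem' := by
    rintro r a ⟨ha, ha'⟩
    simp only [Set.mem_ofPred_eq, map_smul, ha, ha', TensorProduct.tmul_smul,
      TensorProduct.smul_tmul', and_self]

/-! ### Words -/

/-- The tensor algebra whose elements are used to write the monomials `{c₁|⋯|c_p}`;
the letter `c` stands for `s⁻¹ c` and has degree `|c| - 1`. -/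
abbrev Words : Type (max u v) := TensorAlgebra R C.carrier

/-- The tensor algebra whose elements are used to write the bar words `[a₁|⋯|a_p]`;
the letter `a` stands for `s a` and has degree `|a| + 1`. -/
abbrev BarWords : Type (max u v) := TensorAlgebra R C.Words

/-- `IsWord x y p n w`: the element `w` is a monomial `{c₁|⋯|c_p}` of degree `n`, with homogeneous
`cᵢ` of positive degree in `R_{xᵢ₋₁} □ C □ R_{xᵢ}`, where `x₀ = x` and `x_p = y`. -/
inductive IsWord : C.Obj → C.Obj → ℕ → ℕ → C.Words → Prop
  | nil (x : C.Obj) : IsWord x x 0 0 1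
  | cons {x y z : C.Obj} {p m n : ℕ} {c : C.carrier} {w : C.Words} :
      c ∈ C.hom x y → c ∈ C.gr (m + 1) → IsWord y z p n w →
        IsWord x z (p + 1) (m + n) (TensorAlgebra.ι R c * w)

/-- `(ΩC)(x, y)ₙ`, the degree `n` part of `⨁ₚ Rₓ □ (s⁻¹ C̄)^□p □ R_y`. Because `C₀` is free on the
objects, the `p`-fold cotensor product over `C₀` is the span of the composable monomials. Composition
is the product of words (concatenation), and the identity of `x` is `1`. -/
def cobarGr (x y : C.Obj) (n : ℕ) : Submodule R C.Words :=
  Submodule.span R {w | ∃ p, C.IsWord x y p n w}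

/-- `IsBarWord x y p n t`: the element `t` is a bar word `[a₁|⋯|a_p]` of degree `n`, where `aᵢ` is
a monomial of positive length in `(ΩC)(xᵢ₋₁, xᵢ)`, `x₀ = x` and `x_p = y`. The monomials
of positive length span a complement of the identities, so they represent the quotient
`M(ΩC) / u(C₀)`. -/
inductive IsBarWord : C.Obj → C.Obj → ℕ → ℕ → C.BarWords → Prop
  | nil (x : C.Obj) : IsBarWord x x 0 0 1
  | cons {x y z : C.Obj} {q p m n : ℕ} {a : C.Words} {t : C.BarWords} :
      C.IsWord x y (q + 1) m a → IsBarWord y z p n t →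
        IsBarWord x z (p + 1) (m + 1 + n) (TensorAlgebra.ι R a * t)

end CategoricalCoalgebra

/-! ### Linear maps defined by recursion on words -/

section WordRec

variable {R : Type*} [CommRing R] {E : Type*} [AddCommGroup E] [Module R E]
  {V : Type*} [AddCommGroup V] [Module R V]

/-- The step of the recursion: a letter `e` acts by `(w, v) ↦ (e w, s e (w, v))`. -/
def wordStep (s : E →ₗ[R] (TensorAlgebra R E × V) →ₗ[R] V) :
    E →ₗ[R] Module.End R (TensorAlgebra R E × V) where
  toFun e := LinearMap.prod
    (LinearMap.mulLeft R (TensorAlgebra.ι R e) ∘ₗ LinearMap.fst R (TensorAlgebra R E) V) (s e)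
  map_add' a b := by ext <;> simp [add_mul]
  map_smul' r a := by ext <;> simp

/-- The linear map `F` on the tensor algebra with `F 1 = v₀` and `F (e w) = s e (w, F w)` for
a letter `e` and a word `w`. -/
noncomputable def wordRec (s : E →ₗ[R] (TensorAlgebra R E × V) →ₗ[R] V) (v₀ : V) :
    TensorAlgebra R E →ₗ[R] V :=
  LinearMap.snd R (TensorAlgebra R E) V ∘ₗ
    (LinearMap.applyₗ ((1 : TensorAlgebra R E), v₀) :
      Module.End R (TensorAlgebra R E × V) →ₗ[R] TensorAlgebra R E × V) ∘ₗ
    (TensorAlgebra.lift R (wordStep s)).toLinearMap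

theorem wordRec_one (s : E →ₗ[R] (TensorAlgebra R E × V) →ₗ[R] V) (v₀ : V) :
    wordRec s v₀ 1 = v₀ := by
  simp [wordRec]

theorem wordRec_ι_mul (s : E →ₗ[R] (TensorAlgebra R E × V) →ₗ[R] V) (v₀ : V) (e : E)
    (w : TensorAlgebra R E) :
    wordRec s v₀ (TensorAlgebra.ι R e * w) = s e (w, wordRec s v₀ w) := by
  have h1 : ∀ (w : TensorAlgebra R E) (q : TensorAlgebra R E × V),
      (TensorAlgebra.lift R (wordStep s) w q).1 = w * q.1 := by
    intro w
    induction w using TensorAlgebra.induction with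
    | algebraMap r => intro q; simp [Algebra.smul_def]
    | ι x => intro q; simp [wordStep]
    | mul a b ha hb => intro q; simp [ha, hb, mul_assoc]
    | add a b ha hb => intro q; simp [ha, hb, add_mul]
  have h2 : TensorAlgebra.lift R (wordStep s) w (1, v₀) = (w, wordRec s v₀ w) :=
    Prod.ext (by simpa using h1 w (1, v₀)) rfl
  conv_lhs => rw [wordRec]
  simp only [LinearMap.comp_apply, AlgHom.toLinearMap_apply, map_mul, TensorAlgebra.lift_ι_apply,
    LinearMap.applyₗ_apply_apply, Module.End.mul_apply, h2]
  rfl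

end WordRec

namespace CategoricalCoalgebra

open TensorAlgebra TensorProduct Coalgebra Graded

variable {R : Type u} [CommRing R] (C : CategoricalCoalgebra.{u, v} R)

/-! ### The differential of the cobar construction -/

/-- The map `c ↦ {c}`, which is zero on `C₀`. -/
noncomputable def brace : C.carrier →ₗ[R] C.Words := ι R ∘ₗ posPart C.gr

/-- The parity operator of `ΩC`. -/
noncomputable def wordSgn : C.Words →ₐ[R] C.Words := lift R (-(ι R ∘ₗ sgn C.gr))

/-- The differential on letters: `D{c} = h(c) - {∂c} - ∑ (-1)^|c'| {c'|c''}`. -/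
noncomputable def letterD : C.carrier →ₗ[R] C.Words :=
  Algebra.linearMap R C.Words ∘ₗ C.curv - ι R ∘ₗ C.bd -
    LinearMap.mul' R C.Words ∘ₗ map (C.brace ∘ₗ sgn C.gr) C.brace ∘ₗ comul

/-- The differential `D` of `ΩC`: `D 1 = 0` and `D({c} w) = (D{c}) w - (-1)^|c| {c} (D w)`. -/
noncomputable def wordD : C.Words →ₗ[R] C.Words :=
  wordRec (LinearMap.mk₂ R
    (fun c (p : C.Words × C.Words) => C.letterD c * p.1 - ι R (sgn C.gr c) * p.2)
    (by intros; simp only [map_add, add_mul]; abel)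
    (by intros; simp only [map_smul, smul_mul_assoc, smul_sub])
    (by intros; simp only [Prod.fst_add, Prod.snd_add, mul_add]; abel)
    (by intros; simp only [Prod.smul_fst, Prod.smul_snd, mul_smul_comm, smul_sub])) 0

/-- The coefficient of the empty word. -/
noncomputable def wordCoeff : C.Words →ₗ[R] R :=
  (algebraMapInv : C.Words →ₐ[R] R).toLinearMap

/-- The projection onto the words of positive length. -/
noncomputable def plus : C.Words →ₗ[R] C.Words :=
  LinearMap.id - Algebra.linearMap R C.Words ∘ₗ C.wordCoeff

/-! ### The two-sided bar construction -/

/-- `T ⊗ Y ⊗ T`, where `T` is the algebra of words; it contains the cotensor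
products `M(ΩC) □ Y □ M(ΩC)`. -/
abbrev Triple (Y : Type*) [AddCommGroup Y] [Module R Y] : Type _ :=
  C.Words ⊗[R] (Y ⊗[R] C.Words)

/-- The parity operator of bar words. -/
noncomputable def barSgn : C.BarWords →ₐ[R] C.BarWords :=
  lift R (-(ι R ∘ₗ C.wordSgn.toLinearMap))

/-- The coefficient of the empty bar word. -/
noncomputable def barCoeff : C.BarWords →ₗ[R] R :=
  (algebraMapInv : C.BarWords →ₐ[R] R).toLinearMap

/-- `[a₁|⋯|a_p] ↦ -∑ᵢ (-1)^(η (i-1)) [a₁|⋯|D aᵢ|⋯|a_p]`, where `η i = ∑_{j ≤ i} (|aⱼ| + 1)`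
and where the multiples of an identity in `D aᵢ` are dropped. -/
noncomputable def barD : C.BarWords →ₗ[R] C.BarWords :=
  wordRec (LinearMap.mk₂ R
    (fun a (p : C.BarWords × C.BarWords) =>
      -(ι R (C.plus (C.wordD a)) * p.1) - ι R (C.wordSgn a) * p.2)
    (by intros; simp only [map_add, add_mul]; abel)
    (by intros; simp only [map_smul, smul_mul_assoc, smul_sub, smul_neg])
    (by intros; simp only [Prod.fst_add, Prod.snd_add, mul_add]; abel)
    (by intros; simp only [Prod.smul_fst, Prod.smul_snd, mul_smul_comm, smul_sub, smul_neg])) 0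

/-- `[a₁|⋯|a_p] ↦ a₁ ⊗ [a₂|⋯|a_p]`, and `[] ↦ 0`. -/
noncomputable def barFirst : C.BarWords →ₗ[R] C.Words ⊗[R] C.BarWords :=
  wordRec (LinearMap.mk₂ R
    (fun a (p : C.BarWords × C.Words ⊗[R] C.BarWords) => a ⊗ₜ[R] p.1)
    (by intros; simp only [add_tmul])
    (by intros; simp only [smul_tmul'])
    (by intros; simp only [Prod.fst_add, tmul_add])
    (by intros; simp only [Prod.smul_fst, tmul_smul])) 0

/-- `[a₁|⋯|a_p] ↦ [a₁|⋯|a_(p-1)] ⊗ a_p`, and `[] ↦ 0`. -/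
noncomputable def barLast : C.BarWords →ₗ[R] C.BarWords ⊗[R] C.Words :=
  wordRec (LinearMap.mk₂ R
    (fun a (p : C.BarWords × C.BarWords ⊗[R] C.Words) =>
      C.barCoeff p.1 • ((1 : C.BarWords) ⊗ₜ[R] a) + ι R a • p.2)
    (by intros; simp only [map_add, tmul_add, smul_add, add_smul]; abel)
    (by
      intro r a p
      simp only [map_smul, tmul_smul, smul_add, smul_assoc]
      rw [smul_comm r (C.barCoeff p.1)])
    (by intros; simp only [Prod.fst_add, Prod.snd_add, map_add, smul_add, add_smul]; abel)
    (by
      intro r a p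
      simp only [Prod.smul_fst, Prod.smul_snd, map_smul, smul_add, smul_assoc]
      rw [smul_comm r (ι R a)])) 0

/-- `a ⊗ [a₁|⋯|a_p] ↦ [a|a₁|⋯|a_p]`. -/
noncomputable def barCons : C.Words ⊗[R] C.BarWords →ₗ[R] C.BarWords :=
  LinearMap.mul' R C.BarWords ∘ₗ map (ι R) LinearMap.id

/-- `[a₁|⋯|a_p] ↦ ∑_{0 < i < p} (-1)^(η i) [a₁|⋯|aᵢ aᵢ₊₁|⋯|a_p]`. -/
noncomputable def barMul : C.BarWords →ₗ[R] C.BarWords :=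
  wordRec (LinearMap.mk₂ R
    (fun a (p : C.BarWords × C.BarWords) =>
      -C.barCons (C.wordSgn a • C.barFirst p.1) - ι R (C.wordSgn a) * p.2)
    (by intros; simp only [map_add, add_smul, add_mul]; abel)
    (by intros; simp only [map_smul, smul_assoc, smul_mul_assoc, smul_sub, smul_neg])
    (by intros; simp only [Prod.fst_add, Prod.snd_add, map_add, smul_add, mul_add]; abel)
    (by
      intro r a p
      simp only [Prod.smul_fst, Prod.smul_snd, map_smul, mul_smul_comm, smul_sub, smul_neg]
      rw [smul_comm (C.wordSgn a) r, map_smul])) 0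

/-- The parity operator of `T ⊗ Y ⊗ T`, for a module `Y` with parity operator `σ`. -/
noncomputable def tripleSgn {Y : Type*} [AddCommGroup Y] [Module R Y] (σ : Y →ₗ[R] Y) :
    C.Triple Y →ₗ[R] C.Triple Y :=
  map C.wordSgn.toLinearMap (map σ C.wordSgn.toLinearMap)

/-- The linear map `a ⊗ y ⊗ b ↦ a · F(y) · b` for a linear map `F : Y → T ⊗ Z`, where `T ⊗ Z` has
its left multiplication and `b` is put to the right. -/
noncomputable def insertLeft {Y Z : Type*} [AddCommGroup Y] [Module R Y] [AddCommGroup Z]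
    [Module R Z] (F : Y →ₗ[R] C.Words ⊗[R] Z) : C.Triple Y →ₗ[R] C.Triple Z :=
  TensorProduct.lift (LinearMap.mk₂ R
    (fun a (q : Y ⊗[R] C.Words) =>
      a • (TensorProduct.assoc R C.Words Z C.Words) (map F LinearMap.id q))
    (by intros; simp only [add_smul])
    (by intros; simp only [smul_assoc])
    (by intros; simp only [map_add, smul_add])
    (by intro a r q; simp only [map_smul]; rw [smul_comm]))

/-- The linear map `a ⊗ y ⊗ b ↦ a ⊗ F(y) · b` for a linear map `F : Y → Z ⊗ T`. -/
noncomputable def insertRight {Y Z : Type*} [AddCommGroup Y] [Module R Y] [AddCommGroup Z]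
    [Module R Z] (F : Y →ₗ[R] Z ⊗[R] C.Words) : C.Triple Y →ₗ[R] C.Triple Z :=
  map LinearMap.id (map LinearMap.id (LinearMap.mul' R C.Words) ∘ₗ
    (TensorProduct.assoc R Z C.Words C.Words).toLinearMap ∘ₗ map F LinearMap.id)

/-- The differential `δ` of the two-sided bar construction: with
`η i = |a₀| + ∑_{1 ≤ j ≤ i} (|aⱼ| + 1)`, `δ (a₀[a₁|⋯|a_p]b)` is the sum of the terms
`(D a₀)[a₁|⋯|a_p]b`, `-∑ᵢ (-1)^(η (i-1)) a₀[a₁|⋯|D aᵢ|⋯|a_p]b`, `(-1)^(η p) a₀[a₁|⋯|a_p](D b)`,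
`-(-1)^(η 0) a₀a₁[a₂|⋯|a_p]b`, `-∑_{0 < i < p} (-1)^(η i) a₀[a₁|⋯|aᵢaᵢ₊₁|⋯|a_p]b` and
`(-1)^(η (p-1)) a₀[a₁|⋯|a_(p-1)]a_p b`. -/
noncomputable def barDiff : C.Triple C.BarWords →ₗ[R] C.Triple C.BarWords :=
  map C.wordD LinearMap.id +
    map C.wordSgn.toLinearMap (map C.barD LinearMap.id) +
    map C.wordSgn.toLinearMap (map C.barSgn.toLinearMap C.wordD) -
    (C.insertLeft C.barFirst ∘ₗ map C.wordSgn.toLinearMap LinearMap.id +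
      map C.wordSgn.toLinearMap (map C.barMul LinearMap.id) -
      C.insertRight (map C.barSgn.toLinearMap LinearMap.id ∘ₗ C.barLast) ∘ₗ
        map C.wordSgn.toLinearMap LinearMap.id)

/-- The differential `d` of `𝒬`: `d (a □ c □ b)` is
`(D a) □ c □ b + (-1)^|a| a □ ∂c □ b + (-1)^(|a| + |c|) a □ c □ (D b)`
`- (-1)^|a| ∑ a{c'} □ c'' □ b + (-1)^|a| ∑ (-1)^|c'| a □ c' □ {c''}b`. -/
noncomputable def qDiff : C.Triple C.carrier →ₗ[R] C.Triple C.carrier :=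
  map C.wordD LinearMap.id +
    map C.wordSgn.toLinearMap (map C.bd LinearMap.id) +
    map C.wordSgn.toLinearMap (map (sgn C.gr) C.wordD) -
    C.insertLeft (map C.brace LinearMap.id ∘ₗ comul) ∘ₗ map C.wordSgn.toLinearMap LinearMap.id +
    C.insertRight (map (sgn C.gr) C.brace ∘ₗ comul) ∘ₗ map C.wordSgn.toLinearMap LinearMap.id

/-! ### The maps `α`, `π` and `H` -/

/-- `c ↦ ∑ [{c⁽¹⁾}|⋯|{c⁽ⁿ⁾}]`, the `n`-fold iterated coproduct. -/
noncomputable def iterCoprod : ℕ → (C.carrier →ₗ[R] C.BarWords)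
  | 0 => Algebra.linearMap R C.BarWords ∘ₗ counit
  | n + 1 => C.barCons ∘ₗ map C.brace (iterCoprod n) ∘ₗ comul

/-- `c ↦ [{c}] + ∑ [{c'}|{c''}] + ∑ [{c'}|{c''}|{c'''}] + ⋯` for `c` of positive degree, and
`x ↦ []` for an object `x`. An element of degree `n` has no `m`-fold term for `m > n`. -/
noncomputable def allCoprod : C.carrier →ₗ[R] C.BarWords :=
  (DirectSum.toModule R ℕ C.BarWords fun n =>
    (∑ m ∈ Finset.range (n + 1), C.iterCoprod m) ∘ₗ (C.gr n).subtype) ∘ₗ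
      (DirectSum.decomposeLinearEquiv C.gr).toLinearMap

/-- `α (a □ c □ b) = a[{c}]b + ∑ a[{c'}|{c''}]b + ∑ a[{c'}|{c''}|{c'''}]b + ⋯`. -/
noncomputable def alphaLin : C.Triple C.carrier →ₗ[R] C.Triple C.BarWords :=
  map LinearMap.id (map C.allCoprod LinearMap.id)

/-- `w ↦ w ⊗ y` for a word `w` of positive length ending at `y`, and `1 ↦ 0`. -/
noncomputable def targetAux : C.Words →ₗ[R] C.Words ⊗[R] C.carrier :=
  wordRec (LinearMap.mk₂ R
    (fun c (p : C.Words × C.Words ⊗[R] C.carrier) =>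
      C.wordCoeff p.1 • map (ι R) (zeroPart C.gr) (comul c) + ι R c • p.2)
    (by intros; simp only [map_add, smul_add, add_smul]; abel)
    (by
      intro r a p
      simp only [map_smul, smul_add, smul_assoc]
      rw [smul_comm r (C.wordCoeff p.1)])
    (by intros; simp only [Prod.fst_add, Prod.snd_add, map_add, smul_add, add_smul]; abel)
    (by
      intro r a p
      simp only [Prod.smul_fst, Prod.smul_snd, map_smul, smul_add, smul_assoc]
      rw [smul_comm r (ι R a)])) 0

/-- The right coaction on `(ΩC)(x, -)`: `w ↦ w ⊗ y` for `w` in `(ΩC)(x, y)`. -/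
noncomputable def target (x : C.Obj) : C.Words →ₗ[R] C.Words ⊗[R] C.carrier :=
  C.targetAux + LinearMap.toSpanSingleton R _ ((1 : C.Words) ⊗ₜ[R] (x : C.carrier)) ∘ₗ C.wordCoeff

/-- `{c₁|⋯|c_q} ↦ ∑ᵢ (-1)^(|{c₁|⋯|cᵢ₋₁}|) {c₁|⋯|cᵢ₋₁} □ cᵢ □ {cᵢ₊₁|⋯|c_q}`. -/
noncomputable def splitWord : C.Words →ₗ[R] C.Triple C.carrier :=
  wordRec (LinearMap.mk₂ R
    (fun c (p : C.Words × C.Triple C.carrier) =>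
      (1 : C.Words) ⊗ₜ[R] (c ⊗ₜ[R] p.1) - ι R (sgn C.gr c) • p.2)
    (by intros; simp only [map_add, tmul_add, add_tmul, add_smul]; abel)
    (by intros; simp only [map_smul, tmul_smul, ← smul_tmul', smul_sub, smul_assoc])
    (by intros; simp only [Prod.fst_add, Prod.snd_add, tmul_add, smul_add]; abel)
    (by
      intro r a p
      simp only [Prod.smul_fst, Prod.smul_snd, tmul_smul, smul_sub]
      rw [smul_comm r (ι R _)])) 0

/-- `[a] ↦ a`, and bar words of length different from one are sent to zero. -/
noncomputable def barSingle : C.BarWords →ₗ[R] C.Words :=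
  wordRec (LinearMap.mk₂ R
    (fun a (p : C.BarWords × C.Words) => C.barCoeff p.1 • a)
    (by intros; simp only [smul_add])
    (by intro r a p; rw [smul_comm])
    (by intros; simp only [Prod.fst_add, map_add, add_smul])
    (by intros; simp only [Prod.smul_fst, map_smul, smul_assoc])) 0

/-- The linear map `a ⊗ y ⊗ b ↦ a · F(y) · b` for a linear map `F : Y → T ⊗ Z ⊗ T`. -/
noncomputable def insertBoth {Y Z : Type*} [AddCommGroup Y] [Module R Y] [AddCommGroup Z]
    [Module R Z] (F : Y →ₗ[R] C.Triple Z) : C.Triple Y →ₗ[R] C.Triple Z :=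
  C.insertRight LinearMap.id ∘ₗ C.insertLeft F

/-- The map `π` on chains that start at the object `x`: `π (a[]b) = a □ y □ b` where `y` is the target
of `a`, `π (a[{c₁|⋯|c_q}]b) = ∑ᵢ (-1)^(|{c₁|⋯|cᵢ₋₁}|) a{c₁|⋯|cᵢ₋₁} □ cᵢ □ {cᵢ₊₁|⋯|c_q}b`,
and `π (a[a₁|⋯|a_p]b) = 0` for `p > 1`. -/
noncomputable def piLin (x : C.Obj) : C.Triple C.BarWords →ₗ[R] C.Triple C.carrier :=
  (TensorProduct.assoc R C.Words C.carrier C.Words).toLinearMap ∘ₗ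
    map (C.target x) ((TensorProduct.lid R C.Words).toLinearMap ∘ₗ map C.barCoeff LinearMap.id) +
  C.insertBoth (C.splitWord ∘ₗ C.barSingle)

/-- `{c₁|⋯|c_m} ↦ ∑ᵢ (-1)^|cᵢ| {c₁|⋯|cᵢ₋₁} ⊗ (∑ [{cᵢ⁽¹⁾}|⋯|{cᵢ⁽ⁿ⁾}|{cᵢ₊₁|⋯|c_m}])`, where the term with
`i = m` is zero because `[{}] = 0`. -/
noncomputable def splitOff : C.Words →ₗ[R] C.Words ⊗[R] C.BarWords :=
  wordRec (LinearMap.mk₂ R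
    (fun c (p : C.Words × C.Words ⊗[R] C.BarWords) =>
      (1 : C.Words) ⊗ₜ[R] (C.allCoprod (sgn C.gr c) * ι R (C.plus p.1)) + ι R c • p.2)
    (by intros; simp only [map_add, add_mul, tmul_add, add_smul]; abel)
    (by intros; simp only [map_smul, smul_mul_assoc, tmul_smul, smul_add, smul_assoc])
    (by intros; simp only [Prod.fst_add, Prod.snd_add, map_add, mul_add, tmul_add, smul_add]; abel)
    (by
      intro r a p
      simp only [Prod.smul_fst, Prod.smul_snd, map_smul, mul_smul_comm, tmul_smul, smul_add]
      rw [smul_comm r (ι R a)])) 0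

/-- The map `H`: for `a₁ = {c₁|⋯|c_m}`, `H (a₀[a₁|a₂|⋯|a_p]b)` is
`(-1)^|a₀| ∑_{0 < i < m} (-1)^|cᵢ| a₀{c₁|⋯|cᵢ₋₁}[{cᵢ⁽¹⁾}|⋯|{cᵢ⁽ⁿ⁾}|{cᵢ₊₁|⋯|c_m}|a₂|⋯|a_p]b`,
summed over all `n ≥ 1` and over the terms of the `n`-fold iterated coproduct of `cᵢ`. -/
noncomputable def homotopyLin : C.Triple C.BarWords →ₗ[R] C.Triple C.BarWords :=
  C.insertLeft (map LinearMap.id (LinearMap.mul' R C.BarWords) ∘ₗ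
      (TensorProduct.assoc R C.Words C.BarWords C.BarWords).toLinearMap ∘ₗ
      map C.splitOff LinearMap.id ∘ₗ C.barFirst) ∘ₗ
    map C.wordSgn.toLinearMap LinearMap.id

/-! ### The bimodules -/

/-- `M(ΩC) □ Y □ M(ΩC)` in degree `n` and with endpoints `x`, `y`. The predicate `G x' y' j g` says that
`g` is a generator of degree `j` of the part of the bicomodule `Y` with endpoints `x'`, `y'`. -/
def sandwichGr {Y : Type*} [AddCommGroup Y] [Module R Y] (G : C.Obj → C.Obj → ℕ → Y → Prop)
    (x y : C.Obj) (n : ℕ) : Submodule R (C.Triple Y) :=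
  Submodule.span R {w | ∃ (x' y' : C.Obj) (i j k : ℕ) (a : C.Words) (g : Y) (b : C.Words),
    a ∈ C.cobarGr x x' i ∧ G x' y' j g ∧ b ∈ C.cobarGr y' y k ∧ i + j + k = n ∧
      w = a ⊗ₜ[R] (g ⊗ₜ[R] b)}

/-- The generators of the bicomodule `⨁ₚ (s (M(ΩC) / u(C₀)))^□p`. -/
def barGen (x y : C.Obj) (n : ℕ) (t : C.BarWords) : Prop := ∃ p, C.IsBarWord x y p n t

/-- The homogeneous elements of `Rₓ □ C □ R_y`. -/
def homGen (x y : C.Obj) (n : ℕ) (c : C.carrier) : Prop := c ∈ C.hom x y ∧ c ∈ C.gr n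

/-! ### The Hochschild and coHochschild modules -/

/-- The degree `n` part of `⨁_(x,y) B(x, y) ⊗ (ΩC)(y, x)`, where `B = M(ΩC) □ Y □ M(ΩC)`. The direct sum
over the pairs of objects is kept as finitely supported functions, because a word of length zero
does not remember its object. -/
noncomputable def cyclicGr {Y : Type*} [AddCommGroup Y] [Module R Y] (G : C.Obj → C.Obj → ℕ → Y → Prop)
    (n : ℕ) : Submodule R (C.Obj × C.Obj →₀ C.Triple Y ⊗[R] C.Words) :=
  Submodule.span R {w | ∃ (x y : C.Obj) (i j : ℕ) (b : C.Triple Y) (m : C.Words),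
    b ∈ C.sandwichGr G x y i ∧ m ∈ C.cobarGr y x j ∧ i + j = n ∧
      w = Finsupp.single (x, y) (b ⊗ₜ[R] m)}

/-- Right multiplication by a word, `a ⊗ g ⊗ v ↦ a ⊗ g ⊗ v b`. -/
noncomputable def mulRight {Y : Type*} [AddCommGroup Y] [Module R Y] (b : C.Words) :
    C.Triple Y →ₗ[R] C.Triple Y :=
  map LinearMap.id (map LinearMap.id (LinearMap.mulRight R b))

/-- The relations of the tensor product `B ⊗ M(ΩC)` over `M(ΩC) ⊗ M(ΩC)ᵒᵖ`:
`b·a ⊗ m = b ⊗ a·m` and `a·b ⊗ m = (-1)^(|a|(|b| + |m|)) b ⊗ m·a`. -/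
noncomputable def cyclicRel {Y : Type*} [AddCommGroup Y] [Module R Y] (G : C.Obj → C.Obj → ℕ → Y → Prop) :
    Submodule R (C.Obj × C.Obj →₀ C.Triple Y ⊗[R] C.Words) :=
  Submodule.span R
    ({w | ∃ (x y z : C.Obj) (i j k : ℕ) (b : C.Triple Y) (a m : C.Words),
        b ∈ C.sandwichGr G x z i ∧ a ∈ C.cobarGr z y j ∧ m ∈ C.cobarGr y x k ∧
          w = Finsupp.single (x, y) (C.mulRight a b ⊗ₜ[R] m) -
            Finsupp.single (x, z) (b ⊗ₜ[R] (a * m))} ∪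
      {w | ∃ (x y z : C.Obj) (i j k : ℕ) (a : C.Words) (b : C.Triple Y) (m : C.Words),
        a ∈ C.cobarGr x z i ∧ b ∈ C.sandwichGr G z y j ∧ m ∈ C.cobarGr y x k ∧
          w = Finsupp.single (x, y) ((a • b) ⊗ₜ[R] m) -
            (-1 : R) ^ (i * (j + k)) • Finsupp.single (z, y) (b ⊗ₜ[R] (m * a))})

/-- The map `F ⊗ id`, where `F x` is applied on the summands `B(x, y) ⊗ (ΩC)(y, x)`. -/
noncomputable def cyclicMap {Y Z : Type*} [AddCommGroup Y] [Module R Y] [AddCommGroup Z]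
    [Module R Z] (F : C.Obj → C.Triple Y →ₗ[R] C.Triple Z) :
    (C.Obj × C.Obj →₀ C.Triple Y ⊗[R] C.Words) →ₗ[R]
      (C.Obj × C.Obj →₀ C.Triple Z ⊗[R] C.Words) :=
  Finsupp.lsum R fun q => Finsupp.lsingle q ∘ₗ map (F q.1) LinearMap.id

/-- The differential `b ⊗ m ↦ δ b ⊗ m + (-1)^|b| b ⊗ D m`, where `σ` is the parity operator
of `Y`. -/
noncomputable def cyclicDiff {Y : Type*} [AddCommGroup Y] [Module R Y]
    (δ : C.Triple Y →ₗ[R] C.Triple Y) (σ : Y →ₗ[R] Y) :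
    (C.Obj × C.Obj →₀ C.Triple Y ⊗[R] C.Words) →ₗ[R]
      (C.Obj × C.Obj →₀ C.Triple Y ⊗[R] C.Words) :=
  Finsupp.mapRange.linearMap (map δ LinearMap.id + map (C.tripleSgn σ) C.wordD)

end CategoricalCoalgebra

/-! ### Complexes and chain contractions -/

/-- The data of a non-negatively graded complex of `R`-modules that is presented as
a subquotient of a module `V`: the module of `n`-chains is `gr n / (gr n ∩ rel)`, and
the differential is induced by a linear map `diff` of `V`. Two elements of `gr n` are equal as
chains if their difference lies in `rel`. -/
structure PresentedComplex (R : Type u) [CommRing R] where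
  V : Type v
  [addCommGroup : AddCommGroup V]
  [module : Module R V]
  gr : ℕ → Submodule R V
  rel : Submodule R V
  diff : V →ₗ[R] V

namespace PresentedComplex

attribute [instance] addCommGroup module

variable {R : Type u} [CommRing R] (A B : PresentedComplex.{u, v} R)

/-- The linear map `F` induces a linear map of degree `k` from the chains of `A` to
the chains of `B`. -/
structure IsMap (k : ℕ) (F : A.V →ₗ[R] B.V) : Prop where
  mem : ∀ {n : ℕ} {w : A.V}, w ∈ A.gr n → F w ∈ B.gr (n + k)
  rel : ∀ {n : ℕ} {w : A.V}, w ∈ A.gr n → w ∈ A.rel → F w ∈ B.rel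

/-- The linear maps `F` and `F'` induce the same map from the chains of `A` to the chains of `B`. -/
def SameMap (F F' : A.V →ₗ[R] B.V) : Prop :=
  ∀ (n : ℕ) (w : A.V), w ∈ A.gr n → F w - F' w ∈ B.rel

/-- The data form a chain complex: `diff` induces a map of degree `-1` (zero on `0`-chains), and
its square is zero. -/
structure IsComplex : Prop where
  mem : ∀ {n : ℕ} {w : A.V}, w ∈ A.gr n → A.diff w ∈ Graded.lower A.gr n
  rel : ∀ {n : ℕ} {w : A.V}, w ∈ A.gr n → w ∈ A.rel → A.diff w ∈ A.rel
  sq : A.SameMap A (A.diff ∘ₗ A.diff) 0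

/-- `F` induces a chain map of degree `0`. -/
structure IsChainMap (F : A.V →ₗ[R] B.V) : Prop extends A.IsMap B 0 F where
  comm : A.SameMap B (F ∘ₗ A.diff) (B.diff ∘ₗ F)

/-- The chain maps `π : B → Q` and `α : Q → B` satisfy `π α = id`, and `H` is a chain homotopy
between `α π` and `id`. -/
structure IsChainContraction (B Q : PresentedComplex.{u, v} R) (π : B.V →ₗ[R] Q.V)
    (α : Q.V →ₗ[R] B.V) (H : B.V →ₗ[R] B.V) : Prop where
  complex_left : B.IsComplex
  complex_right : Q.IsComplex
  map_π : B.IsChainMap Q π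
  map_α : Q.IsChainMap B α
  map_H : B.IsMap B 1 H
  π_α : Q.SameMap Q (π ∘ₗ α) LinearMap.id
  homotopy : B.SameMap B (B.diff ∘ₗ H + H ∘ₗ B.diff) (α ∘ₗ π - LinearMap.id)

/-- The chain maps `F : B → B'` and `F' : Q → Q'` are compatible with the data of two contractions. -/
structure IsContractionMap (B Q : PresentedComplex.{u, v} R) (π : B.V →ₗ[R] Q.V)
    (α : Q.V →ₗ[R] B.V) (H : B.V →ₗ[R] B.V) (B' Q' : PresentedComplex.{u, v} R)
    (π' : B'.V →ₗ[R] Q'.V) (α' : Q'.V →ₗ[R] B'.V) (H' : B'.V →ₗ[R] B'.V)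
    (F : B.V →ₗ[R] B'.V) (F' : Q.V →ₗ[R] Q'.V) : Prop where
  map_left : B.IsChainMap B' F
  map_right : Q.IsChainMap Q' F'
  comm_π : B.SameMap Q' (F' ∘ₗ π) (π' ∘ₗ F)
  comm_α : Q.SameMap B' (F ∘ₗ α) (α' ∘ₗ F')
  comm_H : B.SameMap B' (F ∘ₗ H) (H' ∘ₗ F)

end PresentedComplex

namespace CategoricalCoalgebra

open TensorAlgebra TensorProduct Coalgebra Graded

variable {R : Type u} [CommRing R] (C : CategoricalCoalgebra.{u, v} R)

/-- The `(x, y)` part of the two-sided bar construction `ℬ(M(ΩC), M(ΩC), M(ΩC))`. -/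
noncomputable def barComplex (x y : C.Obj) : PresentedComplex.{u, max u v} R where
  V := C.Triple C.BarWords
  gr := C.sandwichGr C.barGen x y
  rel := ⊥
  diff := C.barDiff

/-- The `(x, y)` part of `𝒬(M(ΩC), C, M(ΩC))`. -/
noncomputable def qComplex (x y : C.Obj) : PresentedComplex.{u, max u v} R where
  V := C.Triple C.carrier
  gr := C.sandwichGr C.homGen x y
  rel := ⊥
  diff := C.qDiff

/-- The Hochschild complex of `ΩC`: the tensor product of `ℬ(M(ΩC), M(ΩC), M(ΩC))` and `M(ΩC)` over
`M(ΩC) ⊗ M(ΩC)ᵒᵖ`. -/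
noncomputable def hoch : PresentedComplex.{u, max u v} R where
  V := C.Obj × C.Obj →₀ C.Triple C.BarWords ⊗[R] C.Words
  gr := C.cyclicGr C.barGen
  rel := C.cyclicRel C.barGen
  diff := C.cyclicDiff C.barDiff C.barSgn.toLinearMap

/-- The coHochschild complex of `C`: the tensor product of `𝒬(M(ΩC), C, M(ΩC))` and `M(ΩC)` over
`M(ΩC) ⊗ M(ΩC)ᵒᵖ`. -/
noncomputable def coHoch : PresentedComplex.{u, max u v} R where
  V := C.Obj × C.Obj →₀ C.Triple C.carrier ⊗[R] C.Words
  gr := C.cyclicGr C.homGen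
  rel := C.cyclicRel C.homGen
  diff := C.cyclicDiff C.qDiff (sgn C.gr)

/-! ### The maps induced by a morphism -/

variable {C} {D : CategoricalCoalgebra.{u, v} R} (f : Hom C D)

/-- The map on objects. -/
def Hom.obj (x : C.Obj) : D.Obj := ⟨f.f₀ x, f.f₀_object x.2⟩

/-- The dg functor `Ωf`: the multiplicative extension of `{c} ↦ {f₀ c} + f₁ c`, where the element `f₁ c`
of `D₀` with its endpoints is identified with the scalar `ε (f₁ c)`. -/
noncomputable def Hom.onWords : C.Words →ₐ[R] D.Words :=
  lift R (ι R ∘ₗ (f.f₀ : C.carrier →ₗ[R] D.carrier) +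
    Algebra.linearMap R D.Words ∘ₗ counit ∘ₗ f.f₁)

/-- `[a₁|⋯|a_p] ↦ [Ωf a₁|⋯|Ωf a_p]`, where the multiples of identities in `Ωf aᵢ` are dropped. -/
noncomputable def Hom.onBarWords : C.BarWords →ₐ[R] D.BarWords :=
  lift R (ι R ∘ₗ D.plus ∘ₗ f.onWords.toLinearMap)

/-- `a₀[a₁|⋯|a_p]b ↦ (Ωf a₀)[Ωf a₁|⋯|Ωf a_p](Ωf b)`. -/
noncomputable def Hom.onBar : C.Triple C.BarWords →ₗ[R] D.Triple D.BarWords :=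
  map f.onWords.toLinearMap (map f.onBarWords.toLinearMap f.onWords.toLinearMap)

/-- `a □ c □ b ↦ (Ωf a) □ f₀ c □ (Ωf b)`. -/
noncomputable def Hom.onQ : C.Triple C.carrier →ₗ[R] D.Triple D.carrier :=
  map f.onWords.toLinearMap (map (f.f₀ : C.carrier →ₗ[R] D.carrier) f.onWords.toLinearMap)

/-- The map `F ⊗ Ωf`, which sends the summand of `(x, y)` to the summand of `(f x, f y)`. -/
noncomputable def Hom.onCyclic {Y Z : Type*} [AddCommGroup Y] [Module R Y] [AddCommGroup Z]
    [Module R Z] (F : C.Triple Y →ₗ[R] D.Triple Z) :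
    (C.Obj × C.Obj →₀ C.Triple Y ⊗[R] C.Words) →ₗ[R]
      (D.Obj × D.Obj →₀ D.Triple Z ⊗[R] D.Words) :=
  Finsupp.lsum R fun q =>
    Finsupp.lsingle (f.obj q.1, f.obj q.2) ∘ₗ map F f.onWords.toLinearMap

end CategoricalCoalgebra

-- The maps in play are compatible with the left and right actions of `ΩC` up to Koszul signs, and
-- every chain is a combination of elements `a(1 ⊗ g ⊗ 1)b`. So each identity has to be checked only
-- for `g` a bar word or an element of `C`, and the relations of the tensor product over `M(ΩC) ⊗
-- M(ΩC)ᵒᵖ` are then respected as well. `IsDGBimodule`, `IsBimoduleMap` and `IsSemilinearMap` encode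
-- this reduction; `isChainContraction_of_gen` and `isContractionMap_of_gen` collect its results.
--
-- On the bar side the tool is the extra degeneracy `s(a[a₁|⋯|a_p]b) = 1[a|a₁|⋯|a_p]b`. With the
-- augmentation `ε` and the unit map `η` it satisfies `δs = -1 + ηε - sδ` (`barDiff_degen`). As
-- `1[a|t]1 = s(a·1[t]1)`, this formula gives `δ² = 0`, the chain map property of `π` and the
-- compatibility of `Ωf` with `δ` by cases or induction on the bar length, without expanding `δ`
-- again.
--
-- On the coalgebra side everything is a convolution of linear maps on `C`. Coassociativity, the
-- counit laws and the coderivation rule become rewriting rules (`conv_assoc`, `conv_counit_left`,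
-- `conv_comp_bd`), after which `D² = 0` on letters, `d² = 0` on generators and their analogues for
-- morphisms are additive cancellations. The curvature terms of `∂²` cancel those of `D{c}`.
--
-- The map `c ↦ ∑ 1[{c⁽¹⁾}|⋯|{c⁽ⁿ⁾}]q` is determined by a recursion through `s` (`spread_eq`). A
-- solution of `E = s(f * E)` with `f` zero on `C₀` vanishes, by induction on the degree
-- (`eq_zero_of_degen_conv`). Hence an equation between such maps holds as soon as both sides
-- satisfy the same recursion. This shows that `α` is a chain map (`alphaLin_qMid`) and computes the
-- differential of the summands of `H` (`barDiff_comp_spread_barPush`).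
--
-- For the homotopy equation, `H s({c}v)` is a spread of `c` in front of `v` plus `{c} H s(v)`. The
-- equation at `s(v)`, with `δs` eliminated by the degeneracy formula, therefore implies the one at
-- `s({c}v)` (`homotopy_step`), and induction on the number of letters of the first bar entry
-- finishes.
--
-- For naturality, `Ωf` commutes with `s`, and the scalars `ε f₁(c)` in `Ωf{c}` either disappear
-- from normalized bar entries or cancel against the correction terms in the definition of a
-- morphism.

universe w w'

/-! ### Sign and projection operators on graded modules -/

namespace Graded

variable {R : Type u} [CommRing R] {M : Type v} [AddCommGroup M] [Module R M]
  (gr : ℕ → Submodule R M) [DirectSum.Decomposition gr]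

theorem scale_of_mem (f : ℕ → R) {n : ℕ} {c : M} (hc : c ∈ gr n) :
    scale gr f c = f n • c := by
  lift c to gr n using hc
  rw [scale, LinearMap.comp_apply, LinearEquiv.coe_coe, DirectSum.decomposeLinearEquiv_apply,
    DirectSum.decompose_coe]
  exact DirectSum.toModule_lof (M := fun i => gr i) R n c

/-- Linear maps that agree on the homogeneous elements are equal. -/
theorem linearMap_ext {N : Type*} [AddCommGroup N] [Module R N] {f g : M →ₗ[R] N}
    (h : ∀ n, ∀ c ∈ gr n, f c = g c) : f = g := by
  ext c
  induction c using DirectSum.Decomposition.inductionOn gr with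
  | zero => simp
  | homogeneous m => exact h _ _ m.2
  | add a b ha hb => rw [map_add, map_add, ha, hb]

theorem sgn_of_mem {n : ℕ} {c : M} (hc : c ∈ gr n) : sgn gr c = (-1 : R) ^ n • c :=
  scale_of_mem gr _ hc

theorem zeroPart_of_mem_zero {c : M} (hc : c ∈ gr 0) : zeroPart gr c = c := by
  rw [zeroPart, scale_of_mem gr _ hc, if_pos rfl, one_smul]

theorem zeroPart_of_mem {n : ℕ} {c : M} (hc : c ∈ gr n) (hn : n ≠ 0) : zeroPart gr c = 0 := by
  rw [zeroPart, scale_of_mem gr _ hc, if_neg hn, zero_smul]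

theorem posPart_of_mem_zero {c : M} (hc : c ∈ gr 0) : posPart gr c = 0 := by
  rw [posPart, scale_of_mem gr _ hc, if_pos rfl, zero_smul]

theorem posPart_of_mem {n : ℕ} {c : M} (hc : c ∈ gr n) (hn : n ≠ 0) : posPart gr c = c := by
  rw [posPart, scale_of_mem gr _ hc, if_neg hn, one_smul]

theorem neg_one_pow_mul_self (n : ℕ) : (-1 : R) ^ n * (-1) ^ n = 1 := by
  rw [← mul_pow]; simp

@[simp] theorem sgn_sgn (c : M) : sgn gr (sgn gr c) = c := by
  have : sgn gr ∘ₗ sgn gr = LinearMap.id := linearMap_ext gr fun n c hc => by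
    simp [sgn_of_mem gr hc, smul_smul, neg_one_pow_mul_self]
  exact LinearMap.congr_fun this c

theorem zeroPart_add_posPart : zeroPart gr + posPart gr = LinearMap.id :=
  linearMap_ext gr fun n c hc => by
    rcases eq_or_ne n 0 with rfl | hn
    · simp [zeroPart_of_mem_zero gr hc, posPart_of_mem_zero gr hc]
    · simp [zeroPart_of_mem gr hc hn, posPart_of_mem gr hc hn]

theorem sgn_zeroPart : sgn gr ∘ₗ zeroPart gr = zeroPart gr :=
  linearMap_ext gr fun n c hc => by
    rcases eq_or_ne n 0 with rfl | hn
    · simp [zeroPart_of_mem_zero gr hc, sgn_of_mem gr hc]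
    · simp [zeroPart_of_mem gr hc hn]

theorem zeroPart_sgn : zeroPart gr ∘ₗ sgn gr = zeroPart gr :=
  linearMap_ext gr fun n c hc => by
    rcases eq_or_ne n 0 with rfl | hn
    · simp [zeroPart_of_mem_zero gr hc, sgn_of_mem gr hc]
    · simp [zeroPart_of_mem gr hc hn, sgn_of_mem gr hc]

theorem posPart_sgn : posPart gr ∘ₗ sgn gr = sgn gr ∘ₗ posPart gr :=
  linearMap_ext gr fun n c hc => by
    rcases eq_or_ne n 0 with rfl | hn
    · simp [posPart_of_mem_zero gr hc, sgn_of_mem gr hc]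
    · simp [posPart_of_mem gr hc hn, sgn_of_mem gr hc]

theorem zeroPart_mem (c : M) : zeroPart gr c ∈ gr 0 := by
  induction c using DirectSum.Decomposition.inductionOn gr with
  | zero => simp
  | @homogeneous i m =>
    rcases eq_or_ne i 0 with rfl | hn
    · rw [zeroPart_of_mem_zero gr m.2]; exact m.2
    · rw [zeroPart_of_mem gr m.2 hn]; exact zero_mem _
  | add a b ha hb => rw [map_add]; exact add_mem ha hb

theorem swap_tmul_of_mem {i j : ℕ} {a b : M} (ha : a ∈ gr i) (hb : b ∈ gr j) :
    swap gr (a ⊗ₜ[R] b) = (-1 : R) ^ (i * j) • (b ⊗ₜ[R] a) := by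
  -- For `b` even the sign is trivial, and for `b` odd it is the parity of `a` alone.
  rcases Nat.even_or_odd j with h | h
  · simp [swap, scale_of_mem gr _ hb, h]
  · have h' : ¬ Even j := Nat.not_even_iff_odd.2 h
    simp [swap, scale_of_mem gr _ hb, h', sgn_of_mem gr ha, mul_comm i j, pow_mul, h.neg_one_pow]

theorem mem_lower_succ {N : Type*} [AddCommGroup N] [Module R N] {gr : ℕ → Submodule R N}
    {n : ℕ} {w : N} : w ∈ lower gr (n + 1) ↔ w ∈ gr n := Iff.rfl

theorem mem_lower_zero {N : Type*} [AddCommGroup N] [Module R N] {gr : ℕ → Submodule R N}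
    {w : N} : w ∈ lower gr 0 ↔ w = 0 := Submodule.mem_bot R

end Graded

namespace CategoricalCoalgebra

open TensorAlgebra TensorProduct Coalgebra Graded

variable {R : Type u} [CommRing R] (C : CategoricalCoalgebra.{u, v} R)

/-! ### Convolution -/

section Conv

variable {C}
variable {M N P Q S : Type*} [AddCommGroup M] [Module R M] [AddCommGroup N] [Module R N]
  [AddCommGroup P] [Module R P] [AddCommGroup Q] [Module R Q] [AddCommGroup S] [Module R S]

/-- The convolution `c ↦ ∑ β (f c') (g c'')`. -/
noncomputable def conv (β : M →ₗ[R] N →ₗ[R] P) (f : C.carrier →ₗ[R] M) (g : C.carrier →ₗ[R] N) :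
    C.carrier →ₗ[R] P :=
  TensorProduct.lift β ∘ₗ map f g ∘ₗ comul

/-- This form isolates the coproduct, so that identities between convolutions can be tested as
identities between linear maps on `C ⊗ C`. -/
theorem conv_eq (β : M →ₗ[R] N →ₗ[R] P) (f : C.carrier →ₗ[R] M) (g : C.carrier →ₗ[R] N) :
    conv β f g = TensorProduct.lift (β.compl₁₂ f g) ∘ₗ comul := by
  rw [conv, ← LinearMap.comp_assoc]
  congr 1
  ext; simp

/-- Both sides evaluate a linear map on the same `Δ c`. The intermediate modules may differ, which
lets a factor be transferred between the bilinear map and its arguments. -/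
theorem conv_congr {M' N' : Type*} [AddCommGroup M'] [Module R M'] [AddCommGroup N'] [Module R N']
    {β : M →ₗ[R] N →ₗ[R] P} {f : C.carrier →ₗ[R] M}
    {g : C.carrier →ₗ[R] N} {β' : M' →ₗ[R] N' →ₗ[R] P} {f' : C.carrier →ₗ[R] M'}
    {g' : C.carrier →ₗ[R] N'} (h : ∀ a b, β (f a) (g b) = β' (f' a) (g' b)) :
    conv β f g = conv β' f' g' := by
  rw [conv_eq, conv_eq]
  congr 2
  ext a b; exact h a b

/-- The composition of a convolution with a linear map. -/
theorem comp_conv {M' N' : Type*} [AddCommGroup M'] [Module R M'] [AddCommGroup N'] [Module R N']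
    {L : P →ₗ[R] Q} {β : M →ₗ[R] N →ₗ[R] P} {f : C.carrier →ₗ[R] M}
    {g : C.carrier →ₗ[R] N} {β' : M' →ₗ[R] N' →ₗ[R] Q} {f' : C.carrier →ₗ[R] M'}
    {g' : C.carrier →ₗ[R] N'} (h : ∀ a b, L (β (f a) (g b)) = β' (f' a) (g' b)) :
    L ∘ₗ conv β f g = conv β' f' g' := by
  rw [← show conv (β.compr₂ L) f g = conv β' f' g' from conv_congr h, conv, conv,
    ← LinearMap.comp_assoc]
  congr 1
  ext; simp

theorem conv_add_left (β : M →ₗ[R] N →ₗ[R] P) (f f' : C.carrier →ₗ[R] M) (g : C.carrier →ₗ[R] N) :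
    conv β (f + f') g = conv β f g + conv β f' g := by
  simp only [conv, map_add_left, LinearMap.add_comp, LinearMap.comp_add]

theorem conv_add_right (β : M →ₗ[R] N →ₗ[R] P) (f : C.carrier →ₗ[R] M) (g g' : C.carrier →ₗ[R] N) :
    conv β f (g + g') = conv β f g + conv β f g' := by
  simp only [conv, map_add_right, LinearMap.add_comp, LinearMap.comp_add]

theorem conv_smul_left (β : M →ₗ[R] N →ₗ[R] P) (r : R) (f : C.carrier →ₗ[R] M)
    (g : C.carrier →ₗ[R] N) : conv β (r • f) g = r • conv β f g := by
  simp only [conv, map_smul_left, LinearMap.smul_comp, LinearMap.comp_smul]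

theorem conv_smul_right (β : M →ₗ[R] N →ₗ[R] P) (r : R) (f : C.carrier →ₗ[R] M)
    (g : C.carrier →ₗ[R] N) : conv β f (r • g) = r • conv β f g := by
  simp only [conv, map_smul_right, LinearMap.smul_comp, LinearMap.comp_smul]

theorem conv_neg_left (β : M →ₗ[R] N →ₗ[R] P) (f : C.carrier →ₗ[R] M) (g : C.carrier →ₗ[R] N) :
    conv β (-f) g = -conv β f g := by
  simpa using conv_smul_left β (-1) f g

theorem conv_neg_right (β : M →ₗ[R] N →ₗ[R] P) (f : C.carrier →ₗ[R] M) (g : C.carrier →ₗ[R] N) :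
    conv β f (-g) = -conv β f g := by
  simpa using conv_smul_right β (-1) f g

theorem conv_sub_left (β : M →ₗ[R] N →ₗ[R] P) (f f' : C.carrier →ₗ[R] M) (g : C.carrier →ₗ[R] N) :
    conv β (f - f') g = conv β f g - conv β f' g := by
  rw [sub_eq_add_neg, conv_add_left, conv_neg_left, sub_eq_add_neg]

theorem conv_sub_right (β : M →ₗ[R] N →ₗ[R] P) (f : C.carrier →ₗ[R] M) (g g' : C.carrier →ₗ[R] N) :
    conv β f (g - g') = conv β f g - conv β f g' := by
  rw [sub_eq_add_neg, conv_add_right, conv_neg_right, sub_eq_add_neg]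

theorem conv_zero_left (β : M →ₗ[R] N →ₗ[R] P) (g : C.carrier →ₗ[R] N) :
    conv β (0 : C.carrier →ₗ[R] M) g = 0 := by
  simpa using conv_smul_left β 0 (0 : C.carrier →ₗ[R] M) g

theorem conv_zero_right (β : M →ₗ[R] N →ₗ[R] P) (f : C.carrier →ₗ[R] M) :
    conv β f (0 : C.carrier →ₗ[R] N) = 0 := by
  simpa using conv_smul_right β 0 f (0 : C.carrier →ₗ[R] N)

/-- The associativity of the convolution. -/
theorem conv_assoc {T : Type*} [AddCommGroup T] [Module R T]
    {β₁ : Q →ₗ[R] P →ₗ[R] S} {β₂ : M →ₗ[R] N →ₗ[R] Q} {β₃ : M →ₗ[R] T →ₗ[R] S}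
    {β₄ : N →ₗ[R] P →ₗ[R] T} {f : C.carrier →ₗ[R] M} {g : C.carrier →ₗ[R] N}
    {k : C.carrier →ₗ[R] P}
    (h : ∀ a b c, β₁ (β₂ (f a) (g b)) (k c) = β₃ (f a) (β₄ (g b) (k c))) :
    conv β₁ (conv β₂ f g) k = conv β₃ f (conv β₄ g k) := by
  have e1 : conv β₁ (conv β₂ f g) k =
      (TensorProduct.lift (β₁.compl₁₂ (TensorProduct.lift (β₂.compl₁₂ f g)) k)) ∘ₗ
        (comul.rTensor C.carrier) ∘ₗ comul := by
    rw [conv_eq, conv_eq, ← LinearMap.comp_assoc]; congr 1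
    ext; simp
  have e2 : conv β₃ f (conv β₄ g k) =
      (TensorProduct.lift (β₃.compl₁₂ f (TensorProduct.lift (β₄.compl₁₂ g k)))) ∘ₗ
        (comul.lTensor C.carrier) ∘ₗ comul := by
    rw [conv_eq, conv_eq, ← LinearMap.comp_assoc]; congr 1
    ext; simp
  rw [e1, e2, ← coassoc, ← LinearMap.comp_assoc, ← LinearMap.comp_assoc, ← LinearMap.comp_assoc]
  congr 2
  ext a b c; simpa using h a b c

/-- By the counit law a multiple of the counit acts as a constant. This evaluates the inhomogeneous
terms of the later recursions. -/
theorem conv_counit_left (β : M →ₗ[R] N →ₗ[R] P) (m : M) (g : C.carrier →ₗ[R] N) :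
    conv β (LinearMap.toSpanSingleton R M m ∘ₗ counit) g = β m ∘ₗ g := by
  have : conv β (LinearMap.toSpanSingleton R M m ∘ₗ counit) g =
      (TensorProduct.lift ((LinearMap.lsmul R P).compl₁₂ LinearMap.id (β m ∘ₗ g))) ∘ₗ
        (counit.rTensor C.carrier) ∘ₗ comul := by
    rw [conv_eq, ← LinearMap.comp_assoc]; congr 1
    ext; simp
  rw [this, rTensor_counit_comp_comul]
  ext; simp

theorem conv_counit_right (β : M →ₗ[R] N →ₗ[R] P) (n : N) (f : C.carrier →ₗ[R] M) :
    conv β f (LinearMap.toSpanSingleton R N n ∘ₗ counit) = β.flip n ∘ₗ f := by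
  have : conv β f (LinearMap.toSpanSingleton R N n ∘ₗ counit) =
      (TensorProduct.lift ((LinearMap.lsmul R P).flip.compl₁₂ (β.flip n ∘ₗ f) LinearMap.id)) ∘ₗ
        (counit.lTensor C.carrier) ∘ₗ comul := by
    rw [conv_eq, ← LinearMap.comp_assoc]; congr 1
    ext; simp
  rw [this, lTensor_counit_comp_comul]
  ext; simp

theorem map_comp_comp {f : C.carrier →ₗ[R] M} {g : C.carrier →ₗ[R] N}
    {f' g' : C.carrier →ₗ[R] C.carrier} (k : C.carrier →ₗ[R] C.carrier ⊗[R] C.carrier) :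
    map f g ∘ₗ map f' g' ∘ₗ k = map (f ∘ₗ f') (g ∘ₗ g') ∘ₗ k := by
  rw [map_comp, LinearMap.comp_assoc]

/-- This is the coderivation rule; moving `∂` past the first leg produces the parity operator there.
-/
theorem conv_comp_bd (β : M →ₗ[R] N →ₗ[R] P) (f : C.carrier →ₗ[R] M) (g : C.carrier →ₗ[R] N) :
    conv β f g ∘ₗ C.bd = conv β (f ∘ₗ C.bd) g + conv β (f ∘ₗ sgn C.gr) (g ∘ₗ C.bd) := by
  rw [conv, LinearMap.comp_assoc, LinearMap.comp_assoc, C.comul_bd, LinearMap.add_comp,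
    LinearMap.comp_add, LinearMap.comp_add, conv, conv]
  congr 1
  · rw [map_comp_comp (f := f) (g := g), LinearMap.comp_id]
  · rw [map_comp_comp (f := f) (g := g)]

/-- Two linear maps on `C ⊗ C` that agree on the tensors of degree `n` agree on `Δ c`. -/
theorem comul_congr {n : ℕ} {c : C.carrier} (hc : c ∈ C.gr n)
    {f g : C.carrier ⊗[R] C.carrier →ₗ[R] M}
    (h : ∀ i j a b, a ∈ C.gr i → b ∈ C.gr j → i + j = n → f (a ⊗ₜ b) = g (a ⊗ₜ b)) :
    f (comul c) = g (comul c) := by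
  have := C.comul_mem hc
  rw [tensorGr] at this
  refine LinearMap.eqOn_span (f := f) (g := g) ?_ this
  rintro _ ⟨i, j, a, b, ha, hb, e, rfl⟩
  exact h i j a b ha hb e

/-- The coproduct preserves the total degree, so `(-1)^n` splits as a product over the two legs. -/
theorem comul_sgn : (comul : C.carrier →ₗ[R] C.carrier ⊗[R] C.carrier) ∘ₗ sgn C.gr =
    map (sgn C.gr) (sgn C.gr) ∘ₗ comul :=
  linearMap_ext C.gr fun n c hc => by
    rw [LinearMap.comp_apply, sgn_of_mem C.gr hc, map_smul, LinearMap.comp_apply]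
    refine comul_congr hc (f := (-1 : R) ^ n • LinearMap.id) fun i j a b ha hb e => ?_
    subst e
    simp [sgn_of_mem C.gr ha, sgn_of_mem C.gr hb, pow_add, smul_tmul', tmul_smul, smul_smul, mul_comm]

theorem conv_comp_sgn (β : M →ₗ[R] N →ₗ[R] P) (f : C.carrier →ₗ[R] M) (g : C.carrier →ₗ[R] N) :
    conv β f g ∘ₗ sgn C.gr = conv β (f ∘ₗ sgn C.gr) (g ∘ₗ sgn C.gr) := by
  rw [conv, LinearMap.comp_assoc, LinearMap.comp_assoc, comul_sgn,
    map_comp_comp, conv]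

/-- A linear map vanishes if it is a convolution of itself with a map that vanishes on `C₀`. -/
theorem eq_zero_of_conv {E : C.carrier →ₗ[R] N} {f : C.carrier →ₗ[R] M}
    {β : M →ₗ[R] N →ₗ[R] N} (hf : ∀ c ∈ C.gr 0, f c = 0) (h : E = conv β f E) : E = 0 := by
  refine linearMap_ext C.gr fun n => ?_
  induction n using Nat.strong_induction_on with
  | _ n ih =>
    intro c hc
    rw [h, conv_eq, LinearMap.comp_apply]
    refine comul_congr hc (f := TensorProduct.lift (β.compl₁₂ f E)) (g := 0)
      fun i j a b ha hb e => ?_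
    -- Either the first leg has degree zero and is killed by `f`, or the second leg has degree less
    -- than `n` and the induction hypothesis applies.
    rcases Nat.eq_zero_or_pos i with rfl | hi
    · simp [hf a ha]
    · simp [ih j (by omega) b hb]

/-- The convolution with a map that vanishes on `C₀` only depends on the values in
lower degrees. -/
theorem conv_congr_of_lt {f : C.carrier →ₗ[R] M} {g g' : C.carrier →ₗ[R] N}
    {β : M →ₗ[R] N →ₗ[R] P} (hf : ∀ c ∈ C.gr 0, f c = 0) {n : ℕ} {c : C.carrier}
    (hc : c ∈ C.gr n) (h : ∀ m < n, ∀ b ∈ C.gr m, g b = g' b) : conv β f g c = conv β f g' c := by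
  rw [conv_eq, conv_eq]
  refine comul_congr hc (f := TensorProduct.lift (β.compl₁₂ f g))
    (g := TensorProduct.lift (β.compl₁₂ f g')) fun i j a b ha hb e => ?_
  rcases Nat.eq_zero_or_pos i with rfl | hi
  · simp [hf a ha]
  · simp [h j (by omega) b hb]

end Conv

/-! ### The parity operator, the counit and the curvature -/

variable {C}

theorem bd_comp_sgn : C.bd ∘ₗ sgn C.gr = -(sgn C.gr ∘ₗ C.bd) :=
  linearMap_ext C.gr fun n c hc => by
    have := C.bd_mem hc
    cases n with
    | zero =>
      rw [mem_lower_zero] at this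
      simp [sgn_of_mem C.gr hc, this]
    | succ n =>
      rw [mem_lower_succ] at this
      simp [sgn_of_mem C.gr hc, sgn_of_mem C.gr this, pow_succ]

theorem bd_of_mem_zero {c : C.carrier} (hc : c ∈ C.gr 0) : C.bd c = 0 := C.bd_mem hc

theorem curv_comp_sgn : C.curv ∘ₗ sgn C.gr = C.curv :=
  linearMap_ext C.gr fun n c hc => by
    rcases eq_or_ne n 2 with rfl | hn
    · simp [sgn_of_mem C.gr hc]
    · simp [sgn_of_mem C.gr hc, C.curv_eq_zero hc hn]

theorem counit_comp_sgn : counit ∘ₗ sgn C.gr = (counit : C.carrier →ₗ[R] R) :=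
  linearMap_ext C.gr fun n c hc => by
    rcases eq_or_ne n 0 with rfl | hn
    · simp [sgn_of_mem C.gr hc]
    · simp [sgn_of_mem C.gr hc, C.counit_eq_zero hc hn]

theorem counit_comp_posPart : counit ∘ₗ posPart C.gr = (0 : C.carrier →ₗ[R] R) :=
  linearMap_ext C.gr fun n c hc => by
    rcases eq_or_ne n 0 with rfl | hn
    · simp [posPart_of_mem_zero C.gr hc]
    · simp [posPart_of_mem C.gr hc hn, C.counit_eq_zero hc hn]

/-- Since `∂` has no component in `C₀`, the truncation in `{∂c}` does nothing. -/
theorem posPart_comp_bd : posPart C.gr ∘ₗ C.bd = C.bd := by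
  have := congrArg (· ∘ₗ C.bd) (zeroPart_add_posPart C.gr)
  simpa [LinearMap.add_comp, C.zeroPart_bd] using this

theorem counit_comp_bd : counit ∘ₗ C.bd = (0 : C.carrier →ₗ[R] R) := by
  rw [← posPart_comp_bd, ← LinearMap.comp_assoc, counit_comp_posPart, LinearMap.zero_comp]

theorem brace_apply (c : C.carrier) : C.brace c = ι R (posPart C.gr c) := rfl

theorem brace_of_mem_zero {c : C.carrier} (hc : c ∈ C.gr 0) : C.brace c = 0 := by
  rw [brace_apply, posPart_of_mem_zero C.gr hc, map_zero]

theorem brace_of_mem {n : ℕ} {c : C.carrier} (hc : c ∈ C.gr n) (hn : n ≠ 0) :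
    C.brace c = ι R c := by
  rw [brace_apply, posPart_of_mem C.gr hc hn]

theorem brace_sgn_of_mem_zero {c : C.carrier} (hc : c ∈ C.gr 0) :
    (C.brace ∘ₗ sgn C.gr) c = 0 := by
  simp [sgn_of_mem C.gr hc, brace_of_mem_zero hc]

theorem brace_bd (c : C.carrier) : C.brace (C.bd c) = ι R (C.bd c) := by
  rw [brace_apply]; exact congrArg _ (LinearMap.congr_fun posPart_comp_bd c)

end CategoricalCoalgebra

/-! ### The square of the boundary as a difference of convolutions -/

namespace CategoricalCoalgebra

open TensorAlgebra TensorProduct Coalgebra Graded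

variable {R : Type u} [CommRing R] {C : CategoricalCoalgebra.{u, v} R}

section
variable {M N P : Type*} [AddCommGroup M] [Module R M] [AddCommGroup N] [Module R N]
  [AddCommGroup P] [Module R P]

/-- Linear maps on `C ⊗ C` that agree on the homogeneous tensors are equal. -/
theorem tensor_ext {f g : C.carrier ⊗[R] C.carrier →ₗ[R] M}
    (h : ∀ i j, ∀ a ∈ C.gr i, ∀ b ∈ C.gr j, f (a ⊗ₜ b) = g (a ⊗ₜ b)) : f = g := by
  have : (TensorProduct.mk R C.carrier C.carrier).compr₂ f =
      (TensorProduct.mk R C.carrier C.carrier).compr₂ g :=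
    linearMap_ext C.gr fun i a ha => linearMap_ext C.gr fun j b hb => h i j a ha b hb
  exact TensorProduct.ext this

/-- The curvature sees only degree two, which is even, so the Koszul sign in `Δᵒᵖ` is trivial on
every surviving term. -/
theorem bd_bd_eq : C.bd ∘ₗ C.bd = conv (LinearMap.lsmul R C.carrier) C.curv LinearMap.id -
    conv (LinearMap.lsmul R C.carrier).flip LinearMap.id C.curv := by
  rw [C.bd_bd, LinearMap.comp_sub, LinearMap.comp_sub, conv_eq, conv_eq]
  simp only [← LinearMap.comp_assoc]
  congr 2
  · ext; simp
  · refine tensor_ext fun i j a ha b hb => ?_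
    rcases eq_or_ne j 2 with rfl | hj
    · simp [swap_tmul_of_mem C.gr ha hb]
    · simp [swap_tmul_of_mem C.gr ha hb, C.curv_eq_zero hb hj]

end

/-! ### The algebra of words -/

@[simp] theorem wordSgn_ι (c : C.carrier) : C.wordSgn (ι R c) = -ι R (sgn C.gr c) := by
  simp [wordSgn]

@[simp] theorem wordSgn_wordSgn (w : C.Words) : C.wordSgn (C.wordSgn w) = w := by
  have : C.wordSgn.comp C.wordSgn = AlgHom.id R _ := by
    ext c; simp
  exact AlgHom.congr_fun this w

theorem wordSgn_brace (c : C.carrier) : C.wordSgn (C.brace c) = -C.brace (sgn C.gr c) := by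
  rw [brace_apply, wordSgn_ι, brace_apply]
  exact congrArg (fun x => -ι R x) (LinearMap.congr_fun (posPart_sgn C.gr) c).symm

@[simp] theorem wordD_one : C.wordD 1 = 0 := wordRec_one _ _

theorem wordD_ι_mul (c : C.carrier) (w : C.Words) :
    C.wordD (ι R c * w) = C.letterD c * w - ι R (sgn C.gr c) * C.wordD w :=
  wordRec_ι_mul _ _ _ _

theorem wordD_algebraMap (r : R) : C.wordD (algebraMap R _ r) = 0 := by
  rw [Algebra.algebraMap_eq_smul_one, map_smul, wordD_one, smul_zero]

theorem wordD_ι (c : C.carrier) : C.wordD (ι R c) = C.letterD c := by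
  simpa using C.wordD_ι_mul c 1

/-- `D` is a derivation. -/
theorem wordD_mul (a b : C.Words) :
    C.wordD (a * b) = C.wordD a * b + C.wordSgn a * C.wordD b := by
  induction a using TensorAlgebra.induction generalizing b with
  | algebraMap r => rw [wordD_algebraMap, AlgHom.commutes, ← Algebra.smul_def, ← Algebra.smul_def]; simp
  | ι c => rw [wordD_ι_mul, wordD_ι, wordSgn_ι, neg_mul, sub_eq_add_neg]
  | mul a a' ha ha' => rw [mul_assoc, ha, ha', ha, map_mul]; noncomm_ring
  | add a a' ha ha' => rw [add_mul, map_add, ha, ha', map_add, map_add]; noncomm_ring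

theorem letterD_eq : C.letterD = Algebra.linearMap R C.Words ∘ₗ C.curv - ι R ∘ₗ C.bd -
    conv (LinearMap.mul R C.Words) (C.brace ∘ₗ sgn C.gr) C.brace := rfl

/-- With this vanishing on `C₀`, where `{c} = 0`, the formula for `D{c}` needs no restriction on the
degree of `c`. -/
theorem letterD_of_mem_zero {c : C.carrier} (hc : c ∈ C.gr 0) : C.letterD c = 0 := by
  have h : conv (LinearMap.mul R C.Words) (C.brace ∘ₗ sgn C.gr) C.brace c = 0 := by
    rw [conv_congr_of_lt (g' := 0) (fun c hc => brace_sgn_of_mem_zero hc) hc (by simp),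
      conv_zero_right]; rfl
  simp [letterD_eq, C.curv_eq_zero hc, bd_of_mem_zero hc, h]

theorem wordD_brace (c : C.carrier) : C.wordD (C.brace c) = C.letterD c := by
  have : C.wordD ∘ₗ C.brace = C.letterD := linearMap_ext C.gr fun n c hc => by
    rcases eq_or_ne n 0 with rfl | hn
    · simp [brace_of_mem_zero hc, letterD_of_mem_zero hc]
    · simp [brace_of_mem hc hn, wordD_ι]
  exact LinearMap.congr_fun this c

/-! The maps `{-}`, `{sgn -}`, `{∂ -}` under the operators. -/

theorem brace_sgn_sgn : (C.brace ∘ₗ sgn C.gr) ∘ₗ sgn C.gr = C.brace := by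
  ext; simp

theorem wordD_comp_brace : C.wordD ∘ₗ C.brace = C.letterD := LinearMap.ext wordD_brace

theorem brace_comp_bd : C.brace ∘ₗ C.bd = ι R ∘ₗ C.bd := LinearMap.ext brace_bd

theorem brace_bd_sgn : (C.brace ∘ₗ C.bd) ∘ₗ sgn C.gr = -((C.brace ∘ₗ sgn C.gr) ∘ₗ C.bd) := by
  rw [LinearMap.comp_assoc, bd_comp_sgn, LinearMap.comp_neg, LinearMap.comp_assoc]

theorem letterD_eq' : C.letterD = Algebra.linearMap R C.Words ∘ₗ C.curv - C.brace ∘ₗ C.bd -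
    conv (LinearMap.mul R C.Words) (C.brace ∘ₗ sgn C.gr) C.brace := by
  rw [letterD_eq, brace_comp_bd]

theorem letterD_sgn : C.letterD ∘ₗ sgn C.gr = Algebra.linearMap R C.Words ∘ₗ C.curv +
    (C.brace ∘ₗ sgn C.gr) ∘ₗ C.bd -
      conv (LinearMap.mul R C.Words) C.brace (C.brace ∘ₗ sgn C.gr) := by
  rw [letterD_eq', LinearMap.sub_comp, LinearMap.sub_comp, LinearMap.comp_assoc, curv_comp_sgn,
    conv_comp_sgn, brace_sgn_sgn, brace_bd_sgn]
  abel

/-- This is the statement that `D` is odd, on letters. The parity operator of words takes the letter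
`c` to minus the letter `sgn c`, which absorbs the expected sign. -/
theorem wordSgn_comp_letterD :
    C.wordSgn.toLinearMap ∘ₗ C.letterD = C.letterD ∘ₗ sgn C.gr := by
  have h : C.wordSgn.toLinearMap ∘ₗ conv (LinearMap.mul R C.Words) (C.brace ∘ₗ sgn C.gr) C.brace =
      conv (LinearMap.mul R C.Words) C.brace (C.brace ∘ₗ sgn C.gr) :=
    comp_conv fun a b => by simp [wordSgn_brace]
  rw [letterD_eq', LinearMap.comp_sub, LinearMap.comp_sub, h, ← letterD_eq', letterD_sgn]
  congr 1
  ext c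
  simp [wordSgn_brace]

theorem wordSgn_wordD (w : C.Words) : C.wordSgn (C.wordD w) = -C.wordD (C.wordSgn w) := by
  induction w using TensorAlgebra.induction with
  | algebraMap r => simp [wordD_algebraMap]
  | ι c =>
    rw [wordD_ι, wordSgn_ι, map_neg, wordD_ι, neg_neg]
    exact LinearMap.congr_fun wordSgn_comp_letterD c
  | mul a b ha hb => rw [wordD_mul, map_add, map_mul, map_mul, map_mul, wordD_mul, ha, hb]; noncomm_ring
  | add a b ha hb => rw [map_add, map_add, ha, hb, map_add, map_add]; abel

/-- The term `{∂²c}` cancels the curvature terms that arise from differentiating the quadratic part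
of `D{c}`. The remaining quadratic terms cancel by the coderivation rule, the cubic ones by
coassociativity (`h6`), and the scalar term vanishes because `h∂ = 0`. -/
theorem wordD_comp_letterD : C.wordD ∘ₗ C.letterD = 0 := by
  have h1 : C.wordD ∘ₗ conv (LinearMap.mul R C.Words) (C.brace ∘ₗ sgn C.gr) C.brace =
      conv (LinearMap.mul R C.Words) (C.letterD ∘ₗ sgn C.gr) C.brace -
        conv (LinearMap.mul R C.Words) C.brace C.letterD := by
    rw [conv_eq, conv_eq, conv_eq, ← LinearMap.sub_comp, ← LinearMap.comp_assoc]
    congr 1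
    ext a b
    simp [wordD_mul, wordD_brace, wordSgn_brace, sub_eq_add_neg]
  have h2 : C.wordD ∘ₗ Algebra.linearMap R C.Words ∘ₗ C.curv = 0 := by
    ext c; simp [wordD_algebraMap]
  have h3 : C.wordD ∘ₗ C.brace ∘ₗ C.bd = C.letterD ∘ₗ C.bd := by
    rw [← LinearMap.comp_assoc, wordD_comp_brace]
  have h4 : C.letterD ∘ₗ C.bd = -(C.brace ∘ₗ C.bd ∘ₗ C.bd) -
      conv (LinearMap.mul R C.Words) ((C.brace ∘ₗ sgn C.gr) ∘ₗ C.bd) C.brace -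
      conv (LinearMap.mul R C.Words) C.brace (C.brace ∘ₗ C.bd) := by
    rw [letterD_eq', LinearMap.sub_comp, LinearMap.sub_comp, LinearMap.comp_assoc, C.curv_bd,
      LinearMap.comp_zero, conv_comp_bd, brace_sgn_sgn, LinearMap.comp_assoc]
    abel
  have h5 : C.brace ∘ₗ C.bd ∘ₗ C.bd =
      conv (LinearMap.mul R C.Words) (Algebra.linearMap R C.Words ∘ₗ C.curv) C.brace -
      conv (LinearMap.mul R C.Words) C.brace (Algebra.linearMap R C.Words ∘ₗ C.curv) := by
    rw [bd_bd_eq, LinearMap.comp_sub]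
    congr 1
    · exact comp_conv fun a b => by simp [Algebra.smul_def]
    · exact comp_conv fun a b => by
        simp only [LinearMap.flip_apply, LinearMap.lsmul_apply, LinearMap.id_apply, map_smul,
          LinearMap.mul_apply', LinearMap.comp_apply, Algebra.linearMap_apply]
        rw [← Algebra.commutes, Algebra.smul_def]
  -- The two ways of splitting a letter into three carry opposite signs in `D²`.
  have h6 : conv (LinearMap.mul R C.Words)
        (conv (LinearMap.mul R C.Words) C.brace (C.brace ∘ₗ sgn C.gr)) C.brace =
      conv (LinearMap.mul R C.Words) C.brace
        (conv (LinearMap.mul R C.Words) (C.brace ∘ₗ sgn C.gr) C.brace) :=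
    conv_assoc fun a b c => by simp [mul_assoc]
  nth_rw 1 [letterD_eq']
  rw [LinearMap.comp_sub, LinearMap.comp_sub, h1, h2, h3, h4, h5, letterD_sgn, conv_sub_left,
    conv_add_left, h6, letterD_eq', conv_sub_right, conv_sub_right]
  abel

/-- `D² = 0`. -/
theorem wordD_wordD (w : C.Words) : C.wordD (C.wordD w) = 0 := by
  induction w using TensorAlgebra.induction with
  | algebraMap r => simp [wordD_algebraMap]
  | ι c => rw [wordD_ι]; exact LinearMap.congr_fun wordD_comp_letterD c
  | mul a b ha hb =>
    rw [wordD_mul, map_add, wordD_mul, wordD_mul, ha, hb, wordSgn_wordD]; simp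
  | add a b ha hb => rw [map_add, map_add, ha, hb, add_zero]

/-! ### The coefficient of the empty word -/

@[simp] theorem wordCoeff_one : C.wordCoeff 1 = 1 := map_one (algebraMapInv (R := R))

theorem wordCoeff_mul (a b : C.Words) : C.wordCoeff (a * b) = C.wordCoeff a * C.wordCoeff b :=
  map_mul (algebraMapInv (R := R)) a b

@[simp] theorem wordCoeff_ι (c : C.carrier) : C.wordCoeff (ι R c) = 0 := by
  simp [wordCoeff, algebraMapInv]

theorem plus_apply (w : C.Words) : C.plus w = w - C.wordCoeff w • (1 : C.Words) := by
  simp [plus, Algebra.algebraMap_eq_smul_one]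

theorem plus_of_wordCoeff {w : C.Words} (h : C.wordCoeff w = 0) : C.plus w = w := by
  simp [plus_apply, h]

@[simp] theorem plus_one : C.plus 1 = 0 := by simp [plus_apply]

@[simp] theorem wordCoeff_plus (w : C.Words) : C.wordCoeff (C.plus w) = 0 := by
  simp [plus_apply]

@[simp] theorem plus_plus (w : C.Words) : C.plus (C.plus w) = C.plus w :=
  plus_of_wordCoeff (wordCoeff_plus w)

@[simp] theorem plus_ι (c : C.carrier) : C.plus (ι R c) = ι R c := plus_of_wordCoeff (by simp)

@[simp] theorem wordCoeff_wordSgn (w : C.Words) : C.wordCoeff (C.wordSgn w) = C.wordCoeff w := by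
  have : (algebraMapInv : C.Words →ₐ[R] R).comp C.wordSgn = algebraMapInv := by
    ext c; simp [algebraMapInv]
  exact AlgHom.congr_fun this w

theorem plus_wordSgn (w : C.Words) : C.plus (C.wordSgn w) = C.wordSgn (C.plus w) := by
  simp [plus_apply]

theorem wordD_plus (w : C.Words) : C.wordD (C.plus w) = C.wordD w := by
  simp [plus_apply]

end CategoricalCoalgebra

namespace CategoricalCoalgebra

open TensorAlgebra TensorProduct Coalgebra Graded

variable {R : Type u} [CommRing R] {C : CategoricalCoalgebra.{u, v} R}

/-! ### Calculus in `T ⊗ Y ⊗ T` -/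

section Triple

variable {Y Z : Type*} [AddCommGroup Y] [Module R Y] [AddCommGroup Z] [Module R Z]

theorem smul_triple (a a' : C.Words) (q : Y ⊗[R] C.Words) :
    a • (a' ⊗ₜ[R] q : C.Triple Y) = (a * a') ⊗ₜ[R] q := rfl

@[simp] theorem mulRight_tmul (b a : C.Words) (y : Y) (v : C.Words) :
    C.mulRight b (a ⊗ₜ[R] (y ⊗ₜ[R] v)) = a ⊗ₜ[R] (y ⊗ₜ[R] (v * b)) := rfl

/-- Induction on the elements of `T ⊗ Y ⊗ T`. -/
theorem triple_induction {p : C.Triple Y → Prop} (u : C.Triple Y)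
    (h : ∀ a y b, p (a ⊗ₜ[R] (y ⊗ₜ[R] b))) (hadd : ∀ u v, p u → p v → p (u + v)) : p u := by
  have h0 : p 0 := by simpa using h 0 0 0
  induction u using TensorProduct.induction_on with
  | zero => exact h0
  | add u v hu hv => exact hadd u v hu hv
  | tmul a q =>
    induction q using TensorProduct.induction_on with
    | zero => simpa using h0
    | add u v hu hv => rw [tmul_add]; exact hadd _ _ hu hv
    | tmul y b => exact h a y b

theorem mulRight_smul (b a : C.Words) (u : C.Triple Y) :
    C.mulRight b (a • u) = a • C.mulRight b u := by
  induction u using triple_induction with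
  | h a' y v => rfl
  | hadd u v hu hv => rw [smul_add, map_add, map_add, smul_add, hu, hv]

theorem mulRight_mulRight (b a : C.Words) (u : C.Triple Y) :
    C.mulRight b (C.mulRight a u) = C.mulRight (a * b) u := by
  induction u using triple_induction with
  | h a' y v => simp [mul_assoc]
  | hadd u v hu hv => rw [map_add, map_add, map_add, hu, hv]

@[simp] theorem mulRight_one (u : C.Triple Y) : C.mulRight 1 u = u := by
  induction u using triple_induction with
  | h a' y v => simp
  | hadd u v hu hv => rw [map_add, hu, hv]

theorem mulRight_add (a b : C.Words) (u : C.Triple Y) :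
    C.mulRight (a + b) u = C.mulRight a u + C.mulRight b u := by
  induction u using triple_induction with
  | h a' y v => simp [mul_add, tmul_add]
  | hadd u v hu hv => rw [map_add, map_add, map_add, hu, hv]; abel

theorem mulRight_rsmul (r : R) (b : C.Words) (u : C.Triple Y) :
    C.mulRight (r • b) u = r • C.mulRight b u := by
  induction u using triple_induction with
  | h a' y v => simp
  | hadd u v hu hv => rw [map_add, map_add, hu, hv, smul_add]

@[simp] theorem mulRight_zero (u : C.Triple Y) : C.mulRight 0 u = 0 := by
  simpa using mulRight_rsmul 0 (0 : C.Words) u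

variable (C Y) in
/-- The left action of `T` on `T ⊗ Y ⊗ T`. -/
noncomputable def lact : C.Words →ₗ[R] C.Triple Y →ₗ[R] C.Triple Y :=
  LinearMap.mk₂ R (fun a u => a • u) add_smul (fun r a u => smul_assoc r a u) smul_add
    (fun r a u => smul_comm a r u)

variable (C Y) in
/-- The right action of `T` on `T ⊗ Y ⊗ T`. -/
noncomputable def ract : C.Triple Y →ₗ[R] C.Words →ₗ[R] C.Triple Y :=
  (LinearMap.mk₂ R (fun b u => C.mulRight b u) mulRight_add mulRight_rsmul
    (fun _ => map_add _) (fun _ _ _ => map_smul _ _ _)).flip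

@[simp] theorem lact_apply (a : C.Words) (u : C.Triple Y) : C.lact Y a u = a • u := rfl

@[simp] theorem ract_apply (a : C.Words) (u : C.Triple Y) : C.ract Y u a = C.mulRight a u := rfl

/-- Thus `T ⊗ Y ⊗ T` is generated as a bimodule by the elements `1 ⊗ y ⊗ 1`; the later reductions to
generators rest on this. -/
theorem tmul_eq_smul_mulRight (a : C.Words) (y : Y) (b : C.Words) :
    a ⊗ₜ[R] (y ⊗ₜ[R] b) = a • C.mulRight b (1 ⊗ₜ[R] (y ⊗ₜ[R] 1)) := by
  simp [smul_triple]

variable (C Y) in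
/-- The map `y ↦ 1 ⊗ y ⊗ 1`. -/
noncomputable def mid : Y →ₗ[R] C.Triple Y :=
  TensorProduct.mk R C.Words _ 1 ∘ₗ (TensorProduct.mk R Y C.Words).flip 1

@[simp] theorem mid_apply (y : Y) : C.mid Y y = 1 ⊗ₜ[R] (y ⊗ₜ[R] 1) := rfl

theorem assoc_tmul (q : C.Words ⊗[R] Z) (b : C.Words) :
    TensorProduct.assoc R C.Words Z C.Words (q ⊗ₜ b) =
      C.mulRight b (TensorProduct.assoc R C.Words Z C.Words (q ⊗ₜ 1)) := by
  induction q using TensorProduct.induction_on with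
  | zero => simp
  | add p q hp hq => rw [add_tmul, add_tmul, map_add, map_add, map_add, hp, hq]
  | tmul a z => simp

theorem insertLeft_tmul (F : Y →ₗ[R] C.Words ⊗[R] Z) (a : C.Words) (y : Y) (b : C.Words) :
    C.insertLeft F (a ⊗ₜ[R] (y ⊗ₜ[R] b)) =
      a • C.mulRight b (TensorProduct.assoc R C.Words Z C.Words (F y ⊗ₜ 1)) := by
  rw [← assoc_tmul]; rfl

theorem insertRight_tmul (F : Y →ₗ[R] Z ⊗[R] C.Words) (a : C.Words) (y : Y) (b : C.Words) :
    C.insertRight F (a ⊗ₜ[R] (y ⊗ₜ[R] b)) = a • C.mulRight b (1 ⊗ₜ[R] F y) := by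
  simp only [insertRight, map_tmul, LinearMap.id_apply, LinearMap.comp_apply]
  generalize F y = q
  induction q using TensorProduct.induction_on with
  | zero => simp
  | add p q hp hq =>
    rw [add_tmul, map_add, map_add, tmul_add, hp, hq, tmul_add, map_add, smul_add]
  | tmul z v => simp [smul_triple]

theorem insertLeft_smul (F : Y →ₗ[R] C.Words ⊗[R] Z) (a : C.Words) (u : C.Triple Y) :
    C.insertLeft F (a • u) = a • C.insertLeft F u := by
  induction u using triple_induction with
  | h a' y v => rw [smul_triple, insertLeft_tmul, insertLeft_tmul, mul_smul]
  | hadd u v hu hv => rw [smul_add, map_add, map_add, smul_add, hu, hv]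

theorem insertLeft_mulRight (F : Y →ₗ[R] C.Words ⊗[R] Z) (b : C.Words) (u : C.Triple Y) :
    C.insertLeft F (C.mulRight b u) = C.mulRight b (C.insertLeft F u) := by
  induction u using triple_induction with
  | h a' y v => rw [mulRight_tmul, insertLeft_tmul, insertLeft_tmul, mulRight_smul, mulRight_mulRight]
  | hadd u v hu hv => rw [map_add, map_add, map_add, map_add, hu, hv]

theorem insertBoth_tmul (F : Y →ₗ[R] C.Triple Z) (a : C.Words) (y : Y) (b : C.Words) :
    C.insertBoth F (a ⊗ₜ[R] (y ⊗ₜ[R] b)) = a • C.mulRight b (F y) := by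
  rw [insertBoth, LinearMap.comp_apply, insertLeft_tmul]
  generalize F y = q
  induction q using triple_induction with
  | h a' z v =>
    simp only [TensorProduct.assoc_tmul, mulRight_tmul, smul_triple, insertRight_tmul,
      LinearMap.id_apply, mul_one, one_mul]
  | hadd p q hp hq => rw [add_tmul, map_add, map_add, map_add, smul_add, smul_add, map_add, hp, hq]

theorem tripleSgn_tmul (τ : Y →ₗ[R] Y) (a : C.Words) (y : Y) (b : C.Words) :
    C.tripleSgn τ (a ⊗ₜ[R] (y ⊗ₜ[R] b)) = C.wordSgn a ⊗ₜ[R] (τ y ⊗ₜ[R] C.wordSgn b) := rfl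

theorem tripleSgn_smul (τ : Y →ₗ[R] Y) (a : C.Words) (u : C.Triple Y) :
    C.tripleSgn τ (a • u) = C.wordSgn a • C.tripleSgn τ u := by
  induction u using triple_induction with
  | h a' y v => simp [smul_triple, tripleSgn_tmul]
  | hadd u v hu hv => rw [smul_add, map_add, map_add, smul_add, hu, hv]

theorem tripleSgn_mulRight (τ : Y →ₗ[R] Y) (b : C.Words) (u : C.Triple Y) :
    C.tripleSgn τ (C.mulRight b u) = C.mulRight (C.wordSgn b) (C.tripleSgn τ u) := by
  induction u using triple_induction with
  | h a' y v => simp [tripleSgn_tmul]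
  | hadd u v hu hv => rw [map_add, map_add, map_add, map_add, hu, hv]

/-- `d (a ⊗ y ⊗ b) = D a ⊗ y ⊗ b + (-1)^|a| a · F y · b + (-1)^(|a| + |y|) a ⊗ y ⊗ D b`. -/
def IsTwisted (τ : Y →ₗ[R] Y) (F : Y →ₗ[R] C.Triple Y) (d : C.Triple Y →ₗ[R] C.Triple Y) : Prop :=
  ∀ a y b, d (a ⊗ₜ[R] (y ⊗ₜ[R] b)) = C.wordD a ⊗ₜ[R] (y ⊗ₜ[R] b) +
    C.wordSgn a • C.mulRight b (F y) + C.wordSgn a ⊗ₜ[R] (τ y ⊗ₜ[R] C.wordD b)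

namespace IsTwisted

variable {τ : Y →ₗ[R] Y} {F : Y →ₗ[R] C.Triple Y} {d : C.Triple Y →ₗ[R] C.Triple Y}

theorem one_tmul_one (h : IsTwisted τ F d) (y : Y) : d (1 ⊗ₜ[R] (y ⊗ₜ[R] 1)) = F y := by
  simp [h 1 y 1]

/-- `d (a u) = (D a) u + (-1)^|a| a (d u)`. -/
theorem smul (h : IsTwisted τ F d) (a : C.Words) (u : C.Triple Y) :
    d (a • u) = C.wordD a • u + C.wordSgn a • d u := by
  induction u using triple_induction with
  | h a' y v =>
    simp only [smul_triple, h _ _ _, wordD_mul, map_mul, smul_add, add_tmul, mul_smul]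
    abel
  | hadd u v hu hv => rw [smul_add, map_add, hu, hv, map_add, smul_add, smul_add]; abel

/-- `d (u b) = (d u) b + (-1)^|u| u (D b)`. -/
theorem mulRight (h : IsTwisted τ F d) (b : C.Words) (u : C.Triple Y) :
    d (C.mulRight b u) = C.mulRight b (d u) + C.mulRight (C.wordD b) (C.tripleSgn τ u) := by
  induction u using triple_induction with
  | h a' y v =>
    simp only [mulRight_tmul, h _ _ _, wordD_mul, map_add, tripleSgn_tmul, mulRight_smul,
      mulRight_mulRight, tmul_add]
    abel
  | hadd u v hu hv => simp only [map_add, hu, hv]; abel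

end IsTwisted

end Triple

/-! ### The differential of `𝒬` -/

/-- The value of the differential of `𝒬` on `1 □ c □ 1`. -/
noncomputable def qMid : C.carrier →ₗ[R] C.Triple C.carrier :=
  C.mid _ ∘ₗ C.bd -
    conv (C.lact _) C.brace
      (C.mid _) +
    conv (C.ract _)
      (C.mid _ ∘ₗ sgn C.gr)
      C.brace

/-- The terms of `d` that involve `∂` or the coproduct depend on the outer words only through the
two actions and the sign of the left word, so they assemble into `qMid`; what remains is `D` on the
outer words. -/
theorem isTwisted_qDiff : IsTwisted (sgn C.gr) C.qMid C.qDiff := by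
  intro a c b
  have h1 : TensorProduct.assoc R C.Words C.carrier C.Words
      ((map C.brace LinearMap.id ∘ₗ comul) c ⊗ₜ 1) = conv (C.lact _) C.brace
      (C.mid _) c := by
    rw [conv_eq, LinearMap.comp_apply, LinearMap.comp_apply]
    generalize (comul c : C.carrier ⊗[R] C.carrier) = q
    induction q using TensorProduct.induction_on with
    | zero => simp
    | add p q hp hq => rw [map_add, map_add, ← hp, ← hq, add_tmul, map_add]
    | tmul x y => simp [smul_triple]
  have h2 : 1 ⊗ₜ (map (sgn C.gr) C.brace ∘ₗ comul) c = conv (C.ract _)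
      (C.mid _ ∘ₗ sgn C.gr)
      C.brace c := by
    rw [conv_eq, LinearMap.comp_apply, LinearMap.comp_apply]
    generalize (comul c : C.carrier ⊗[R] C.carrier) = q
    induction q using TensorProduct.induction_on with
    | zero => simp
    | add p q hp hq => rw [map_add, map_add, ← hp, ← hq, tmul_add]
    | tmul x y => simp
  simp only [qDiff, LinearMap.add_apply, LinearMap.sub_apply, LinearMap.comp_apply, map_tmul,
    AlgHom.toLinearMap_apply, LinearMap.id_apply, insertLeft_tmul, insertRight_tmul]
  simp only [LinearMap.comp_apply] at h1 h2
  rw [h1, h2, qMid]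
  simp [smul_triple, smul_sub, smul_add]
  abel

end CategoricalCoalgebra

namespace CategoricalCoalgebra

open TensorAlgebra TensorProduct Coalgebra Graded

variable {R : Type u} [CommRing R] {C : CategoricalCoalgebra.{u, v} R}

/-! ### The decomposition of `C` by pairs of objects -/

variable (C) in
/-- The coordinates of the degree zero part in the basis of objects. -/
noncomputable def coords : C.carrier →ₗ[R] C.Obj →₀ R :=
  C.linearIndependent_objects.repr ∘ₗ
    (zeroPart C.gr).codRestrict _ fun c => by
      rw [Subtype.range_coe, C.span_objects]; exact zeroPart_mem C.gr c

variable (C) in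
/-- The coordinate at the object `x`. -/
noncomputable def coord (x : C.Obj) : C.carrier →ₗ[R] R := Finsupp.lapply x ∘ₗ C.coords

theorem object_mem (x : C.Obj) : (x : C.carrier) ∈ C.gr 0 := by
  rw [← C.span_objects]; exact Submodule.subset_span x.2

theorem linearCombination_coords (c : C.carrier) :
    Finsupp.linearCombination R ((↑) : C.Obj → C.carrier) (C.coords c) = zeroPart C.gr c :=
  C.linearIndependent_objects.linearCombination_repr _

theorem coords_object (x : C.Obj) : C.coords (x : C.carrier) = Finsupp.single x 1 := by
  refine C.linearIndependent_objects.repr_eq_single x _ ?_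
  simpa using zeroPart_of_mem_zero C.gr (object_mem x)

open Classical in
theorem coord_object (x y : C.Obj) : C.coord x (y : C.carrier) = if y = x then 1 else 0 := by
  simp [coord, coords_object, Finsupp.single_apply]

theorem coord_zeroPart (x : C.Obj) (c : C.carrier) : C.coord x (zeroPart C.gr c) = C.coord x c := by
  have h : zeroPart C.gr (zeroPart C.gr c) = zeroPart C.gr c :=
    zeroPart_of_mem_zero C.gr (zeroPart_mem C.gr c)
  simp only [coord, coords, LinearMap.comp_apply]
  congr 2
  exact Subtype.ext h

theorem coord_of_mem (x : C.Obj) {n : ℕ} {c : C.carrier} (hc : c ∈ C.gr n) (hn : n ≠ 0) :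
    C.coord x c = 0 := by
  rw [← coord_zeroPart, zeroPart_of_mem C.gr hc hn, map_zero]

/-- Linear maps that agree on the objects and in positive degrees are equal. -/
theorem linearMap_ext_objects {N : Type*} [AddCommGroup N] [Module R N]
    {f g : C.carrier →ₗ[R] N} (h0 : ∀ x : C.Obj, f x = g x)
    (h : ∀ n, n ≠ 0 → ∀ c ∈ C.gr n, f c = g c) : f = g := by
  refine linearMap_ext C.gr fun n c hc => ?_
  rcases eq_or_ne n 0 with rfl | hn
  · rw [← C.span_objects] at hc
    exact LinearMap.eqOn_span (fun x hx => h0 ⟨x, hx⟩) hc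
  · exact h n hn c hc

theorem comul_obj (x : C.Obj) :
    (comul (x : C.carrier) : C.carrier ⊗[R] C.carrier) = (x : C.carrier) ⊗ₜ (x : C.carrier) :=
  C.comul_object x.2

theorem counit_obj (x : C.Obj) : counit (R := R) (x : C.carrier) = 1 := C.counit_object x.2

variable (C) in
/-- The projection onto the elements with left coaction `x ⊗ c`. -/
noncomputable def projLeft (x : C.Obj) : C.carrier →ₗ[R] C.carrier :=
  conv (LinearMap.lsmul R C.carrier) (C.coord x) LinearMap.id

variable (C) in
/-- The projection onto the elements with right coaction `c ⊗ y`. -/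
noncomputable def projRight (y : C.Obj) : C.carrier →ₗ[R] C.carrier :=
  conv (LinearMap.lsmul R C.carrier).flip LinearMap.id (C.coord y)

theorem map_comul_eq_conv {M N : Type*} [AddCommGroup M] [Module R M] [AddCommGroup N] [Module R N]
    (f : C.carrier →ₗ[R] M) (g : C.carrier →ₗ[R] N) :
    map f g ∘ₗ comul = conv (TensorProduct.mk R _ _) f g := by
  rw [conv, ← LinearMap.comp_assoc]; congr 1; ext; simp

section
variable {M N P : Type*} [AddCommGroup M] [Module R M] [AddCommGroup N] [Module R N]
  [AddCommGroup P] [Module R P]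

/-- The projection is itself a convolution with a coordinate from the left, so coassociativity moves
it onto the first leg. -/
theorem conv_comp_projLeft (β : M →ₗ[R] N →ₗ[R] P) (f : C.carrier →ₗ[R] M)
    (g : C.carrier →ₗ[R] N) (x : C.Obj) :
    conv β f g ∘ₗ C.projLeft x = conv β (f ∘ₗ C.projLeft x) g := by
  have h1 : conv β f g ∘ₗ C.projLeft x =
      conv (LinearMap.lsmul R P) (C.coord x) (conv β f g) := comp_conv fun a b => by simp
  have h2 : f ∘ₗ C.projLeft x = conv (LinearMap.lsmul R M) (C.coord x) f :=
    comp_conv fun a b => by simp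
  rw [h1, h2]
  exact (conv_assoc fun a b c => by simp).symm

theorem conv_comp_projRight (β : M →ₗ[R] N →ₗ[R] P) (f : C.carrier →ₗ[R] M)
    (g : C.carrier →ₗ[R] N) (y : C.Obj) :
    conv β f g ∘ₗ C.projRight y = conv β f (g ∘ₗ C.projRight y) := by
  have h1 : conv β f g ∘ₗ C.projRight y =
      conv (LinearMap.lsmul R P).flip (conv β f g) (C.coord y) := comp_conv fun a b => by simp
  have h2 : g ∘ₗ C.projRight y = conv (LinearMap.lsmul R N).flip g (C.coord y) :=
    comp_conv fun a b => by simp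
  rw [h1, h2]
  exact conv_assoc fun a b c => by simp

/-- The coordinate of the middle object may be read from either side. This balancing is what places
the coproduct in the cotensor product over `C₀`. -/
theorem conv_projRight_left (β : M →ₗ[R] N →ₗ[R] P) (f : C.carrier →ₗ[R] M)
    (g : C.carrier →ₗ[R] N) (z : C.Obj) :
    conv β (f ∘ₗ C.projRight z) g = conv β f (g ∘ₗ C.projLeft z) := by
  have h1 : f ∘ₗ C.projRight z = conv (LinearMap.lsmul R M).flip f (C.coord z) :=
    comp_conv fun a b => by simp
  have h2 : g ∘ₗ C.projLeft z = conv (LinearMap.lsmul R N) (C.coord z) g :=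
    comp_conv fun a b => by simp
  rw [h1, h2]
  exact conv_assoc fun a b c => by simp

end

/-- The coordinate at `x` is idempotent for convolution. On objects this holds because they are
set-like; in positive degree at least one leg of every term of the coproduct has positive degree and
coordinate zero. -/
theorem projLeft_comp_projLeft (x : C.Obj) : C.projLeft x ∘ₗ C.projLeft x = C.projLeft x := by
  have h : C.coord x ∘ₗ C.projLeft x = C.coord x := by
    have h1 : C.coord x ∘ₗ C.projLeft x =
        conv (LinearMap.mul R R) (C.coord x) (C.coord x) := comp_conv fun a b => by simp
    rw [h1]
    refine linearMap_ext_objects (fun y => ?_) fun n hn c hc => ?_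
    · rw [conv_eq, LinearMap.comp_apply, comul_obj]
      by_cases h : y = x <;> simp [coord_object, h]
    · rw [conv_eq, LinearMap.comp_apply, coord_of_mem x hc hn]
      refine comul_congr hc (f := TensorProduct.lift _) (g := 0) fun i j a b ha hb e => ?_
      rcases eq_or_ne i 0 with rfl | hi
      · simp [coord_of_mem x hb (by omega : j ≠ 0)]
      · simp [coord_of_mem x ha hi]
  nth_rw 1 [projLeft]
  rw [conv_comp_projLeft, h, projLeft]

theorem projLeft_comp_projRight (x y : C.Obj) :
    C.projLeft x ∘ₗ C.projRight y = C.projRight y ∘ₗ C.projLeft x := by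
  nth_rw 1 [projLeft]
  rw [conv_comp_projRight, projLeft]
  exact (comp_conv fun a b => by simp).symm

theorem projRight_comp_projRight (x : C.Obj) :
    C.projRight x ∘ₗ C.projRight x = C.projRight x := by
  have h : C.coord x ∘ₗ C.projRight x = C.coord x := by
    have h1 : C.coord x ∘ₗ C.projRight x =
        conv (LinearMap.mul R R).flip (C.coord x) (C.coord x) := comp_conv fun a b => by
          simp [mul_comm]
    rw [h1]
    refine linearMap_ext_objects (fun y => ?_) fun n hn c hc => ?_
    · rw [conv_eq, LinearMap.comp_apply, comul_obj]
      by_cases h : y = x <;> simp [coord_object, h]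
    · rw [conv_eq, LinearMap.comp_apply, coord_of_mem x hc hn]
      refine comul_congr hc (f := TensorProduct.lift _) (g := 0) fun i j a b ha hb e => ?_
      rcases eq_or_ne i 0 with rfl | hi
      · simp [coord_of_mem x hb (by omega : j ≠ 0)]
      · simp [coord_of_mem x ha hi]
  nth_rw 1 [projRight]
  rw [conv_comp_projRight, h, projRight]

theorem projLeft_mem (x : C.Obj) {n : ℕ} {c : C.carrier} (hc : c ∈ C.gr n) :
    C.projLeft x c ∈ C.gr n := by
  rw [projLeft, conv_eq, LinearMap.comp_apply]
  -- Membership is recast as vanishing in the quotient by `C.gr n`, so that it can be tested on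
  -- homogeneous tensors; only those with first leg in degree zero have a coordinate.
  rw [← Submodule.ker_mkQ (C.gr n), LinearMap.mem_ker, ← LinearMap.comp_apply]
  refine comul_congr hc (f := (C.gr n).mkQ ∘ₗ TensorProduct.lift _) (g := 0)
    fun i j a b ha hb e => ?_
  rcases eq_or_ne i 0 with rfl | hi
  · obtain rfl : j = n := by omega
    simp [(Submodule.Quotient.mk_eq_zero _).2 hb]
  · simp [coord_of_mem x ha hi]

theorem projRight_mem (x : C.Obj) {n : ℕ} {c : C.carrier} (hc : c ∈ C.gr n) :
    C.projRight x c ∈ C.gr n := by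
  rw [projRight, conv_eq, LinearMap.comp_apply]
  rw [← Submodule.ker_mkQ (C.gr n), LinearMap.mem_ker, ← LinearMap.comp_apply]
  refine comul_congr hc (f := (C.gr n).mkQ ∘ₗ TensorProduct.lift _) (g := 0)
    fun i j a b ha hb e => ?_
  rcases eq_or_ne j 0 with rfl | hi
  · obtain rfl : i = n := by omega
    simp [(Submodule.Quotient.mk_eq_zero _).2 ha]
  · simp [coord_of_mem x hb hi]

theorem zeroPart_comp_projLeft (x : C.Obj) : zeroPart C.gr ∘ₗ C.projLeft x =
    LinearMap.toSpanSingleton R _ (x : C.carrier) ∘ₗ C.coord x := by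
  refine linearMap_ext_objects (fun y => ?_) fun n hn c hc => ?_
  · rw [LinearMap.comp_apply, zeroPart_of_mem_zero C.gr (projLeft_mem x (object_mem y)), projLeft,
      conv_eq, LinearMap.comp_apply, comul_obj]
    by_cases h : y = x <;> simp [coord_object, h]
  · simp [zeroPart_of_mem C.gr (projLeft_mem x hc) hn, coord_of_mem x hc hn]

theorem zeroPart_comp_projRight (x : C.Obj) : zeroPart C.gr ∘ₗ C.projRight x =
    LinearMap.toSpanSingleton R _ (x : C.carrier) ∘ₗ C.coord x := by
  refine linearMap_ext_objects (fun y => ?_) fun n hn c hc => ?_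
  · rw [LinearMap.comp_apply, zeroPart_of_mem_zero C.gr (projRight_mem x (object_mem y)),
      projRight, conv_eq, LinearMap.comp_apply, comul_obj]
    by_cases h : y = x <;> simp [coord_object, h]
  · simp [zeroPart_of_mem C.gr (projRight_mem x hc) hn, coord_of_mem x hc hn]

theorem mem_hom {x y : C.Obj} {c : C.carrier} : c ∈ C.hom x y ↔
    map (zeroPart C.gr) LinearMap.id (comul c) = (x : C.carrier) ⊗ₜ[R] c ∧
    map LinearMap.id (zeroPart C.gr) (comul c) = c ⊗ₜ[R] (y : C.carrier) := Iff.rfl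

/-- The coaction conditions are recast as fixed-point conditions for two commuting idempotents,
which can be handled by the convolution rules. -/
theorem mem_hom_iff {x y : C.Obj} {c : C.carrier} :
    c ∈ C.hom x y ↔ C.projLeft x c = c ∧ C.projRight y c = c := by
  rw [mem_hom]
  constructor
  · rintro ⟨h1, h2⟩
    constructor
    -- Contracting the left leg with the coordinate at `x` turns the coaction into the projection on
    -- one side and into the identity on the other.
    · have := congrArg (TensorProduct.lift ((LinearMap.lsmul R C.carrier) ∘ₗ C.coord x)) h1
      rw [← LinearMap.comp_apply] at this
      have e : TensorProduct.lift ((LinearMap.lsmul R C.carrier) ∘ₗ C.coord x) ∘ₗ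
          map (zeroPart C.gr) LinearMap.id = TensorProduct.lift
            ((LinearMap.lsmul R C.carrier).compl₁₂ (C.coord x) LinearMap.id) := by
        ext; simp [coord_zeroPart]
      rw [e] at this
      rw [projLeft, conv_eq]
      refine this.trans ?_
      simp [coord_object]
    · have := congrArg (TensorProduct.lift ((LinearMap.lsmul R C.carrier) ∘ₗ C.coord y).flip) h2
      rw [← LinearMap.comp_apply] at this
      have e : TensorProduct.lift ((LinearMap.lsmul R C.carrier) ∘ₗ C.coord y).flip ∘ₗ
          map LinearMap.id (zeroPart C.gr) = TensorProduct.lift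
            ((LinearMap.lsmul R C.carrier).flip.compl₁₂ LinearMap.id (C.coord y)) := by
        ext; simp [coord_zeroPart]
      rw [e] at this
      rw [projRight, conv_eq]
      refine this.trans ?_
      simp [coord_object]
  · rintro ⟨h1, h2⟩
    constructor
    · have := LinearMap.congr_fun (conv_comp_projLeft (TensorProduct.mk R _ _) (zeroPart C.gr)
        LinearMap.id x) c
      rw [zeroPart_comp_projLeft, ← map_comul_eq_conv, LinearMap.comp_apply, h1] at this
      refine this.trans ?_
      nth_rw 2 [← h1]
      rw [projLeft]
      change _ = (TensorProduct.mk R _ _ (x : C.carrier) ∘ₗ _) c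
      refine LinearMap.congr_fun (comp_conv fun a b => ?_).symm c
      simp
    · have := LinearMap.congr_fun (conv_comp_projRight (TensorProduct.mk R _ _) LinearMap.id
        (zeroPart C.gr) y) c
      rw [zeroPart_comp_projRight, ← map_comul_eq_conv, LinearMap.comp_apply, h2] at this
      refine this.trans ?_
      nth_rw 2 [← h2]
      rw [projRight]
      change _ = ((TensorProduct.mk R _ _).flip (y : C.carrier) ∘ₗ _) c
      refine LinearMap.congr_fun (comp_conv fun a b => ?_).symm c
      simp

theorem proj_mem_hom (x y : C.Obj) (c : C.carrier) :
    C.projRight y (C.projLeft x c) ∈ C.hom x y := by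
  rw [mem_hom_iff]
  constructor
  · rw [← LinearMap.comp_apply (C.projLeft x), projLeft_comp_projRight, LinearMap.comp_apply,
      ← LinearMap.comp_apply (C.projLeft x), projLeft_comp_projLeft]
  · rw [← LinearMap.comp_apply (C.projRight y), projRight_comp_projRight]

open Classical in
/-- An element is the sum of its right projections. -/
theorem exists_sum_projRight (c : C.carrier) :
    ∃ F : Finset C.Obj, ∀ F', F ⊆ F' → ∑ z ∈ F', C.projRight z c = c := by
  -- There may be infinitely many objects, so the finite set depends on the tensor. Quantifying over
  -- all larger sets lets the sets for two summands be united.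
  have key : ∀ q : C.carrier ⊗[R] C.carrier, ∃ F : Finset C.Obj, ∀ F', F ⊆ F' →
      ∑ z ∈ F', TensorProduct.lift ((LinearMap.lsmul R C.carrier).flip.compl₁₂ LinearMap.id
        (C.coord z)) q = TensorProduct.lift ((LinearMap.lsmul R C.carrier).flip.compl₁₂
          LinearMap.id counit) q := by
    intro q
    induction q using TensorProduct.induction_on with
    | zero => exact ⟨∅, fun F' _ => by simp⟩
    | add p q hp hq =>
      obtain ⟨F, hF⟩ := hp
      obtain ⟨F2, hF2⟩ := hq
      refine ⟨F ∪ F2, fun F' h => ?_⟩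
      simp only [map_add, Finset.sum_add_distrib]
      rw [hF F' (Finset.union_subset_left h), hF2 F' (Finset.union_subset_right h)]
    | tmul a b =>
      refine ⟨(C.coords b).support, fun F' h => ?_⟩
      have h1 : counit b = ∑ z ∈ F', C.coord z b := by
        have h2 : counit b = counit (R := R) (zeroPart C.gr b) := by
          have : counit = counit (R := R) ∘ₗ zeroPart C.gr := by
            have := congrArg (counit (R := R) ∘ₗ ·) (zeroPart_add_posPart C.gr)
            simpa [LinearMap.comp_add, counit_comp_posPart] using this.symm
          exact LinearMap.congr_fun this b
        rw [h2, ← linearCombination_coords, Finsupp.linearCombination_apply, Finsupp.sum, map_sum]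
        simp only [map_smul, counit_obj, smul_eq_mul, mul_one]
        exact Finset.sum_subset h fun z _ hz => by simpa using hz
      simp [h1]
  obtain ⟨F, hF⟩ := key (comul c)
  refine ⟨F, fun F' h => ?_⟩
  have h1 : conv (LinearMap.lsmul R C.carrier).flip LinearMap.id counit = LinearMap.id := by
    have := conv_counit_right (C := C) (LinearMap.lsmul R C.carrier).flip (1 : R) LinearMap.id
    have e : LinearMap.toSpanSingleton R R 1 ∘ₗ counit = counit (R := R) (A := C.carrier) := by
      ext; simp
    rw [e] at this
    rw [this]; ext; simp
  rw [conv_eq] at h1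
  have := hF F' h
  rw [← LinearMap.comp_apply, h1] at this
  simpa only [projRight, conv_eq, LinearMap.comp_apply, LinearMap.id_apply] using this

open Classical in
/-- The coproduct of an element of `C(x, y)` is a sum of tensors of elements of
`C(x, z)` and `C(z, y)`. -/
theorem comul_mem_span {x y : C.Obj} {n : ℕ} {c : C.carrier} (hc : c ∈ C.hom x y)
    (hn : c ∈ C.gr n) : comul c ∈ Submodule.span R {t : C.carrier ⊗[R] C.carrier |
      ∃ (z : C.Obj) (i j : ℕ) (a b : C.carrier), a ∈ C.hom x z ∧ a ∈ C.gr i ∧ b ∈ C.hom z y ∧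
        b ∈ C.gr j ∧ i + j = n ∧ t = a ⊗ₜ b} := by
  obtain ⟨hl, hr⟩ := mem_hom_iff.1 hc
  have key : ∀ q : C.carrier ⊗[R] C.carrier, ∃ F : Finset C.Obj, ∀ F', F ⊆ F' →
      ∑ z ∈ F', map (C.projRight z) LinearMap.id q = q := by
    intro q
    induction q using TensorProduct.induction_on with
    | zero => exact ⟨∅, fun F' _ => by simp⟩
    | add p q hp hq =>
      obtain ⟨F, hF⟩ := hp
      obtain ⟨F2, hF2⟩ := hq
      refine ⟨F ∪ F2, fun F' h => ?_⟩
      simp only [map_add, Finset.sum_add_distrib]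
      rw [hF F' (Finset.union_subset_left h), hF2 F' (Finset.union_subset_right h)]
    | tmul a b =>
      obtain ⟨F, hF⟩ := exists_sum_projRight a
      refine ⟨F, fun F' h => ?_⟩
      simp only [map_tmul, ← sum_tmul, hF F' h, LinearMap.id_apply]
  -- The outer projections come from `c` being fixed by them. The middle projection is idempotent,
  -- so one copy of it can be kept and the other passed to the second leg.
  have e1 : ∀ z, map (C.projRight z) LinearMap.id (comul c) =
      map (C.projRight z ∘ₗ C.projLeft x) (C.projRight y ∘ₗ C.projLeft z) (comul c) := by
    intro z
    have a1 : c = C.projRight y (C.projLeft x c) := by rw [hl, hr]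
    conv_lhs => rw [a1]
    rw [← LinearMap.comp_apply, ← LinearMap.comp_apply (map _ _), map_comul_eq_conv,
      map_comul_eq_conv, ← LinearMap.comp_apply, ← LinearMap.comp_apply, LinearMap.comp_assoc,
      ← LinearMap.comp_assoc, conv_comp_projRight, conv_comp_projLeft, LinearMap.id_comp,
      ← projLeft_comp_projRight x z, ← conv_projRight_left,
      LinearMap.comp_assoc, projRight_comp_projRight]
  obtain ⟨F, hF⟩ := key (comul c)
  rw [← hF F subset_rfl]
  refine Submodule.sum_mem _ fun z _ => ?_
  rw [e1 z]
  have h := C.comul_mem hn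
  rw [tensorGr] at h
  refine Submodule.span_induction ?_ (by simp) (fun p q _ _ hp hq => ?_) (fun r p _ hp => ?_) h
  · rintro _ ⟨i, j, a, b, ha, hb, e, rfl⟩
    refine Submodule.subset_span ⟨z, i, j, _, _, proj_mem_hom x z a,
      projRight_mem z (projLeft_mem x ha), proj_mem_hom z y b,
      projRight_mem y (projLeft_mem z hb), e, rfl⟩
  · rw [map_add]; exact add_mem hp hq
  · rw [map_smul]; exact Submodule.smul_mem _ _ hp

/-- A criterion for the values of a convolution. -/
theorem conv_mem {M N P : Type*} [AddCommGroup M] [Module R M] [AddCommGroup N] [Module R N]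
    [AddCommGroup P] [Module R P] {β : M →ₗ[R] N →ₗ[R] P} {f : C.carrier →ₗ[R] M}
    {g : C.carrier →ₗ[R] N} {S : Submodule R P} {x y : C.Obj} {n : ℕ} {c : C.carrier}
    (hc : c ∈ C.hom x y) (hn : c ∈ C.gr n)
    (h : ∀ z i j a b, a ∈ C.hom x z → a ∈ C.gr i → b ∈ C.hom z y → b ∈ C.gr j → i + j = n →
      β (f a) (g b) ∈ S) : conv β f g c ∈ S := by
  rw [conv_eq, LinearMap.comp_apply]
  refine Submodule.span_induction ?_ (by simp) (fun p q _ _ hp hq => ?_) (fun r p _ hp => ?_)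
    (comul_mem_span hc hn)
  · rintro _ ⟨z, i, j, a, b, ha, ha', hb, hb', e, rfl⟩
    exact h z i j a b ha ha' hb hb' e
  · rw [map_add]; exact add_mem hp hq
  · rw [map_smul]; exact Submodule.smul_mem _ _ hp

theorem object_mem_hom (x : C.Obj) : (x : C.carrier) ∈ C.hom x x := by
  rw [mem_hom, comul_obj]
  simp [zeroPart_of_mem_zero C.gr (object_mem x)]

/-- An element of `C(x, y)` of degree zero is a multiple of an object, and zero if `x ≠ y`. -/
theorem hom_zero {x y : C.Obj} {c : C.carrier} (hc : c ∈ C.hom x y) (hn : c ∈ C.gr 0) :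
    c = counit (R := R) c • (x : C.carrier) ∧ (x ≠ y → c = 0) := by
  obtain ⟨hl, hr⟩ := mem_hom_iff.1 hc
  have h1 := LinearMap.congr_fun (zeroPart_comp_projLeft x) c
  have h2 := LinearMap.congr_fun (zeroPart_comp_projRight y) c
  simp only [LinearMap.comp_apply, hl, hr, zeroPart_of_mem_zero C.gr hn,
    LinearMap.toSpanSingleton_apply] at h1 h2
  have h3 : counit (R := R) c = C.coord x c := by
    conv_lhs => rw [h1]
    simp [counit_obj]
  refine ⟨by rw [h3, ← h1], fun hxy => ?_⟩
  have h4 : C.coord x c = 0 := by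
    rw [h2, map_smul, coord_object, if_neg (Ne.symm hxy), smul_zero]
  rw [h1, h4, zero_smul]

/-- The coordinates vanish on the image of `∂`, so in the coderivation rule only the term with `∂`
on the leg away from the coordinate survives, and `∂` commutes with both projections. -/
theorem bd_mem_hom {x y : C.Obj} {c : C.carrier} (hc : c ∈ C.hom x y) : C.bd c ∈ C.hom x y := by
  obtain ⟨hl, hr⟩ := mem_hom_iff.1 hc
  have h0 : ∀ z, C.coord z ∘ₗ C.bd = 0 := fun z => by
    ext a
    have : zeroPart C.gr (C.bd a) = 0 := LinearMap.congr_fun C.zeroPart_bd a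
    rw [LinearMap.comp_apply, ← coord_zeroPart, this, map_zero, LinearMap.zero_apply]
  have hs : ∀ z, C.coord z ∘ₗ sgn C.gr = C.coord z := fun z => by
    ext a
    have : zeroPart C.gr (sgn C.gr a) = zeroPart C.gr a := LinearMap.congr_fun (zeroPart_sgn _) a
    rw [LinearMap.comp_apply, ← coord_zeroPart, this, coord_zeroPart]
  rw [mem_hom_iff]
  constructor
  · conv_rhs => rw [← hl]
    rw [← LinearMap.comp_apply, ← LinearMap.comp_apply]
    refine LinearMap.congr_fun ?_ c
    rw [projLeft, conv_comp_bd, h0, hs, conv_zero_left, zero_add]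
    exact (comp_conv fun a b => by simp).symm
  · conv_rhs => rw [← hr]
    rw [← LinearMap.comp_apply, ← LinearMap.comp_apply]
    refine LinearMap.congr_fun ?_ c
    rw [projRight, conv_comp_bd, h0, conv_zero_right, add_zero]
    exact (comp_conv fun a b => by simp).symm

/-- The curvature of an element of `C(x, y)` with `x ≠ y` vanishes. -/
theorem curv_of_ne {x y : C.Obj} {c : C.carrier} (hc : c ∈ C.hom x y) (hxy : x ≠ y)
    {n : ℕ} (hn : c ∈ C.gr n) : C.curv c = 0 := by
  rcases eq_or_ne n 2 with rfl | h2
  swap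
  · exact C.curv_eq_zero hn h2
  obtain ⟨hl, hr⟩ := mem_hom_iff.1 hc
  have h := LinearMap.congr_fun bd_bd_eq c
  -- In degree two `∂²c` lies in `C₀`, where `∂` has no component. The formula for `∂²` then reads
  -- `0 = h(c) y - h(c) x`, and `x`, `y` are distinct basis elements.
  have e1 : C.bd (C.bd c) = 0 := by
    have h1 : C.bd c ∈ C.gr 1 := C.bd_mem hn
    have h3 : C.bd (C.bd c) ∈ C.gr 0 := C.bd_mem h1
    rw [← zeroPart_of_mem_zero C.gr h3]
    exact LinearMap.congr_fun C.zeroPart_bd _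
  have e2 : conv (LinearMap.lsmul R C.carrier) C.curv LinearMap.id c = C.curv c • (y : C.carrier) := by
    have a1 := (mem_hom.1 hc).2
    have a2 := congrArg (TensorProduct.lift ((LinearMap.lsmul R C.carrier) ∘ₗ C.curv)) a1
    rw [lift.tmul] at a2
    refine Eq.trans ?_ a2
    rw [conv_eq, LinearMap.comp_apply]
    -- If the second leg has positive degree, the first has degree below two and its curvature is
    -- zero; hence only the right coaction of `c` contributes.
    refine comul_congr hn (f := TensorProduct.lift _) (g := TensorProduct.lift _ ∘ₗ map _ _)
      fun i j a b ha hb e => ?_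
    rcases eq_or_ne j 0 with rfl | hj
    · simp [zeroPart_of_mem_zero C.gr hb]
    · simp [C.curv_eq_zero ha (by omega)]
  have e3 : conv (LinearMap.lsmul R C.carrier).flip LinearMap.id C.curv c =
      C.curv c • (x : C.carrier) := by
    have a1 := (mem_hom.1 hc).1
    have a2 := congrArg (TensorProduct.lift ((LinearMap.lsmul R C.carrier) ∘ₗ C.curv).flip) a1
    rw [lift.tmul] at a2
    refine Eq.trans ?_ a2
    rw [conv_eq, LinearMap.comp_apply]
    refine comul_congr hn (f := TensorProduct.lift _) (g := TensorProduct.lift _ ∘ₗ map _ _)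
      fun i j a b ha hb e => ?_
    rcases eq_or_ne i 0 with rfl | hj
    · simp [zeroPart_of_mem_zero C.gr ha]
    · simp [C.curv_eq_zero hb (by omega)]
  rw [LinearMap.comp_apply, e1, LinearMap.sub_apply, e2, e3] at h
  have := congrArg (C.coord y) h
  simpa [coord_object, hxy] using this.symm

end CategoricalCoalgebra

/-! ### Membership in a grading shifted down by one -/

namespace Graded

variable {R : Type u} [CommRing R] {N : Type*} [AddCommGroup N] [Module R N]
  {gr : ℕ → Submodule R N}

/-- A map of degree `-1` must vanish in degree zero. Splitting off the zero element lets the other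
case use an honest degree `k` without truncated subtraction. -/
theorem mem_lower_iff {n : ℕ} {w : N} : w ∈ lower gr n ↔ w = 0 ∨ ∃ k, n = k + 1 ∧ w ∈ gr k := by
  cases n with
  | zero => simp [mem_lower_zero]
  | succ n =>
    rw [mem_lower_succ]
    exact ⟨fun h => .inr ⟨n, rfl, h⟩, fun h => by
      rcases h with rfl | ⟨k, hk, h⟩
      · exact zero_mem _
      · obtain rfl : n = k := by omega
        exact h⟩

theorem mem_lower_of_eq {n k : ℕ} {w : N} (h : w ∈ gr k) (e : n = k + 1) : w ∈ lower gr n :=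
  mem_lower_iff.2 (.inr ⟨k, e, h⟩)

end Graded

namespace CategoricalCoalgebra

open TensorAlgebra TensorProduct Coalgebra Graded

variable {R : Type u} [CommRing R] {C : CategoricalCoalgebra.{u, v} R}

/-! ### The graded pieces of the cobar construction -/

theorem IsWord.mul {x y z : C.Obj} {p q m n : ℕ} {a b : C.Words} (ha : C.IsWord x y p m a)
    (hb : C.IsWord y z q n b) : C.IsWord x z (p + q) (m + n) (a * b) := by
  induction ha with
  | nil x => simpa using hb
  | cons hc hm _ ih =>
    rw [mul_assoc]
    convert IsWord.cons hc hm (ih hb) using 1 <;> omega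

theorem IsWord.wordSgn {x y : C.Obj} {p n : ℕ} {a : C.Words} (ha : C.IsWord x y p n a) :
    C.wordSgn a = (-1 : R) ^ n • a := by
  induction ha with
  | nil x => simp
  | cons hc hm _ ih =>
    rw [map_mul, ih, wordSgn_ι, sgn_of_mem C.gr hm, map_smul, pow_succ, pow_add, mul_neg_one,
      neg_smul, neg_neg, smul_mul_smul_comm]

theorem IsWord.wordCoeff {x y : C.Obj} {p n : ℕ} {a : C.Words} (ha : C.IsWord x y (p + 1) n a) :
    C.wordCoeff a = 0 := by
  cases ha with
  | cons hc hm hw => rw [wordCoeff_mul, wordCoeff_ι, zero_mul]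

theorem IsWord.plus {x y : C.Obj} {p n : ℕ} {a : C.Words} (ha : C.IsWord x y (p + 1) n a) :
    C.plus a = a := plus_of_wordCoeff ha.wordCoeff

theorem one_mem_cobarGr (x : C.Obj) : (1 : C.Words) ∈ C.cobarGr x x 0 :=
  Submodule.subset_span ⟨0, .nil x⟩

/-- A criterion for the values of a linear map on `(ΩC)(x, y)`. -/
theorem cobarGr_map_mem {N : Type*} [AddCommGroup N] [Module R N] {L : C.Words →ₗ[R] N}
    {S : Submodule R N} {x y : C.Obj} {n : ℕ} (h : ∀ p w, C.IsWord x y p n w → L w ∈ S)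
    {w : C.Words} (hw : w ∈ C.cobarGr x y n) : L w ∈ S := by
  have : C.cobarGr x y n ≤ S.comap L := Submodule.span_le.2 fun w hw => by
    obtain ⟨p, hp⟩ := hw
    exact h p w hp
  exact this hw

/-- Linear maps that agree on the monomials agree on `(ΩC)(x, y)`. -/
theorem cobarGr_ext {N : Type*} [AddCommGroup N] [Module R N] {f g : C.Words →ₗ[R] N}
    {x y : C.Obj} {n : ℕ} (h : ∀ p w, C.IsWord x y p n w → f w = g w)
    {w : C.Words} (hw : w ∈ C.cobarGr x y n) : f w = g w :=
  LinearMap.eqOn_span (s := {w | ∃ p, C.IsWord x y p n w})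
    (fun w hw => by obtain ⟨p, hp⟩ := hw; exact h p w hp) hw

theorem mul_mem_cobarGr {x y z : C.Obj} {m n : ℕ} {a b : C.Words} (ha : a ∈ C.cobarGr x y m)
    (hb : b ∈ C.cobarGr y z n) : a * b ∈ C.cobarGr x z (m + n) := by
  refine cobarGr_map_mem (L := LinearMap.mulRight R b) (fun p a ha => ?_) ha
  refine cobarGr_map_mem (L := LinearMap.mulLeft R a) (fun q b hb => ?_) hb
  exact Submodule.subset_span ⟨_, ha.mul hb⟩

theorem lower_mul_mem_cobarGr {x y z : C.Obj} {m n : ℕ} {a b : C.Words}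
    (ha : a ∈ lower (C.cobarGr x y) m) (hb : b ∈ C.cobarGr y z n) :
    a * b ∈ lower (C.cobarGr x z) (m + n) := by
  rcases mem_lower_iff.1 ha with rfl | ⟨k, rfl, ha⟩
  · rw [zero_mul]; exact zero_mem _
  · exact mem_lower_of_eq (mul_mem_cobarGr ha hb) (by omega)

theorem mul_lower_mem_cobarGr {x y z : C.Obj} {m n : ℕ} {a b : C.Words}
    (ha : a ∈ C.cobarGr x y m) (hb : b ∈ lower (C.cobarGr y z) n) :
    a * b ∈ lower (C.cobarGr x z) (m + n) := by
  rcases mem_lower_iff.1 hb with rfl | ⟨k, rfl, hb⟩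
  · rw [mul_zero]; exact zero_mem _
  · exact mem_lower_of_eq (mul_mem_cobarGr ha hb) (by omega)

theorem wordSgn_of_mem {x y : C.Obj} {n : ℕ} {a : C.Words} (ha : a ∈ C.cobarGr x y n) :
    C.wordSgn a = (-1 : R) ^ n • a := by
  change C.wordSgn.toLinearMap a = ((-1 : R) ^ n • LinearMap.id (R := R) (M := C.Words)) a
  exact cobarGr_ext (f := C.wordSgn.toLinearMap) (g := (-1 : R) ^ n • LinearMap.id)
    (fun _ _ h => by rw [LinearMap.smul_apply]; exact h.wordSgn) ha

theorem ι_mem_cobarGr {x y : C.Obj} {m : ℕ} {c : C.carrier} (hc : c ∈ C.hom x y)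
    (hm : c ∈ C.gr (m + 1)) : ι R c ∈ C.cobarGr x y m :=
  Submodule.subset_span ⟨1, by simpa using IsWord.cons hc hm (.nil y)⟩

theorem brace_mem_cobarGr {x y : C.Obj} {n : ℕ} {c : C.carrier} (hc : c ∈ C.hom x y)
    (hn : c ∈ C.gr n) : C.brace c ∈ lower (C.cobarGr x y) n := by
  cases n with
  | zero => rw [brace_of_mem_zero hn]; exact zero_mem _
  | succ n =>
    rw [brace_of_mem hn (by omega)]
    exact ι_mem_cobarGr hc hn

/-- A scalar is a multiple of an identity and so belongs to `(ΩC)(x, y)` only through `x = y`. The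
scalar part of `D{c}` is harmless because the curvature vanishes between distinct objects. -/
theorem letterD_mem {x y : C.Obj} {m : ℕ} {c : C.carrier} (hc : c ∈ C.hom x y)
    (hm : c ∈ C.gr (m + 1)) : C.letterD c ∈ lower (C.cobarGr x y) m := by
  have h1 : algebraMap R C.Words (C.curv c) ∈ lower (C.cobarGr x y) m := by
    rcases eq_or_ne (m + 1) 2 with h | h
    · by_cases hxy : x = y
      · subst hxy
        rw [Algebra.algebraMap_eq_smul_one]
        exact Submodule.smul_mem _ _ (mem_lower_of_eq (one_mem_cobarGr x) (by omega))
      · rw [curv_of_ne hc hxy hm, map_zero]; exact zero_mem _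
    · rw [C.curv_eq_zero hm h, map_zero]; exact zero_mem _
  have h2 : C.brace (C.bd c) ∈ lower (C.cobarGr x y) m :=
    brace_mem_cobarGr (bd_mem_hom hc) (C.bd_mem hm)
  have h3 : conv (LinearMap.mul R C.Words) (C.brace ∘ₗ sgn C.gr) C.brace c ∈
      lower (C.cobarGr x y) m := by
    refine conv_mem hc hm fun z i j a b ha hi hb hj e => ?_
    rw [LinearMap.comp_apply, sgn_of_mem C.gr hi, map_smul, map_smul, LinearMap.smul_apply]
    refine Submodule.smul_mem _ _ ?_
    -- A product of two letters has degree two less than the sum of the degrees in `C`. One of these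
    -- shifts is used up by the index `m` in place of `m + 1`, the other is recorded by `lower`.
    rcases mem_lower_iff.1 (brace_mem_cobarGr ha hi) with h | ⟨k, rfl, h⟩
    · rw [h, map_zero]; exact zero_mem _
    · have := mul_lower_mem_cobarGr h (brace_mem_cobarGr hb hj)
      rwa [show k + j = m by omega] at this
  rw [letterD_eq']
  exact sub_mem (sub_mem h1 h2) h3

theorem wordD_mem {x y : C.Obj} {n : ℕ} {a : C.Words} (ha : a ∈ C.cobarGr x y n) :
    C.wordD a ∈ lower (C.cobarGr x y) n := by
  refine cobarGr_map_mem (fun p w hw => ?_) ha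
  clear ha
  induction hw with
  | nil x => rw [wordD_one]; exact zero_mem _
  | cons hc hm hw ih =>
    rw [wordD_ι_mul, sgn_of_mem C.gr hm, map_smul, smul_mul_assoc]
    exact sub_mem (lower_mul_mem_cobarGr (letterD_mem hc hm) (Submodule.subset_span ⟨_, hw⟩))
      (Submodule.smul_mem _ _ (mul_lower_mem_cobarGr (ι_mem_cobarGr hc hm) ih))

/-! ### Cotensor products with the cobar construction on both sides -/

section Sandwich

variable {Y : Type w} [AddCommGroup Y] [Module R Y] {Z : Type*} [AddCommGroup Z] [Module R Z]
variable {G : C.Obj → C.Obj → ℕ → Y → Prop} {G' : C.Obj → C.Obj → ℕ → Z → Prop}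

theorem gen_mem_sandwichGr {x y : C.Obj} {n : ℕ} {g : Y} (hg : G x y n g) :
    (1 : C.Words) ⊗ₜ[R] (g ⊗ₜ[R] (1 : C.Words)) ∈ C.sandwichGr G x y n :=
  Submodule.subset_span ⟨x, y, 0, n, 0, 1, g, 1, one_mem_cobarGr x, hg, one_mem_cobarGr y,
    by omega, rfl⟩

theorem tmul_mem_sandwichGr {x x' y' y : C.Obj} {i j k n : ℕ} {a : C.Words} {g : Y} {b : C.Words}
    (ha : a ∈ C.cobarGr x x' i) (hg : G x' y' j g) (hb : b ∈ C.cobarGr y' y k)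
    (e : i + j + k = n) : a ⊗ₜ[R] (g ⊗ₜ[R] b) ∈ C.sandwichGr G x y n :=
  Submodule.subset_span ⟨x', y', i, j, k, a, g, b, ha, hg, hb, e, rfl⟩

/-- A criterion for the values of a linear map. -/
theorem sandwichGr_map_mem {N : Type*} [AddCommGroup N] [Module R N] {L : C.Triple Y →ₗ[R] N}
    {S : Submodule R N} {x y : C.Obj} {n : ℕ}
    (h : ∀ x' y' i j k a g b, a ∈ C.cobarGr x x' i → G x' y' j g → b ∈ C.cobarGr y' y k →
      i + j + k = n → L (a • C.mulRight b (1 ⊗ₜ[R] (g ⊗ₜ[R] 1))) ∈ S)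
    {u : C.Triple Y} (hu : u ∈ C.sandwichGr G x y n) : L u ∈ S := by
  have : C.sandwichGr G x y n ≤ S.comap L := Submodule.span_le.2 fun u hu => by
    obtain ⟨x', y', i, j, k, a, g, b, ha, hg, hb, e, rfl⟩ := hu
    rw [tmul_eq_smul_mulRight]
    exact h x' y' i j k a g b ha hg hb e
  exact this hu

theorem sandwichGr_ext {N : Type*} [AddCommGroup N] [Module R N] {L L' : C.Triple Y →ₗ[R] N}
    {x y : C.Obj} {n : ℕ}
    (h : ∀ x' y' i j k a g b, a ∈ C.cobarGr x x' i → G x' y' j g → b ∈ C.cobarGr y' y k →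
      i + j + k = n → L (a • C.mulRight b (1 ⊗ₜ[R] (g ⊗ₜ[R] 1))) =
        L' (a • C.mulRight b (1 ⊗ₜ[R] (g ⊗ₜ[R] 1))))
    {u : C.Triple Y} (hu : u ∈ C.sandwichGr G x y n) : L u = L' u := by
  have := sandwichGr_map_mem (L := L - L') (S := ⊥) (G := G) (x := x) (y := y) (n := n)
    (fun x' y' i j k a g b ha hg hb e => by
      rw [Submodule.mem_bot, LinearMap.sub_apply, h x' y' i j k a g b ha hg hb e, sub_self]) hu
  rwa [Submodule.mem_bot, LinearMap.sub_apply, sub_eq_zero] at this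

theorem smul_mem_sandwichGr {x z y : C.Obj} {i j : ℕ} {a : C.Words} {u : C.Triple Y}
    (ha : a ∈ C.cobarGr x z i) (hu : u ∈ C.sandwichGr G z y j) :
    a • u ∈ C.sandwichGr G x y (i + j) := by
  refine sandwichGr_map_mem (L := C.lact Y a) (fun x' y' i' j' k a' g b ha' hg hb e => ?_) hu
  rw [lact_apply, ← mul_smul, ← tmul_eq_smul_mulRight]
  exact tmul_mem_sandwichGr (mul_mem_cobarGr ha ha') hg hb (by omega)

theorem mulRight_mem_sandwichGr {x z y : C.Obj} {i j : ℕ} {b : C.Words} {u : C.Triple Y}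
    (hu : u ∈ C.sandwichGr G x z i) (hb : b ∈ C.cobarGr z y j) :
    C.mulRight b u ∈ C.sandwichGr G x y (i + j) := by
  refine sandwichGr_map_mem (L := C.mulRight b) (fun x' y' i' j' k a' g b' ha' hg hb' e => ?_) hu
  rw [mulRight_smul, mulRight_mulRight, ← tmul_eq_smul_mulRight]
  exact tmul_mem_sandwichGr ha' hg (mul_mem_cobarGr hb' hb) (by omega)

theorem lower_smul_mem_sandwichGr {x z y : C.Obj} {i j : ℕ} {a : C.Words} {u : C.Triple Y}
    (ha : a ∈ lower (C.cobarGr x z) i) (hu : u ∈ C.sandwichGr G z y j) :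
    a • u ∈ lower (C.sandwichGr G x y) (i + j) := by
  rcases mem_lower_iff.1 ha with rfl | ⟨k, rfl, ha⟩
  · rw [zero_smul]; exact zero_mem _
  · exact mem_lower_of_eq (smul_mem_sandwichGr ha hu) (by omega)

theorem smul_lower_mem_sandwichGr {x z y : C.Obj} {i j : ℕ} {a : C.Words} {u : C.Triple Y}
    (ha : a ∈ C.cobarGr x z i) (hu : u ∈ lower (C.sandwichGr G z y) j) :
    a • u ∈ lower (C.sandwichGr G x y) (i + j) := by
  rcases mem_lower_iff.1 hu with rfl | ⟨k, rfl, hu⟩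
  · rw [smul_zero]; exact zero_mem _
  · exact mem_lower_of_eq (smul_mem_sandwichGr ha hu) (by omega)

theorem mulRight_lower_mem_sandwichGr {x z y : C.Obj} {i j : ℕ} {b : C.Words} {u : C.Triple Y}
    (hu : u ∈ C.sandwichGr G x z i) (hb : b ∈ lower (C.cobarGr z y) j) :
    C.mulRight b u ∈ lower (C.sandwichGr G x y) (i + j) := by
  rcases mem_lower_iff.1 hb with rfl | ⟨k, rfl, hb⟩
  · rw [mulRight_zero]; exact zero_mem _
  · exact mem_lower_of_eq (mulRight_mem_sandwichGr hu hb) (by omega)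

theorem lower_mulRight_mem_sandwichGr {x z y : C.Obj} {i j : ℕ} {b : C.Words} {u : C.Triple Y}
    (hu : u ∈ lower (C.sandwichGr G x z) i) (hb : b ∈ C.cobarGr z y j) :
    C.mulRight b u ∈ lower (C.sandwichGr G x y) (i + j) := by
  rcases mem_lower_iff.1 hu with rfl | ⟨k, rfl, hu⟩
  · rw [map_zero]; exact zero_mem _
  · exact mem_lower_of_eq (mulRight_mem_sandwichGr hu hb) (by omega)

variable (C G) in
/-- A differential on the cotensor products `M(ΩC) □ Y □ M(ΩC)` that is compatible with
the actions of `ΩC`; here `τ` is the parity operator of `Y`, and `F g` is the differential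
of the generator `1 ⊗ g ⊗ 1`. -/
structure IsDGBimodule (τ : Y →ₗ[R] Y) (F : Y →ₗ[R] C.Triple Y)
    (d : C.Triple Y →ₗ[R] C.Triple Y) : Prop where
  twisted : IsTwisted τ F d
  sign : ∀ {x y n g}, G x y n g → τ g = (-1 : R) ^ n • g
  mem : ∀ {x y n g}, G x y n g → F g ∈ lower (C.sandwichGr G x y) n
  sq : ∀ {x y n g}, G x y n g → d (F g) = 0

namespace IsDGBimodule

variable {τ : Y →ₗ[R] Y} {F : Y →ₗ[R] C.Triple Y} {d : C.Triple Y →ₗ[R] C.Triple Y}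

theorem smul (h : IsDGBimodule C G τ F d) {x z : C.Obj} {i : ℕ} {a : C.Words}
    (ha : a ∈ C.cobarGr x z i) (u : C.Triple Y) :
    d (a • u) = C.wordD a • u + (-1 : R) ^ i • a • d u := by
  rw [h.twisted.smul, wordSgn_of_mem ha, smul_assoc]

theorem tripleSgn (h : IsDGBimodule C G τ F d) {x y : C.Obj} {n : ℕ} {u : C.Triple Y}
    (hu : u ∈ C.sandwichGr G x y n) : C.tripleSgn τ u = (-1 : R) ^ n • u := by
  refine sandwichGr_ext (L' := (-1 : R) ^ n • LinearMap.id)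
    (fun x' y' i j k a g b ha hg hb e => ?_) hu
  subst e
  simp only [tripleSgn_smul, tripleSgn_mulRight, wordSgn_of_mem ha, wordSgn_of_mem hb,
    tripleSgn_tmul, h.sign hg, map_one, LinearMap.smul_apply, LinearMap.id_apply,
    ← smul_tmul', tmul_smul, map_smul, mulRight_rsmul, smul_assoc, smul_smul, pow_add]
  rw [smul_comm a, smul_smul]
  ring_nf

theorem mulRight (h : IsDGBimodule C G τ F d) {x z : C.Obj} {n : ℕ} {u : C.Triple Y}
    (hu : u ∈ C.sandwichGr G x z n) (b : C.Words) :
    d (C.mulRight b u) = C.mulRight b (d u) + (-1 : R) ^ n • C.mulRight (C.wordD b) u := by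
  rw [h.twisted.mulRight, h.tripleSgn hu, map_smul]

theorem map_gen (h : IsDGBimodule C G τ F d) (g : Y) : d (1 ⊗ₜ[R] (g ⊗ₜ[R] 1)) = F g :=
  h.twisted.one_tmul_one g

theorem map_mem (h : IsDGBimodule C G τ F d) {x y : C.Obj} {n : ℕ} {u : C.Triple Y}
    (hu : u ∈ C.sandwichGr G x y n) : d u ∈ lower (C.sandwichGr G x y) n := by
  refine sandwichGr_map_mem (fun x' y' i j k a g b ha hg hb e => ?_) hu
  subst e
  have hg' := gen_mem_sandwichGr hg
  rw [h.smul ha, h.mulRight hg', h.map_gen, add_assoc]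
  refine add_mem (lower_smul_mem_sandwichGr (wordD_mem ha) (mulRight_mem_sandwichGr hg' hb))
    (Submodule.smul_mem _ _ (smul_lower_mem_sandwichGr ha (add_mem ?_ (Submodule.smul_mem _ _ ?_))))
  · exact lower_mulRight_mem_sandwichGr (h.mem hg) hb
  · exact mulRight_lower_mem_sandwichGr hg' (wordD_mem hb)

/-- The value has degree `n - 1`; the sign is written as `-(-1)^n` so that degree zero, where the
value is zero, needs no exception. -/
theorem tripleSgn_map (h : IsDGBimodule C G τ F d) {x y : C.Obj} {n : ℕ} {u : C.Triple Y}
    (hu : u ∈ C.sandwichGr G x y n) : C.tripleSgn τ (d u) = -((-1 : R) ^ n • d u) := by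
  rcases mem_lower_iff.1 (h.map_mem hu) with h0 | ⟨k, rfl, h1⟩
  · simp [h0]
  · rw [h.tripleSgn h1, pow_succ]; simp

/-- Differentiating an outer word and then the rest, or in the other order, gives opposite signs.
Together with `D² = 0` this makes `d²` linear for both actions, so its vanishing on generators
suffices. -/
theorem map_map (h : IsDGBimodule C G τ F d) {x y : C.Obj} {n : ℕ} {u : C.Triple Y}
    (hu : u ∈ C.sandwichGr G x y n) : d (d u) = 0 := by
  refine sandwichGr_ext (L := d ∘ₗ d) (L' := 0) (fun x' y' i j k a g b ha hg hb e => ?_) hu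
  have hg' := gen_mem_sandwichGr hg
  have h1 : d (d (C.mulRight b (1 ⊗ₜ[R] (g ⊗ₜ[R] 1)))) = 0 := by
    rw [h.mulRight hg', map_add, map_smul, h.mulRight hg', wordD_wordD, h.twisted.mulRight,
      h.tripleSgn_map hg', h.map_gen, h.sq hg]
    simp
  rw [LinearMap.comp_apply, h.smul ha, map_add, map_smul d ((-1 : R) ^ i), h.smul ha, h1, h.twisted.smul,
    wordD_wordD, wordSgn_wordD, wordSgn_of_mem ha]
  simp

end IsDGBimodule

/-- The complex `M(ΩC) □ Y □ M(ΩC)`. -/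
abbrev sandwichComplex (G : C.Obj → C.Obj → ℕ → Y → Prop) (d : C.Triple Y →ₗ[R] C.Triple Y)
    (x y : C.Obj) : PresentedComplex.{u, max u v w} R where
  V := C.Triple Y
  gr := C.sandwichGr G x y
  rel := ⊥
  diff := d

theorem IsDGBimodule.isComplex {τ : Y →ₗ[R] Y} {F : Y →ₗ[R] C.Triple Y}
    {d : C.Triple Y →ₗ[R] C.Triple Y} (h : IsDGBimodule C G τ F d) (x y : C.Obj) :
    (sandwichComplex G d x y).IsComplex where
  mem hw := h.map_mem hw
  rel _ hw := by
    obtain rfl := (Submodule.mem_bot R).1 hw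
    rw [map_zero]; exact zero_mem _
  sq n w hw := by
    have : d (d w) = 0 := h.map_map hw
    exact (Submodule.mem_bot R).2 (by simpa [sandwichComplex] using this)

end Sandwich

end CategoricalCoalgebra

namespace CategoricalCoalgebra

open TensorAlgebra TensorProduct Coalgebra Graded

variable {R : Type u} [CommRing R] {C : CategoricalCoalgebra.{u, v} R}

/-! ### Bimodule maps, and identities that follow from generators -/

section BimoduleMap

variable {Y : Type w} [AddCommGroup Y] [Module R Y] {Z : Type w'} [AddCommGroup Z] [Module R Z]
variable {G : C.Obj → C.Obj → ℕ → Y → Prop} {G' : C.Obj → C.Obj → ℕ → Z → Prop}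

variable (C G G') in
/-- A map of degree `k` of `ΩC`-bimodules; `F x` is its restriction to the elements that start at
the object `x`. -/
structure IsBimoduleMap (k : ℕ) (F : C.Obj → C.Triple Y →ₗ[R] C.Triple Z) : Prop where
  mem_gen : ∀ {x y n g}, G x y n g → F x (1 ⊗ₜ[R] (g ⊗ₜ[R] 1)) ∈ C.sandwichGr G' x y (n + k)
  smul : ∀ {x z y i j a u}, a ∈ C.cobarGr x z i → u ∈ C.sandwichGr G z y j →
    F x (a • u) = (-1 : R) ^ (k * i) • a • F z u
  mulRight : ∀ {x z y i j u b}, u ∈ C.sandwichGr G x z i → b ∈ C.cobarGr z y j →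
    F x (C.mulRight b u) = C.mulRight b (F x u)

namespace IsBimoduleMap

variable {k : ℕ} {F : C.Obj → C.Triple Y →ₗ[R] C.Triple Z}

theorem map_mem (h : IsBimoduleMap C G G' k F) {x y : C.Obj} {n : ℕ} {u : C.Triple Y}
    (hu : u ∈ C.sandwichGr G x y n) : F x u ∈ C.sandwichGr G' x y (n + k) := by
  refine sandwichGr_map_mem (fun x' y' i j l a g b ha hg hb e => ?_) hu
  have hg' := gen_mem_sandwichGr hg
  rw [h.smul ha (mulRight_mem_sandwichGr hg' hb), h.mulRight hg' hb]
  refine Submodule.smul_mem _ _ ?_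
  have := smul_mem_sandwichGr ha (mulRight_mem_sandwichGr (h.mem_gen hg) hb)
  rwa [show i + (j + k + l) = n + k by omega] at this

/-- The element `a` has degree `i - 1`, and `k * i + k` has the parity of `k(i - 1)`. The form with
`lower` applies directly to `a` replaced by its differential. -/
theorem lower_smul (h : IsBimoduleMap C G G' k F) {x z y : C.Obj} {i j : ℕ} {a : C.Words}
    {u : C.Triple Y} (ha : a ∈ lower (C.cobarGr x z) i) (hu : u ∈ C.sandwichGr G z y j) :
    F x (a • u) = (-1 : R) ^ (k * i + k) • a • F z u := by
  rcases mem_lower_iff.1 ha with rfl | ⟨l, rfl, ha⟩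
  · simp
  · rw [h.smul ha hu]
    congr 1
    rw [mul_add, mul_one, add_assoc, pow_add _ (k * l), pow_add _ k, neg_one_pow_mul_self, mul_one]

theorem smul_lower (h : IsBimoduleMap C G G' k F) {x z y : C.Obj} {i j : ℕ} {a : C.Words}
    {u : C.Triple Y} (ha : a ∈ C.cobarGr x z i) (hu : u ∈ lower (C.sandwichGr G z y) j) :
    F x (a • u) = (-1 : R) ^ (k * i) • a • F z u := by
  rcases mem_lower_iff.1 hu with rfl | ⟨l, rfl, hu⟩
  · simp
  · exact h.smul ha hu

theorem mulRight_lower (h : IsBimoduleMap C G G' k F) {x z y : C.Obj} {i j : ℕ} {b : C.Words}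
    {u : C.Triple Y} (hu : u ∈ C.sandwichGr G x z i) (hb : b ∈ lower (C.cobarGr z y) j) :
    F x (C.mulRight b u) = C.mulRight b (F x u) := by
  rcases mem_lower_iff.1 hb with rfl | ⟨l, rfl, hb⟩
  · simp
  · exact h.mulRight hu hb

theorem lower_mulRight (h : IsBimoduleMap C G G' k F) {x z y : C.Obj} {i j : ℕ} {b : C.Words}
    {u : C.Triple Y} (hu : u ∈ lower (C.sandwichGr G x z) i) (hb : b ∈ C.cobarGr z y j) :
    F x (C.mulRight b u) = C.mulRight b (F x u) := by
  rcases mem_lower_iff.1 hu with rfl | ⟨l, rfl, hu⟩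
  · simp
  · exact h.mulRight hu hb

variable {τ : Y →ₗ[R] Y} {FY : Y →ₗ[R] C.Triple Y} {d : C.Triple Y →ₗ[R] C.Triple Y}
  {τ' : Z →ₗ[R] Z} {FZ : Z →ₗ[R] C.Triple Z} {d' : C.Triple Z →ₗ[R] C.Triple Z}

/-- A bimodule map of degree zero is a chain map if this holds on generators. -/
theorem comm (h : IsBimoduleMap C G G' 0 F) (hY : IsDGBimodule C G τ FY d)
    (hZ : IsDGBimodule C G' τ' FZ d')
    (hg : ∀ x y n g, G x y n g → F x (FY g) = d' (F x (1 ⊗ₜ[R] (g ⊗ₜ[R] 1))))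
    {x y : C.Obj} {n : ℕ} {u : C.Triple Y} (hu : u ∈ C.sandwichGr G x y n) :
    F x (d u) = d' (F x u) := by
  refine sandwichGr_ext (L := F x ∘ₗ d) (L' := d' ∘ₗ F x)
    (fun x' y' i j l a g b ha hgen hb e => ?_) hu
  have m1 := gen_mem_sandwichGr hgen
  have m2 := mulRight_mem_sandwichGr m1 hb
  have h1 : F x' (d (C.mulRight b (1 ⊗ₜ[R] (g ⊗ₜ[R] 1)))) =
      d' (F x' (C.mulRight b (1 ⊗ₜ[R] (g ⊗ₜ[R] 1)))) := by
    rw [hY.mulRight m1, map_add, map_smul, h.lower_mulRight (hY.map_mem m1) hb,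
      h.mulRight_lower m1 (wordD_mem hb), h.mulRight m1 hb, hZ.mulRight (h.map_mem m1),
      hY.map_gen, hg _ _ _ _ hgen, add_zero]
  rw [LinearMap.comp_apply, LinearMap.comp_apply, hY.smul ha, map_add, map_smul (F x) ((-1 : R) ^ i),
    h.lower_smul (wordD_mem ha) m2, h.smul_lower ha (hY.map_mem m2), h1, h.smul ha m2, map_smul d',
    hZ.smul ha]
  simp

/-- A homotopy relation between bimodule maps holds if it holds on generators. -/
theorem homotopy {π : C.Obj → C.Triple Y →ₗ[R] C.Triple Z}
    {α : C.Obj → C.Triple Z →ₗ[R] C.Triple Y} {H : C.Obj → C.Triple Y →ₗ[R] C.Triple Y}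
    (hπ : IsBimoduleMap C G G' 0 π) (hα : IsBimoduleMap C G' G 0 α)
    (hH : IsBimoduleMap C G G 1 H) (hY : IsDGBimodule C G τ FY d)
    (hg : ∀ x y n g, G x y n g → d (H x (1 ⊗ₜ[R] (g ⊗ₜ[R] 1))) + H x (FY g) =
      α x (π x (1 ⊗ₜ[R] (g ⊗ₜ[R] 1))) - 1 ⊗ₜ[R] (g ⊗ₜ[R] 1))
    {x y : C.Obj} {n : ℕ} {u : C.Triple Y} (hu : u ∈ C.sandwichGr G x y n) :
    d (H x u) + H x (d u) = α x (π x u) - u := by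
  refine sandwichGr_ext (L := d ∘ₗ H x + H x ∘ₗ d) (L' := α x ∘ₗ π x - LinearMap.id)
    (fun x' y' i j l a g b ha hgen hb e => ?_) hu
  have m1 := gen_mem_sandwichGr hgen
  have m2 := mulRight_mem_sandwichGr m1 hb
  have h1 : d (H x' (C.mulRight b (1 ⊗ₜ[R] (g ⊗ₜ[R] 1)))) +
      H x' (d (C.mulRight b (1 ⊗ₜ[R] (g ⊗ₜ[R] 1)))) =
      α x' (π x' (C.mulRight b (1 ⊗ₜ[R] (g ⊗ₜ[R] 1)))) - C.mulRight b (1 ⊗ₜ[R] (g ⊗ₜ[R] 1)) := by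
    have := congrArg (C.mulRight b) (hg _ _ _ _ hgen)
    rw [map_add, map_sub] at this
    rw [hH.mulRight m1 hb, hY.mulRight (hH.map_mem m1), hY.mulRight m1, map_add, map_smul,
      hH.lower_mulRight (hY.map_mem m1) hb, hH.mulRight_lower m1 (wordD_mem hb),
      hπ.mulRight m1 hb, hα.mulRight (hπ.map_mem m1) hb, hY.map_gen, ← this, pow_succ]
    simp only [mul_neg_one, neg_smul]
    abel
  simp only [LinearMap.add_apply, LinearMap.sub_apply, LinearMap.comp_apply, LinearMap.id_apply]
  have h2 := congrArg (fun q => a • q) h1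
  simp only [smul_add, smul_sub] at h2
  -- The two terms with `D a` cancel because `H` has odd degree, and the rest is `a` applied to
  -- `h1`.
  rw [hH.smul ha m2, map_smul d ((-1 : R) ^ (1 * i)), hY.smul ha, hY.smul ha, map_add,
    map_smul (H x) ((-1 : R) ^ i), hH.lower_smul (wordD_mem ha) m2,
    hH.smul_lower ha (hY.map_mem m2), hπ.smul ha m2, map_smul (α x) ((-1 : R) ^ (0 * i)),
    hα.smul ha (hπ.map_mem m2)]
  simp only [one_mul, zero_mul, pow_zero, one_smul, smul_add, smul_smul, neg_one_pow_mul_self,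
    pow_succ, mul_neg_one, neg_smul]
  rw [← h2]
  abel

/-- Two composites of bimodule maps of degree zero agree if they agree on generators. -/
theorem comp_eq_id {π : C.Obj → C.Triple Y →ₗ[R] C.Triple Z}
    {α : C.Obj → C.Triple Z →ₗ[R] C.Triple Y}
    (hπ : IsBimoduleMap C G G' 0 π) (hα : IsBimoduleMap C G' G 0 α)
    (hg : ∀ x y n g, G' x y n g → π x (α x (1 ⊗ₜ[R] (g ⊗ₜ[R] 1))) = 1 ⊗ₜ[R] (g ⊗ₜ[R] 1))
    {x y : C.Obj} {n : ℕ} {u : C.Triple Z} (hu : u ∈ C.sandwichGr G' x y n) :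
    π x (α x u) = u := by
  refine sandwichGr_ext (L := π x ∘ₗ α x) (L' := LinearMap.id)
    (fun x' y' i j l a g b ha hgen hb e => ?_) hu
  have m1 := gen_mem_sandwichGr hgen
  have m2 := mulRight_mem_sandwichGr m1 hb
  rw [LinearMap.comp_apply, hα.smul ha m2, map_smul (π x) ((-1 : R) ^ (0 * i)),
    hπ.smul ha (hα.map_mem m2), hα.mulRight m1 hb, hπ.mulRight (hα.map_mem m1) hb, hg _ _ _ _ hgen]
  simp

end IsBimoduleMap

/-! ### The Hochschild and coHochschild modules -/

theorem cyclicMap_single (F : C.Obj → C.Triple Y →ₗ[R] C.Triple Z) (x y : C.Obj) (u : C.Triple Y)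
    (m : C.Words) : C.cyclicMap F (Finsupp.single (x, y) (u ⊗ₜ[R] m)) =
      Finsupp.single (x, y) (F x u ⊗ₜ[R] m) := by
  simp [cyclicMap]

theorem cyclicDiff_single (d : C.Triple Y →ₗ[R] C.Triple Y) (τ : Y →ₗ[R] Y) (x y : C.Obj)
    (u : C.Triple Y) (m : C.Words) :
    C.cyclicDiff d τ (Finsupp.single (x, y) (u ⊗ₜ[R] m)) =
      Finsupp.single (x, y) (d u ⊗ₜ[R] m) +
        Finsupp.single (x, y) (C.tripleSgn τ u ⊗ₜ[R] C.wordD m) := by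
  simp [cyclicDiff]

theorem single_mem_cyclicGr {x y : C.Obj} {i j n : ℕ} {u : C.Triple Y} {m : C.Words}
    (hu : u ∈ C.sandwichGr G x y i) (hm : m ∈ C.cobarGr y x j) (e : i + j = n) :
    Finsupp.single (x, y) (u ⊗ₜ[R] m) ∈ C.cyclicGr G n :=
  Submodule.subset_span ⟨x, y, i, j, u, m, hu, hm, e, rfl⟩

theorem cyclicGr_map_mem {N : Type*} [AddCommGroup N] [Module R N]
    {L : (C.Obj × C.Obj →₀ C.Triple Y ⊗[R] C.Words) →ₗ[R] N} {S : Submodule R N} {n : ℕ}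
    (h : ∀ x y i j u m, u ∈ C.sandwichGr G x y i → m ∈ C.cobarGr y x j → i + j = n →
      L (Finsupp.single (x, y) (u ⊗ₜ[R] m)) ∈ S)
    {w : C.Obj × C.Obj →₀ C.Triple Y ⊗[R] C.Words} (hw : w ∈ C.cyclicGr G n) : L w ∈ S := by
  have : C.cyclicGr G n ≤ S.comap L := Submodule.span_le.2 fun u hu => by
    obtain ⟨x, y, i, j, u, m, hu, hm, e, rfl⟩ := hu
    exact h x y i j u m hu hm e
  exact this hw

theorem cyclicGr_ext {N : Type*} [AddCommGroup N] [Module R N]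
    {L L' : (C.Obj × C.Obj →₀ C.Triple Y ⊗[R] C.Words) →ₗ[R] N} {n : ℕ}
    (h : ∀ x y i j u m, u ∈ C.sandwichGr G x y i → m ∈ C.cobarGr y x j → i + j = n →
      L (Finsupp.single (x, y) (u ⊗ₜ[R] m)) = L' (Finsupp.single (x, y) (u ⊗ₜ[R] m)))
    {w : C.Obj × C.Obj →₀ C.Triple Y ⊗[R] C.Words} (hw : w ∈ C.cyclicGr G n) : L w = L' w := by
  have := cyclicGr_map_mem (L := L - L') (S := ⊥) (G := G) (n := n)
    (fun x y i j u m hu hm e => by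
      rw [Submodule.mem_bot, LinearMap.sub_apply, h x y i j u m hu hm e, sub_self]) hw
  rwa [Submodule.mem_bot, LinearMap.sub_apply, sub_eq_zero] at this

variable (C G) in
/-- The class of `u ⊗ m` in the quotient by the relations. -/
noncomputable def cyc (x y : C.Obj) (u : C.Triple Y) (m : C.Words) :
    (C.Obj × C.Obj →₀ C.Triple Y ⊗[R] C.Words) ⧸ C.cyclicRel G :=
  (C.cyclicRel G).mkQ (Finsupp.single (x, y) (u ⊗ₜ[R] m))

section cyc

theorem mkQ_single (x y : C.Obj) (u : C.Triple Y) (m : C.Words) :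
    (C.cyclicRel G).mkQ (Finsupp.single (x, y) (u ⊗ₜ[R] m)) = C.cyc G x y u m := rfl

variable {x y z : C.Obj}

theorem cyc_add_left (u u' : C.Triple Y) (m : C.Words) :
    C.cyc G x y (u + u') m = C.cyc G x y u m + C.cyc G x y u' m := by
  simp only [cyc, add_tmul, Finsupp.single_add, map_add]

theorem cyc_add_right (u : C.Triple Y) (m m' : C.Words) :
    C.cyc G x y u (m + m') = C.cyc G x y u m + C.cyc G x y u m' := by
  simp only [cyc, tmul_add, Finsupp.single_add, map_add]

theorem cyc_smul_left (r : R) (u : C.Triple Y) (m : C.Words) :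
    C.cyc G x y (r • u) m = r • C.cyc G x y u m := by
  simp only [cyc, ← smul_tmul', ← Finsupp.smul_single, map_smul]

theorem cyc_smul_right (r : R) (u : C.Triple Y) (m : C.Words) :
    C.cyc G x y u (r • m) = r • C.cyc G x y u m := by
  simp only [cyc, tmul_smul, ← Finsupp.smul_single, map_smul]

@[simp] theorem cyc_zero_left (m : C.Words) : C.cyc G x y 0 m = 0 := by simp [cyc]

@[simp] theorem cyc_zero_right (u : C.Triple Y) : C.cyc G x y u 0 = 0 := by simp [cyc]

theorem cyc_mulRight {i j k : ℕ} {u : C.Triple Y} {a m : C.Words}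
    (hu : u ∈ C.sandwichGr G x z i) (ha : a ∈ C.cobarGr z y j) (hm : m ∈ C.cobarGr y x k) :
    C.cyc G x y (C.mulRight a u) m = C.cyc G x z u (a * m) := by
  rw [cyc, cyc, ← sub_eq_zero, ← map_sub, Submodule.mkQ_apply, Submodule.Quotient.mk_eq_zero]
  exact Submodule.subset_span (.inl ⟨x, y, z, i, j, k, u, a, m, hu, ha, hm, rfl⟩)

theorem cyc_smul {i j k : ℕ} {u : C.Triple Y} {a m : C.Words}
    (ha : a ∈ C.cobarGr x z i) (hu : u ∈ C.sandwichGr G z y j) (hm : m ∈ C.cobarGr y x k) :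
    C.cyc G x y (a • u) m = (-1 : R) ^ (i * (j + k)) • C.cyc G z y u (m * a) := by
  rw [cyc, cyc, ← sub_eq_zero, ← map_smul, ← map_sub, Submodule.mkQ_apply,
    Submodule.Quotient.mk_eq_zero]
  exact Submodule.subset_span (.inr ⟨x, y, z, i, j, k, a, u, m, ha, hu, hm, rfl⟩)

/-- Lowering the degree of one of the three factors changes the sign exponent `i(j + k)` by `j + k`
or by `i`. This statement and its companions cover the values of the differentials, including zero
in degree zero. -/
theorem cyc_smul_lower₁ {i j k : ℕ} {u : C.Triple Y} {a m : C.Words}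
    (ha : a ∈ lower (C.cobarGr x z) i) (hu : u ∈ C.sandwichGr G z y j) (hm : m ∈ C.cobarGr y x k) :
    C.cyc G x y (a • u) m = (-1 : R) ^ (i * (j + k) + (j + k)) • C.cyc G z y u (m * a) := by
  rcases mem_lower_iff.1 ha with rfl | ⟨l, rfl, ha⟩
  · simp
  · rw [cyc_smul ha hu hm]
    congr 1
    rw [add_mul, one_mul, add_assoc, pow_add _ (l * (j + k)), pow_add _ (j + k),
      neg_one_pow_mul_self, mul_one]

theorem cyc_smul_lower₂ {i j k : ℕ} {u : C.Triple Y} {a m : C.Words}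
    (ha : a ∈ C.cobarGr x z i) (hu : u ∈ lower (C.sandwichGr G z y) j) (hm : m ∈ C.cobarGr y x k) :
    C.cyc G x y (a • u) m = (-1 : R) ^ (i * (j + k) + i) • C.cyc G z y u (m * a) := by
  rcases mem_lower_iff.1 hu with rfl | ⟨l, rfl, hu⟩
  · simp
  · rw [cyc_smul ha hu hm]
    congr 1
    rw [show i * (l + 1 + k) + i = i * (l + k) + (i + i) by ring, pow_add _ (i * (l + k)),
      pow_add _ i, neg_one_pow_mul_self, mul_one]

theorem cyc_smul_lower₃ {i j k : ℕ} {u : C.Triple Y} {a m : C.Words}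
    (ha : a ∈ C.cobarGr x z i) (hu : u ∈ C.sandwichGr G z y j) (hm : m ∈ lower (C.cobarGr y x) k) :
    C.cyc G x y (a • u) m = (-1 : R) ^ (i * (j + k) + i) • C.cyc G z y u (m * a) := by
  rcases mem_lower_iff.1 hm with rfl | ⟨l, rfl, hm⟩
  · simp
  · rw [cyc_smul ha hu hm]
    congr 1
    rw [show i * (j + (l + 1)) + i = i * (j + l) + (i + i) by ring, pow_add _ (i * (j + l)),
      pow_add _ i, neg_one_pow_mul_self, mul_one]

theorem cyc_mulRight_lower₁ {i j k : ℕ} {u : C.Triple Y} {a m : C.Words}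
    (hu : u ∈ lower (C.sandwichGr G x z) i) (ha : a ∈ C.cobarGr z y j) (hm : m ∈ C.cobarGr y x k) :
    C.cyc G x y (C.mulRight a u) m = C.cyc G x z u (a * m) := by
  rcases mem_lower_iff.1 hu with rfl | ⟨l, rfl, hu⟩
  · simp
  · exact cyc_mulRight hu ha hm

theorem cyc_mulRight_lower₂ {i j k : ℕ} {u : C.Triple Y} {a m : C.Words}
    (hu : u ∈ C.sandwichGr G x z i) (ha : a ∈ lower (C.cobarGr z y) j) (hm : m ∈ C.cobarGr y x k) :
    C.cyc G x y (C.mulRight a u) m = C.cyc G x z u (a * m) := by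
  rcases mem_lower_iff.1 ha with rfl | ⟨l, rfl, ha⟩
  · simp
  · exact cyc_mulRight hu ha hm

theorem cyc_mulRight_lower₃ {i j k : ℕ} {u : C.Triple Y} {a m : C.Words}
    (hu : u ∈ C.sandwichGr G x z i) (ha : a ∈ C.cobarGr z y j) (hm : m ∈ lower (C.cobarGr y x) k) :
    C.cyc G x y (C.mulRight a u) m = C.cyc G x z u (a * m) := by
  rcases mem_lower_iff.1 hm with rfl | ⟨l, rfl, hm⟩
  · simp
  · exact cyc_mulRight hu ha hm

/-- A criterion for a linear map to vanish on the relations. -/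
theorem cyclicRel_le {N : Type*} [AddCommGroup N] [Module R N]
    {L : (C.Obj × C.Obj →₀ C.Triple Y ⊗[R] C.Words) →ₗ[R] N}
    (h1 : ∀ x y z i j k u a m, u ∈ C.sandwichGr G x z i → a ∈ C.cobarGr z y j →
      m ∈ C.cobarGr y x k → L (Finsupp.single (x, y) (C.mulRight a u ⊗ₜ[R] m)) =
        L (Finsupp.single (x, z) (u ⊗ₜ[R] (a * m))))
    (h2 : ∀ x y z i j k a u m, a ∈ C.cobarGr x z i → u ∈ C.sandwichGr G z y j →
      m ∈ C.cobarGr y x k → L (Finsupp.single (x, y) ((a • u) ⊗ₜ[R] m)) =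
        (-1 : R) ^ (i * (j + k)) • L (Finsupp.single (z, y) (u ⊗ₜ[R] (m * a))))
    {w : C.Obj × C.Obj →₀ C.Triple Y ⊗[R] C.Words} (hw : w ∈ C.cyclicRel G) : L w = 0 := by
  have : C.cyclicRel G ≤ LinearMap.ker L := by
    refine Submodule.span_le.2 ?_
    rintro _ (⟨x, y, z, i, j, k, u, a, m, hu, ha, hm, rfl⟩ | ⟨x, y, z, i, j, k, a, u, m, ha, hu, hm, rfl⟩)
    · rw [SetLike.mem_coe, LinearMap.mem_ker, map_sub, h1 x y z i j k u a m hu ha hm, sub_self]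
    · rw [SetLike.mem_coe, LinearMap.mem_ker, map_sub, map_smul, h2 x y z i j k a u m ha hu hm,
        sub_self]
  exact this hw

theorem mem_cyclicRel_iff {w : C.Obj × C.Obj →₀ C.Triple Y ⊗[R] C.Words} :
    w ∈ C.cyclicRel G ↔ (C.cyclicRel G).mkQ w = 0 := by
  rw [Submodule.mkQ_apply, Submodule.Quotient.mk_eq_zero]

end cyc

/-- The tensor product of `M(ΩC) □ Y □ M(ΩC)` with `M(ΩC)` over `M(ΩC) ⊗ M(ΩC)ᵒᵖ`. -/
noncomputable abbrev cyclicComplex (G : C.Obj → C.Obj → ℕ → Y → Prop)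
    (d : C.Triple Y →ₗ[R] C.Triple Y) (τ : Y →ₗ[R] Y) : PresentedComplex.{u, max u v w} R where
  V := C.Obj × C.Obj →₀ C.Triple Y ⊗[R] C.Words
  gr := C.cyclicGr G
  rel := C.cyclicRel G
  diff := C.cyclicDiff d τ

section

variable {τ : Y →ₗ[R] Y} {FY : Y →ₗ[R] C.Triple Y} {d : C.Triple Y →ₗ[R] C.Triple Y}
  {τ' : Z →ₗ[R] Z} {FZ : Z →ₗ[R] C.Triple Z} {d' : C.Triple Z →ₗ[R] C.Triple Z}

theorem IsDGBimodule.cyclicDiff_single (h : IsDGBimodule C G τ FY d) {x y : C.Obj} {n : ℕ}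
    {u : C.Triple Y} (hu : u ∈ C.sandwichGr G x y n) (m : C.Words) :
    C.cyclicDiff d τ (Finsupp.single (x, y) (u ⊗ₜ[R] m)) =
      Finsupp.single (x, y) (d u ⊗ₜ[R] m) +
        (-1 : R) ^ n • Finsupp.single (x, y) (u ⊗ₜ[R] C.wordD m) := by
  rw [CategoricalCoalgebra.cyclicDiff_single, h.tripleSgn hu, ← smul_tmul', Finsupp.smul_single]

set_option maxHeartbeats 800000 in
-- By the Leibniz rules, differentiating a relation gives three pairs of terms, one for each
-- differentiated factor, and each pair is an instance of the same relation with that factor lowered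
-- by one degree.
theorem IsDGBimodule.cyclicDiff_mem_rel (h : IsDGBimodule C G τ FY d)
    {w : C.Obj × C.Obj →₀ C.Triple Y ⊗[R] C.Words} (hw : w ∈ C.cyclicRel G) :
    C.cyclicDiff d τ w ∈ C.cyclicRel G := by
  rw [mem_cyclicRel_iff, ← LinearMap.comp_apply]
  refine cyclicRel_le (fun x y z i j k u a m hu ha hm => ?_)
    (fun x y z i j k a u m ha hu hm => ?_) hw
  · rw [LinearMap.comp_apply, LinearMap.comp_apply,
      h.cyclicDiff_single (mulRight_mem_sandwichGr hu ha), h.cyclicDiff_single hu, map_add, map_add,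
      map_smul, map_smul]
    simp only [mkQ_single]
    rw [h.mulRight hu, cyc_add_left, cyc_smul_left, cyc_mulRight_lower₁ (h.map_mem hu) ha hm,
      cyc_mulRight_lower₂ hu (wordD_mem ha) hm, cyc_mulRight_lower₃ hu ha (wordD_mem hm),
      wordD_mul, wordSgn_of_mem ha, cyc_add_right, smul_mul_assoc, cyc_smul_right, smul_add,
      smul_smul, ← pow_add, add_assoc]
  · rw [LinearMap.comp_apply, LinearMap.comp_apply,
      h.cyclicDiff_single (smul_mem_sandwichGr ha hu), h.cyclicDiff_single hu, map_add, map_add,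
      map_smul _ ((-1 : R) ^ (i + j)), map_smul _ ((-1 : R) ^ j)]
    simp only [mkQ_single]
    have r1 := cyc_smul_lower₁ (wordD_mem ha) hu hm
    have hu' := h.map_mem hu
    have r2 := cyc_smul_lower₂ ha hu' hm
    have r3 := cyc_smul_lower₃ ha hu (wordD_mem hm)
    rw [h.smul ha, cyc_add_left, cyc_smul_left, r1, r2, r3, wordD_mul,
      wordSgn_of_mem hm, cyc_add_right, Algebra.smul_mul_assoc, cyc_smul_right]
    have e1 : ((-1 : R) ^ i * (-1) ^ i) = 1 := neg_one_pow_mul_self i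
    -- After this only `(-1)^i * (-1)^i = 1` is needed to match the signs.
    generalize (i * (j + k)) = s
    simp only [smul_add, smul_smul, pow_add]
    rw [show (-1 : R) ^ i * ((-1) ^ s * (-1) ^ i) = (-1) ^ s by linear_combination (-1 : R) ^ s * e1,
      show (-1 : R) ^ i * (-1) ^ j * ((-1) ^ s * (-1) ^ i) = (-1) ^ s * (-1) ^ j by
        linear_combination (-1 : R) ^ s * (-1 : R) ^ j * e1,
      show (-1 : R) ^ s * ((-1) ^ j * (-1) ^ k) = (-1) ^ s * (-1) ^ j * (-1) ^ k by ring]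
    abel

theorem IsDGBimodule.cyclicDiff_mem (h : IsDGBimodule C G τ FY d) {n : ℕ}
    {w : C.Obj × C.Obj →₀ C.Triple Y ⊗[R] C.Words} (hw : w ∈ C.cyclicGr G n) :
    C.cyclicDiff d τ w ∈ lower (C.cyclicGr G) n := by
  refine cyclicGr_map_mem (fun x y i j u m hu hm e => ?_) hw
  rw [h.cyclicDiff_single hu]
  refine add_mem ?_ (Submodule.smul_mem _ _ ?_)
  · rcases mem_lower_iff.1 (h.map_mem hu) with h0 | ⟨l, rfl, h1⟩
    · simp [h0]
    · exact mem_lower_of_eq (single_mem_cyclicGr h1 hm rfl) (by omega)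
  · rcases mem_lower_iff.1 (wordD_mem hm) with h0 | ⟨l, rfl, h1⟩
    · simp [h0]
    · exact mem_lower_of_eq (single_mem_cyclicGr hu h1 rfl) (by omega)

theorem IsDGBimodule.cyclicDiff_sq (h : IsDGBimodule C G τ FY d) {n : ℕ}
    {w : C.Obj × C.Obj →₀ C.Triple Y ⊗[R] C.Words} (hw : w ∈ C.cyclicGr G n) :
    C.cyclicDiff d τ (C.cyclicDiff d τ w) = 0 := by
  refine cyclicGr_ext (L := C.cyclicDiff d τ ∘ₗ C.cyclicDiff d τ) (L' := 0)
    (fun x y i j u m hu hm e => ?_) hw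
  rw [LinearMap.comp_apply, h.cyclicDiff_single hu, map_add, map_smul,
    -- The squares of the two parts of the differential vanish. The mixed terms cancel because `d`
    -- reverses the parity of the first factor.
    h.cyclicDiff_single hu, CategoricalCoalgebra.cyclicDiff_single, h.map_map hu, wordD_wordD,
    h.tripleSgn_map hu]
  simp [neg_tmul, ← smul_tmul']

theorem IsDGBimodule.isComplex_cyclic (h : IsDGBimodule C G τ FY d) :
    (cyclicComplex G d τ).IsComplex where
  mem hw := h.cyclicDiff_mem hw
  rel _ hw := h.cyclicDiff_mem_rel hw
  sq n w hw := by
    have e : C.cyclicDiff d τ (C.cyclicDiff d τ w) = 0 := h.cyclicDiff_sq hw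
    have : (C.cyclicDiff d τ ∘ₗ C.cyclicDiff d τ) w - 0 = 0 := by simp [e]
    exact this ▸ zero_mem (C.cyclicRel G)

/-- A bimodule map induces a map of the tensor products. -/
theorem IsBimoduleMap.cyclicMap_mem {k : ℕ} {F : C.Obj → C.Triple Y →ₗ[R] C.Triple Z}
    (h : IsBimoduleMap C G G' k F) {n : ℕ} {w : C.Obj × C.Obj →₀ C.Triple Y ⊗[R] C.Words}
    (hw : w ∈ C.cyclicGr G n) : C.cyclicMap F w ∈ C.cyclicGr G' (n + k) := by
  refine cyclicGr_map_mem (L := C.cyclicMap F) (fun x y i j u m hu hm e => ?_) hw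
  rw [cyclicMap_single]
  exact single_mem_cyclicGr (h.map_mem hu) hm (by omega)

theorem IsBimoduleMap.cyclicMap_mem_rel {k : ℕ} {F : C.Obj → C.Triple Y →ₗ[R] C.Triple Z}
    (h : IsBimoduleMap C G G' k F) {w : C.Obj × C.Obj →₀ C.Triple Y ⊗[R] C.Words}
    (hw : w ∈ C.cyclicRel G) : C.cyclicMap F w ∈ C.cyclicRel G' := by
  rw [mem_cyclicRel_iff, ← LinearMap.comp_apply]
  refine cyclicRel_le (fun x y z i j l u a m hu ha hm => ?_)
    (fun x y z i j l a u m ha hu hm => ?_) hw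
  · rw [LinearMap.comp_apply, LinearMap.comp_apply, cyclicMap_single, cyclicMap_single,
      h.mulRight hu ha]
    exact cyc_mulRight (h.map_mem hu) ha hm
  · rw [LinearMap.comp_apply, LinearMap.comp_apply, cyclicMap_single, cyclicMap_single,
      h.smul ha hu, ← smul_tmul', ← Finsupp.smul_single, map_smul _ ((-1 : R) ^ (k * i))]
    refine (congrArg _ (cyc_smul ha (h.map_mem hu) hm)).trans ?_
    -- The sign for moving `F` past `a` equals the sign caused by the degree of `F` in the cyclic
    -- relation, so the two cancel.
    rw [smul_smul, ← pow_add, show k * i + i * (j + k + l) = i * (j + l) + (k * i + k * i) by ring,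
      pow_add, pow_add _ (k * i), neg_one_pow_mul_self, mul_one]
    rfl

end

end BimoduleMap

/-! ### Assembling a contraction from identities on generators -/

theorem sub_mem_of_eq {M : Type*} [AddCommGroup M] [Module R M] {S : Submodule R M} {a b : M}
    (h : a = b) : a - b ∈ S := by
  rw [h, sub_self]; exact zero_mem _

theorem map_mem_of_mem_bot {M N : Type*} [AddCommGroup M] [Module R M] [AddCommGroup N] [Module R N]
    (L : M →ₗ[R] N) {a : M} (h : a ∈ (⊥ : Submodule R M)) : L a ∈ (⊥ : Submodule R N) := by
  rw [(Submodule.mem_bot R).1 h, map_zero]; exact zero_mem _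

/-- A chain contraction and the induced chain contraction of the tensor products, from
the equations on generators. -/
theorem isChainContraction_of_gen {Y : Type (max u v)} [AddCommGroup Y] [Module R Y] {Z : Type v}
    [AddCommGroup Z] [Module R Z]
    {G : C.Obj → C.Obj → ℕ → Y → Prop} {G' : C.Obj → C.Obj → ℕ → Z → Prop}
    {τ : Y →ₗ[R] Y} {FY : Y →ₗ[R] C.Triple Y} {d : C.Triple Y →ₗ[R] C.Triple Y}
    {τ' : Z →ₗ[R] Z} {FZ : Z →ₗ[R] C.Triple Z} {d' : C.Triple Z →ₗ[R] C.Triple Z}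
    {π : C.Obj → C.Triple Y →ₗ[R] C.Triple Z}
    {α : C.Obj → C.Triple Z →ₗ[R] C.Triple Y} {H : C.Obj → C.Triple Y →ₗ[R] C.Triple Y}
    (hY : IsDGBimodule C G τ FY d) (hZ : IsDGBimodule C G' τ' FZ d')
    (hπ : IsBimoduleMap C G G' 0 π) (hα : IsBimoduleMap C G' G 0 α)
    (hH : IsBimoduleMap C G G 1 H)
    (cπ : ∀ x y n g, G x y n g → π x (FY g) = d' (π x (1 ⊗ₜ[R] (g ⊗ₜ[R] 1))))
    (cα : ∀ x y n g, G' x y n g → α x (FZ g) = d (α x (1 ⊗ₜ[R] (g ⊗ₜ[R] 1))))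
    (hid : ∀ x y n g, G' x y n g → π x (α x (1 ⊗ₜ[R] (g ⊗ₜ[R] 1))) = 1 ⊗ₜ[R] (g ⊗ₜ[R] 1))
    (hho : ∀ x y n g, G x y n g → d (H x (1 ⊗ₜ[R] (g ⊗ₜ[R] 1))) + H x (FY g) =
      α x (π x (1 ⊗ₜ[R] (g ⊗ₜ[R] 1))) - 1 ⊗ₜ[R] (g ⊗ₜ[R] 1)) :
    (∀ x y, PresentedComplex.IsChainContraction (sandwichComplex G d x y)
      (sandwichComplex G' d' x y) (π x) (α x) (H x)) ∧
    PresentedComplex.IsChainContraction (cyclicComplex G d τ) (cyclicComplex G' d' τ')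
      (C.cyclicMap π) (C.cyclicMap α) (C.cyclicMap H) := by
  refine ⟨fun x y => ?_, ?_⟩
  · refine ⟨hY.isComplex x y, hZ.isComplex x y,
      ⟨⟨hπ.map_mem, fun _ => map_mem_of_mem_bot _⟩, fun n w hw => ?_⟩,
      ⟨⟨hα.map_mem, fun _ => map_mem_of_mem_bot _⟩, fun n w hw => ?_⟩,
      ⟨hH.map_mem, fun _ => map_mem_of_mem_bot _⟩, fun n w hw => ?_, fun n w hw => ?_⟩
    all_goals refine sub_mem_of_eq ?_
    · exact hπ.comm hY hZ cπ hw
    · exact hα.comm hZ hY cα hw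
    · exact hπ.comp_eq_id hα hid hw
    · exact hπ.homotopy hα hH hY hho hw
  · refine ⟨hY.isComplex_cyclic, hZ.isComplex_cyclic,
      ⟨⟨hπ.cyclicMap_mem, fun _ => hπ.cyclicMap_mem_rel⟩, fun n w hw => ?_⟩,
      ⟨⟨hα.cyclicMap_mem, fun _ => hα.cyclicMap_mem_rel⟩, fun n w hw => ?_⟩,
      ⟨hH.cyclicMap_mem, fun _ => hH.cyclicMap_mem_rel⟩, fun n w hw => ?_, fun n w hw => ?_⟩
    all_goals refine sub_mem_of_eq (cyclicGr_ext (fun x y i j u m hu hm e => ?_) hw)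
    · simp only [LinearMap.comp_apply, hY.cyclicDiff_single hu, cyclicMap_single, map_add, map_smul,
        hZ.cyclicDiff_single (hπ.map_mem hu), hπ.comm hY hZ cπ hu, add_zero]
    · simp only [LinearMap.comp_apply, hZ.cyclicDiff_single hu, cyclicMap_single, map_add, map_smul,
        hY.cyclicDiff_single (hα.map_mem hu), hα.comm hZ hY cα hu, add_zero]
    · simp only [LinearMap.comp_apply, cyclicMap_single, hπ.comp_eq_id hα hid hu, LinearMap.id_apply]
    · simp only [LinearMap.comp_apply, LinearMap.add_apply, LinearMap.sub_apply, cyclicMap_single,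
        hY.cyclicDiff_single hu, map_add, map_smul, hY.cyclicDiff_single (hH.map_mem hu),
        LinearMap.id_apply]
      -- The terms with `D m` cancel because `H` shifts the degree of the first factor by one; what
      -- is left is the homotopy equation tensored with `m`.
      rw [← Finsupp.single_sub, ← sub_tmul, ← hπ.homotopy hα hH hY hho hu, add_tmul,
        Finsupp.single_add, pow_succ, mul_neg_one, neg_smul]
      abel

end CategoricalCoalgebra

namespace CategoricalCoalgebra

open TensorAlgebra TensorProduct Coalgebra Graded

variable {R : Type u} [CommRing R] {C D : CategoricalCoalgebra.{u, v} R}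

/-! ### Morphisms: compatibility with signs, coproducts and boundaries -/

namespace Hom

variable (f : Hom C D)

/-- The coalgebra map as a linear map. -/
abbrev lin : C.carrier →ₗ[R] D.carrier := (f.f₀ : C.carrier →ₗ[R] D.carrier)

/-- The functional `ε f₁`. -/
noncomputable def eps : C.carrier →ₗ[R] R := counit ∘ₗ f.f₁

theorem lin_mem {n : ℕ} {c : C.carrier} (hc : c ∈ C.gr n) : f.lin c ∈ D.gr n := f.f₀_mem hc

theorem eps_of_mem {n : ℕ} {c : C.carrier} (hc : c ∈ C.gr n) (hn : n ≠ 1) : f.eps c = 0 := by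
  simp [eps, f.f₁_eq_zero hc hn]

theorem lin_comp_sgn : f.lin ∘ₗ sgn C.gr = sgn D.gr ∘ₗ f.lin :=
  linearMap_ext C.gr fun n c hc => by
    rw [LinearMap.comp_apply, LinearMap.comp_apply, sgn_of_mem C.gr hc,
      sgn_of_mem D.gr (f.lin_mem hc), map_smul]

theorem lin_comp_zeroPart : f.lin ∘ₗ zeroPart C.gr = zeroPart D.gr ∘ₗ f.lin :=
  linearMap_ext C.gr fun n c hc => by
    rcases eq_or_ne n 0 with rfl | hn
    · rw [LinearMap.comp_apply, LinearMap.comp_apply, zeroPart_of_mem_zero C.gr hc,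
        zeroPart_of_mem_zero D.gr (f.lin_mem hc)]
    · rw [LinearMap.comp_apply, LinearMap.comp_apply, zeroPart_of_mem C.gr hc hn,
        zeroPart_of_mem D.gr (f.lin_mem hc) hn, map_zero]

theorem lin_comp_posPart : f.lin ∘ₗ posPart C.gr = posPart D.gr ∘ₗ f.lin :=
  linearMap_ext C.gr fun n c hc => by
    rcases eq_or_ne n 0 with rfl | hn
    · rw [LinearMap.comp_apply, LinearMap.comp_apply, posPart_of_mem_zero C.gr hc,
        posPart_of_mem_zero D.gr (f.lin_mem hc), map_zero]
    · rw [LinearMap.comp_apply, LinearMap.comp_apply, posPart_of_mem C.gr hc hn,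
        posPart_of_mem D.gr (f.lin_mem hc) hn]

theorem eps_comp_sgn : f.eps ∘ₗ sgn C.gr = -f.eps :=
  linearMap_ext C.gr fun n c hc => by
    rcases eq_or_ne n 1 with rfl | hn
    · simp [sgn_of_mem C.gr hc]
    · simp [sgn_of_mem C.gr hc, f.eps_of_mem hc hn]

theorem eps_comp_posPart : f.eps ∘ₗ posPart C.gr = f.eps :=
  linearMap_ext C.gr fun n c hc => by
    rcases eq_or_ne n 0 with rfl | hn
    · simp [posPart_of_mem_zero C.gr hc, f.eps_of_mem hc]
    · simp [posPart_of_mem C.gr hc hn]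

theorem map_comul (c : C.carrier) : map f.lin f.lin (comul c) = comul (f.lin c) :=
  CoalgHomClass.map_comp_comul_apply f.f₀ c

theorem conv_comp_lin {M N P : Type*} [AddCommGroup M] [Module R M] [AddCommGroup N] [Module R N]
    [AddCommGroup P] [Module R P] (β : M →ₗ[R] N →ₗ[R] P) (g : D.carrier →ₗ[R] M)
    (k : D.carrier →ₗ[R] N) : conv β g k ∘ₗ f.lin = conv β (g ∘ₗ f.lin) (k ∘ₗ f.lin) := by
  have : (comul : D.carrier →ₗ[R] _) ∘ₗ f.lin = map f.lin f.lin ∘ₗ comul :=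
    LinearMap.ext fun c => (f.map_comul c).symm
  rw [conv, conv, LinearMap.comp_assoc, LinearMap.comp_assoc, this, map_comp, LinearMap.comp_assoc]

/-- The functional `ε f₁` is supported in degree one, so the Koszul sign of `Δᵒᵖ` is the parity of
the other leg and can be written with the parity operator. -/
theorem lin_comp_bd : f.lin ∘ₗ C.bd = D.bd ∘ₗ f.lin +
    conv (LinearMap.lsmul R D.carrier) f.eps f.lin -
      conv (LinearMap.lsmul R D.carrier).flip (f.lin ∘ₗ sgn C.gr) f.eps := by
  rw [f.f₀_bd, LinearMap.comp_sub, LinearMap.comp_sub, conv_eq, conv_eq, ← add_sub_assoc]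
  simp only [← LinearMap.comp_assoc]
  congr 2
  · congr 2
    ext; simp [eps]
  · refine tensor_ext fun i j a ha b hb => ?_
    change (TensorProduct.lid R D.carrier) (map f.eps f.lin (swap C.gr (a ⊗ₜ b))) = _
    rw [swap_tmul_of_mem C.gr ha hb]
    rcases eq_or_ne j 1 with rfl | hj
    · simp only [mul_one, map_smul, map_tmul, lid_tmul, lift.tmul, LinearMap.compl₁₂_apply,
        LinearMap.comp_apply, sgn_of_mem C.gr ha, LinearMap.smul_apply]
      rfl
    · simp [f.eps_of_mem hb hj]

theorem curv_lin : D.curv ∘ₗ f.lin = C.curv - f.eps ∘ₗ C.bd +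
    conv (LinearMap.mul R R) f.eps f.eps := f.curv_f₀

/-! ### The functor `Ωf` -/

@[simp] theorem onWords_ι (c : C.carrier) : f.onWords (ι R c) =
    ι R (f.lin c) + algebraMap R _ (f.eps c) := by
  simp [onWords, eps]

theorem onWords_brace (c : C.carrier) : f.onWords (C.brace c) =
    D.brace (f.lin c) + algebraMap R _ (f.eps c) := by
  rw [brace_apply, onWords_ι, brace_apply]
  congr 2
  · exact LinearMap.congr_fun f.lin_comp_posPart c
  · exact LinearMap.congr_fun f.eps_comp_posPart c

theorem onWords_wordSgn (w : C.Words) : f.onWords (C.wordSgn w) = D.wordSgn (f.onWords w) := by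
  have : f.onWords.comp C.wordSgn = D.wordSgn.comp f.onWords := by
    ext c
    have h1 := LinearMap.congr_fun f.lin_comp_sgn c
    have h2 := LinearMap.congr_fun f.eps_comp_sgn c
    simp only [LinearMap.comp_apply, LinearMap.neg_apply] at h1 h2
    simp [h1, h2, add_comm]
  exact AlgHom.congr_fun this w

/-- The quadratic part of `D{c}` turns into a product of two sums of a letter and a scalar. Its
mixed terms cancel the correction in `f₀∂`, while its scalar term and `ε f₁ ∂` are those that
compare the two curvatures. -/
theorem onWords_comp_letterD : f.onWords.toLinearMap ∘ₗ C.letterD = D.letterD ∘ₗ f.lin := by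
  have h1 : f.onWords.toLinearMap ∘ₗ
      conv (LinearMap.mul R C.Words) (C.brace ∘ₗ sgn C.gr) C.brace =
      conv (LinearMap.mul R D.Words) (D.brace ∘ₗ f.lin ∘ₗ sgn C.gr - Algebra.linearMap R _ ∘ₗ f.eps)
        (D.brace ∘ₗ f.lin + Algebra.linearMap R _ ∘ₗ f.eps) :=
    comp_conv fun a b => by
      have h2 := LinearMap.congr_fun f.eps_comp_sgn a
      simp only [LinearMap.comp_apply, LinearMap.neg_apply] at h2
      simp [onWords_brace, h2, sub_eq_add_neg, add_mul]
  have h2 : f.onWords.toLinearMap ∘ₗ C.brace ∘ₗ C.bd =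
      D.brace ∘ₗ f.lin ∘ₗ C.bd + Algebra.linearMap R _ ∘ₗ f.eps ∘ₗ C.bd := by
    ext c; simp [onWords_brace]
  have h3 : D.brace ∘ₗ conv (LinearMap.lsmul R D.carrier) f.eps f.lin =
      conv (LinearMap.mul R D.Words) (Algebra.linearMap R _ ∘ₗ f.eps) (D.brace ∘ₗ f.lin) :=
    comp_conv fun a b => by simp [Algebra.smul_def]
  have h4 : D.brace ∘ₗ conv (LinearMap.lsmul R D.carrier).flip (f.lin ∘ₗ sgn C.gr) f.eps =
      conv (LinearMap.mul R D.Words) (D.brace ∘ₗ f.lin ∘ₗ sgn C.gr)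
        (Algebra.linearMap R _ ∘ₗ f.eps) :=
    comp_conv fun a b => by
      simp only [LinearMap.flip_apply, LinearMap.lsmul_apply, map_smul,
        LinearMap.mul_apply', LinearMap.comp_apply, Algebra.linearMap_apply]
      rw [← Algebra.commutes, Algebra.smul_def]
  have h5 : Algebra.linearMap R D.Words ∘ₗ conv (LinearMap.mul R R) f.eps f.eps =
      conv (LinearMap.mul R D.Words) (Algebra.linearMap R _ ∘ₗ f.eps)
        (Algebra.linearMap R _ ∘ₗ f.eps) := comp_conv fun a b => by simp
  have h6 : f.onWords.toLinearMap ∘ₗ Algebra.linearMap R C.Words ∘ₗ C.curv =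
      Algebra.linearMap R D.Words ∘ₗ C.curv := by ext; simp
  rw [letterD_eq', letterD_eq', LinearMap.comp_sub, LinearMap.comp_sub, h1, h2, h6, f.lin_comp_bd,
    LinearMap.comp_sub, LinearMap.comp_add, h3, h4, LinearMap.sub_comp, LinearMap.sub_comp,
    conv_comp_lin, LinearMap.comp_assoc _ D.curv, curv_lin, LinearMap.comp_add, LinearMap.comp_sub,
    h5, LinearMap.comp_assoc f.lin, LinearMap.comp_assoc f.lin, ← lin_comp_sgn, conv_sub_left,
    conv_add_right, conv_add_right]
  abel

theorem onWords_wordD (w : C.Words) : f.onWords (C.wordD w) = D.wordD (f.onWords w) := by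
  induction w using TensorAlgebra.induction with
  | algebraMap r => simp [wordD_algebraMap]
  | ι c =>
    rw [wordD_ι, onWords_ι, map_add, wordD_ι, wordD_algebraMap, add_zero]
    exact LinearMap.congr_fun f.onWords_comp_letterD c
  | mul a b ha hb => simp only [wordD_mul, map_add, map_mul, ha, hb, onWords_wordSgn]
  | add a b ha hb => simp only [map_add, ha, hb]

theorem lin_mem_hom {x y : C.Obj} {c : C.carrier} (hc : c ∈ C.hom x y) :
    f.lin c ∈ D.hom (f.obj x) (f.obj y) := by
  rw [mem_hom] at hc ⊢
  have h1 : map (zeroPart D.gr) LinearMap.id ∘ₗ map f.lin f.lin =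
      map f.lin f.lin ∘ₗ map (zeroPart C.gr) LinearMap.id := by
    rw [← map_comp, ← map_comp, lin_comp_zeroPart]; rfl
  have h2 : map LinearMap.id (zeroPart D.gr) ∘ₗ map f.lin f.lin =
      map f.lin f.lin ∘ₗ map LinearMap.id (zeroPart C.gr) := by
    rw [← map_comp, ← map_comp, lin_comp_zeroPart]; rfl
  rw [← map_comul, ← LinearMap.comp_apply, ← LinearMap.comp_apply (map LinearMap.id _), h1, h2,
    LinearMap.comp_apply, LinearMap.comp_apply, hc.1, hc.2]
  exact ⟨rfl, rfl⟩

/-- The functional `ε f₁` vanishes on `C(x, y)` if `f x ≠ f y`. -/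
theorem eps_of_ne {x y : C.Obj} {c : C.carrier} (hc : c ∈ C.hom x y) {n : ℕ} (hn : c ∈ C.gr n)
    (h : f.obj x ≠ f.obj y) : f.eps c = 0 := by
  rcases eq_or_ne n 1 with rfl | h1
  swap
  · exact f.eps_of_mem hn h1
  have h0 : f.f₁ c ∈ D.gr 0 := f.f₁_mem hn
  rw [mem_hom] at hc
  -- The two comodule conditions on `f₁` give endpoints to `f₁ c`. An element of degree zero with
  -- distinct endpoints is zero.
  have hm : f.f₁ c ∈ D.hom (f.obj x) (f.obj y) := by
    rw [mem_hom]
    have e1 : (comul (f.f₁ c) : D.carrier ⊗[R] D.carrier) = (f.obj x : D.carrier) ⊗ₜ f.f₁ c := by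
      have := f.comul_f₁_left c
      rw [show map ((f.f₀ : C.carrier →ₗ[R] D.carrier) ∘ₗ zeroPart C.gr) f.f₁ =
        map f.lin f.f₁ ∘ₗ map (zeroPart C.gr) LinearMap.id by rw [← map_comp]; rfl,
        LinearMap.comp_apply, hc.1] at this
      exact this
    have e2 : (comul (f.f₁ c) : D.carrier ⊗[R] D.carrier) = f.f₁ c ⊗ₜ (f.obj y : D.carrier) := by
      have := f.comul_f₁_right c
      rw [show map f.f₁ ((f.f₀ : C.carrier →ₗ[R] D.carrier) ∘ₗ zeroPart C.gr) =
        map f.f₁ f.lin ∘ₗ map LinearMap.id (zeroPart C.gr) by rw [← map_comp]; rfl,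
        LinearMap.comp_apply, hc.2] at this
      exact this
    constructor
    · rw [e1, map_tmul, zeroPart_of_mem_zero D.gr (object_mem _), LinearMap.id_apply]
    · rw [e2, map_tmul, zeroPart_of_mem_zero D.gr (object_mem _), LinearMap.id_apply]
  rw [eps, LinearMap.comp_apply, (hom_zero hm h0).2 h, map_zero]

theorem onWords_mem {x y : C.Obj} {n : ℕ} {w : C.Words} (hw : w ∈ C.cobarGr x y n) :
    f.onWords w ∈ D.cobarGr (f.obj x) (f.obj y) n := by
  refine cobarGr_map_mem (L := f.onWords.toLinearMap) (fun p w h => ?_) hw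
  clear hw
  induction h with
  | nil x => simpa using one_mem_cobarGr (f.obj x)
  | @cons x y z p m n c w hc hm hw ih =>
    rw [AlgHom.toLinearMap_apply, map_mul]
    refine mul_mem_cobarGr ?_ ih
    rw [onWords_ι]
    refine add_mem (ι_mem_cobarGr (f.lin_mem_hom hc) (f.lin_mem hm)) ?_
    -- The scalar part occurs only for `|c| = 1`, where the letter has degree zero like an identity,
    -- and only if the endpoints have the same image.
    rcases eq_or_ne m 0 with rfl | h0
    · by_cases h : f.obj x = f.obj y
      · rw [← h, Algebra.algebraMap_eq_smul_one]
        exact Submodule.smul_mem _ _ (one_mem_cobarGr _)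
      · rw [f.eps_of_ne hc hm h, map_zero]; exact zero_mem _
    · rw [f.eps_of_mem hm (by omega), map_zero]; exact zero_mem _

end Hom

/-! ### Naturality -/

section Semilinear

variable {Y : Type w} [AddCommGroup Y] [Module R Y] {Z : Type w'} [AddCommGroup Z] [Module R Z]
variable {G : C.Obj → C.Obj → ℕ → Y → Prop} {G' : D.Obj → D.Obj → ℕ → Z → Prop}

/-- A map of degree zero between bimodules that is compatible with `Ωf`. -/
structure IsSemilinearMap (f : Hom C D) (G : C.Obj → C.Obj → ℕ → Y → Prop)
    (G' : D.Obj → D.Obj → ℕ → Z → Prop) (F : C.Triple Y →ₗ[R] D.Triple Z) : Prop where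
  mem_gen : ∀ {x y n g}, G x y n g →
    F (1 ⊗ₜ[R] (g ⊗ₜ[R] 1)) ∈ D.sandwichGr G' (f.obj x) (f.obj y) n
  smul : ∀ a u, F (a • u) = f.onWords a • F u
  mulRight : ∀ b u, F (C.mulRight b u) = D.mulRight (f.onWords b) (F u)

namespace IsSemilinearMap

variable {f : Hom C D} {F : C.Triple Y →ₗ[R] D.Triple Z}

theorem map_mem (h : IsSemilinearMap f G G' F) {x y : C.Obj} {n : ℕ} {u : C.Triple Y}
    (hu : u ∈ C.sandwichGr G x y n) : F u ∈ D.sandwichGr G' (f.obj x) (f.obj y) n := by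
  refine sandwichGr_map_mem (fun x' y' i j l a g b ha hg hb e => ?_) hu
  rw [h.smul, h.mulRight]
  have := smul_mem_sandwichGr (f.onWords_mem ha)
    (mulRight_mem_sandwichGr (h.mem_gen hg) (f.onWords_mem hb))
  rwa [show i + (j + l) = n by omega] at this

theorem comm {τ : Y →ₗ[R] Y} {FY : Y →ₗ[R] C.Triple Y} {d : C.Triple Y →ₗ[R] C.Triple Y}
    {τ' : Z →ₗ[R] Z} {FZ : Z →ₗ[R] D.Triple Z} {d' : D.Triple Z →ₗ[R] D.Triple Z}
    (h : IsSemilinearMap f G G' F) (hY : IsDGBimodule C G τ FY d) (hZ : IsDGBimodule D G' τ' FZ d')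
    (hg : ∀ x y n g, G x y n g → F (FY g) = d' (F (1 ⊗ₜ[R] (g ⊗ₜ[R] 1))))
    {x y : C.Obj} {n : ℕ} {u : C.Triple Y} (hu : u ∈ C.sandwichGr G x y n) :
    F (d u) = d' (F u) := by
  refine sandwichGr_ext (L := F ∘ₗ d) (L' := d' ∘ₗ F) (fun x' y' i j l a g b ha hgen hb e => ?_) hu
  have m1 := gen_mem_sandwichGr hgen
  rw [LinearMap.comp_apply, LinearMap.comp_apply, hY.twisted.smul, hY.mulRight m1, map_add,
    h.smul, h.smul, map_add, map_smul F, h.mulRight, h.mulRight, h.mulRight, h.smul,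
    hZ.twisted.smul, h.mulRight, hZ.mulRight (h.map_mem m1), hY.map_gen, hg _ _ _ _ hgen,
    f.onWords_wordD, f.onWords_wordD, f.onWords_wordSgn]

/-- Compatibility with bimodule maps can be checked on generators. -/
theorem comm_bimoduleMap {Y' : Type*} [AddCommGroup Y'] [Module R Y'] {Z' : Type*} [AddCommGroup Z']
    [Module R Z'] {G₁ : C.Obj → C.Obj → ℕ → Y' → Prop} {G₁' : D.Obj → D.Obj → ℕ → Z' → Prop}
    {F' : C.Triple Y' →ₗ[R] D.Triple Z'} {k : ℕ} {π : C.Obj → C.Triple Y →ₗ[R] C.Triple Y'}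
    {π' : D.Obj → D.Triple Z →ₗ[R] D.Triple Z'}
    (h : IsSemilinearMap f G G' F) (h' : IsSemilinearMap f G₁ G₁' F')
    (hπ : IsBimoduleMap C G G₁ k π) (hπ' : IsBimoduleMap D G' G₁' k π')
    (hg : ∀ x y n g, G x y n g → F' (π x (1 ⊗ₜ[R] (g ⊗ₜ[R] 1))) =
      π' (f.obj x) (F (1 ⊗ₜ[R] (g ⊗ₜ[R] 1))))
    {x y : C.Obj} {n : ℕ} {u : C.Triple Y} (hu : u ∈ C.sandwichGr G x y n) :
    F' (π x u) = π' (f.obj x) (F u) := by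
  refine sandwichGr_ext (L := F' ∘ₗ π x) (L' := π' (f.obj x) ∘ₗ F)
    (fun x' y' i j l a g b ha hgen hb e => ?_) hu
  have m1 := gen_mem_sandwichGr hgen
  have m2 := h.map_mem m1
  have hb' := f.onWords_mem hb
  rw [LinearMap.comp_apply, LinearMap.comp_apply, hπ.smul ha (mulRight_mem_sandwichGr m1 hb),
    map_smul F', h'.smul, hπ.mulRight m1 hb, h'.mulRight, h.smul, h.mulRight,
    hπ'.smul (f.onWords_mem ha) (mulRight_mem_sandwichGr m2 hb'), hπ'.mulRight m2 hb',
    hg _ _ _ _ hgen]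

theorem onCyclic_single (F : C.Triple Y →ₗ[R] D.Triple Z) (x y : C.Obj) (u : C.Triple Y)
    (m : C.Words) : f.onCyclic F (Finsupp.single (x, y) (u ⊗ₜ[R] m)) =
      Finsupp.single (f.obj x, f.obj y) (F u ⊗ₜ[R] f.onWords m) := by
  simp [Hom.onCyclic]

theorem onCyclic_mem (h : IsSemilinearMap f G G' F) {n : ℕ}
    {w : C.Obj × C.Obj →₀ C.Triple Y ⊗[R] C.Words} (hw : w ∈ C.cyclicGr G n) :
    f.onCyclic F w ∈ D.cyclicGr G' n := by
  refine cyclicGr_map_mem (L := f.onCyclic F) (fun x y i j u m hu hm e => ?_) hw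
  rw [onCyclic_single]
  exact single_mem_cyclicGr (h.map_mem hu) (f.onWords_mem hm) e

theorem onCyclic_mem_rel (h : IsSemilinearMap f G G' F)
    {w : C.Obj × C.Obj →₀ C.Triple Y ⊗[R] C.Words} (hw : w ∈ C.cyclicRel G) :
    f.onCyclic F w ∈ D.cyclicRel G' := by
  rw [mem_cyclicRel_iff, ← LinearMap.comp_apply]
  refine cyclicRel_le (fun x y z i j l u a m hu ha hm => ?_)
    (fun x y z i j l a u m ha hu hm => ?_) hw
  · rw [LinearMap.comp_apply, LinearMap.comp_apply, onCyclic_single, onCyclic_single, h.mulRight,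
      map_mul]
    exact cyc_mulRight (h.map_mem hu) (f.onWords_mem ha) (f.onWords_mem hm)
  · rw [LinearMap.comp_apply, LinearMap.comp_apply, onCyclic_single, onCyclic_single, h.smul, map_mul]
    exact cyc_smul (f.onWords_mem ha) (h.map_mem hu) (f.onWords_mem hm)

end IsSemilinearMap

end Semilinear

/-- The compatibility of contractions with `Ωf`, from the equations on generators. -/
theorem isContractionMap_of_gen {f : Hom C D}
    {Y : Type (max u v)} [AddCommGroup Y] [Module R Y] {Z : Type v} [AddCommGroup Z] [Module R Z]
    {Y' : Type (max u v)} [AddCommGroup Y'] [Module R Y'] {Z' : Type v} [AddCommGroup Z']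
    [Module R Z']
    {G : C.Obj → C.Obj → ℕ → Y → Prop} {G₁ : C.Obj → C.Obj → ℕ → Z → Prop}
    {G' : D.Obj → D.Obj → ℕ → Y' → Prop} {G₁' : D.Obj → D.Obj → ℕ → Z' → Prop}
    {τ : Y →ₗ[R] Y} {FY : Y →ₗ[R] C.Triple Y} {d : C.Triple Y →ₗ[R] C.Triple Y}
    {τ₁ : Z →ₗ[R] Z} {FZ : Z →ₗ[R] C.Triple Z} {d₁ : C.Triple Z →ₗ[R] C.Triple Z}
    {τ' : Y' →ₗ[R] Y'} {FY' : Y' →ₗ[R] D.Triple Y'} {d' : D.Triple Y' →ₗ[R] D.Triple Y'}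
    {τ₁' : Z' →ₗ[R] Z'} {FZ' : Z' →ₗ[R] D.Triple Z'} {d₁' : D.Triple Z' →ₗ[R] D.Triple Z'}
    {π : C.Obj → C.Triple Y →ₗ[R] C.Triple Z} {α : C.Obj → C.Triple Z →ₗ[R] C.Triple Y}
    {H : C.Obj → C.Triple Y →ₗ[R] C.Triple Y}
    {π' : D.Obj → D.Triple Y' →ₗ[R] D.Triple Z'} {α' : D.Obj → D.Triple Z' →ₗ[R] D.Triple Y'}
    {H' : D.Obj → D.Triple Y' →ₗ[R] D.Triple Y'}
    {F : C.Triple Y →ₗ[R] D.Triple Y'} {F₁ : C.Triple Z →ₗ[R] D.Triple Z'}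
    (hY : IsDGBimodule C G τ FY d) (hZ : IsDGBimodule C G₁ τ₁ FZ d₁)
    (hY' : IsDGBimodule D G' τ' FY' d') (hZ' : IsDGBimodule D G₁' τ₁' FZ' d₁')
    (hπ : IsBimoduleMap C G G₁ 0 π) (hα : IsBimoduleMap C G₁ G 0 α) (hH : IsBimoduleMap C G G 1 H)
    (hπ' : IsBimoduleMap D G' G₁' 0 π') (hα' : IsBimoduleMap D G₁' G' 0 α')
    (hH' : IsBimoduleMap D G' G' 1 H')
    (hF : IsSemilinearMap f G G' F) (hF₁ : IsSemilinearMap f G₁ G₁' F₁)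
    (cF : ∀ x y n g, G x y n g → F (FY g) = d' (F (1 ⊗ₜ[R] (g ⊗ₜ[R] 1))))
    (cF₁ : ∀ x y n g, G₁ x y n g → F₁ (FZ g) = d₁' (F₁ (1 ⊗ₜ[R] (g ⊗ₜ[R] 1))))
    (cπ : ∀ x y n g, G x y n g → F₁ (π x (1 ⊗ₜ[R] (g ⊗ₜ[R] 1))) =
      π' (f.obj x) (F (1 ⊗ₜ[R] (g ⊗ₜ[R] 1))))
    (cα : ∀ x y n g, G₁ x y n g → F (α x (1 ⊗ₜ[R] (g ⊗ₜ[R] 1))) =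
      α' (f.obj x) (F₁ (1 ⊗ₜ[R] (g ⊗ₜ[R] 1))))
    (cH : ∀ x y n g, G x y n g → F (H x (1 ⊗ₜ[R] (g ⊗ₜ[R] 1))) =
      H' (f.obj x) (F (1 ⊗ₜ[R] (g ⊗ₜ[R] 1)))) :
    (∀ x y, PresentedComplex.IsContractionMap (sandwichComplex G d x y) (sandwichComplex G₁ d₁ x y)
      (π x) (α x) (H x) (sandwichComplex G' d' (f.obj x) (f.obj y))
      (sandwichComplex G₁' d₁' (f.obj x) (f.obj y)) (π' (f.obj x)) (α' (f.obj x)) (H' (f.obj x))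
      F F₁) ∧
    PresentedComplex.IsContractionMap (cyclicComplex G d τ) (cyclicComplex G₁ d₁ τ₁)
      (C.cyclicMap π) (C.cyclicMap α) (C.cyclicMap H) (cyclicComplex G' d' τ')
      (cyclicComplex G₁' d₁' τ₁') (D.cyclicMap π') (D.cyclicMap α') (D.cyclicMap H')
      (f.onCyclic F) (f.onCyclic F₁) := by
  refine ⟨fun x y => ?_, ?_⟩
  · refine ⟨⟨⟨hF.map_mem, fun _ => map_mem_of_mem_bot _⟩, fun n w hw => ?_⟩,
      ⟨⟨hF₁.map_mem, fun _ => map_mem_of_mem_bot _⟩, fun n w hw => ?_⟩,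
      fun n w hw => ?_, fun n w hw => ?_, fun n w hw => ?_⟩
    all_goals refine sub_mem_of_eq ?_
    · exact hF.comm hY hY' cF hw
    · exact hF₁.comm hZ hZ' cF₁ hw
    · exact hF.comm_bimoduleMap hF₁ hπ hπ' cπ hw
    · exact hF₁.comm_bimoduleMap hF hα hα' cα hw
    · exact hF.comm_bimoduleMap hF hH hH' cH hw
  · refine ⟨⟨⟨hF.onCyclic_mem, fun _ => hF.onCyclic_mem_rel⟩, fun n w hw => ?_⟩,
      ⟨⟨hF₁.onCyclic_mem, fun _ => hF₁.onCyclic_mem_rel⟩, fun n w hw => ?_⟩,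
      fun n w hw => ?_, fun n w hw => ?_, fun n w hw => ?_⟩
    all_goals refine sub_mem_of_eq (cyclicGr_ext (fun x y i j u m hu hm e => ?_) hw)
    · simp only [LinearMap.comp_apply, hY.cyclicDiff_single hu, IsSemilinearMap.onCyclic_single,
        map_add, map_smul, hY'.cyclicDiff_single (hF.map_mem hu), hF.comm hY hY' cF hu,
        f.onWords_wordD]
    · simp only [LinearMap.comp_apply, hZ.cyclicDiff_single hu, IsSemilinearMap.onCyclic_single,
        map_add, map_smul, hZ'.cyclicDiff_single (hF₁.map_mem hu), hF₁.comm hZ hZ' cF₁ hu,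
        f.onWords_wordD]
    · simp only [LinearMap.comp_apply, IsSemilinearMap.onCyclic_single, cyclicMap_single,
        hF.comm_bimoduleMap hF₁ hπ hπ' cπ hu]
    · simp only [LinearMap.comp_apply, IsSemilinearMap.onCyclic_single, cyclicMap_single,
        hF₁.comm_bimoduleMap hF hα hα' cα hu]
    · simp only [LinearMap.comp_apply, IsSemilinearMap.onCyclic_single, cyclicMap_single,
        hF.comm_bimoduleMap hF hH hH' cH hu]

end CategoricalCoalgebra

namespace CategoricalCoalgebra

open TensorAlgebra TensorProduct Coalgebra Graded

variable {R : Type u} [CommRing R] {C : CategoricalCoalgebra.{u, v} R}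

/-! ### The bimodule `𝒬` -/

section

variable {Y : Type*} [AddCommGroup Y] [Module R Y]

theorem conv_lact_mul (f g : C.carrier →ₗ[R] C.Words) (k : C.carrier →ₗ[R] C.Triple Y) :
    conv (C.lact Y) (conv (LinearMap.mul R C.Words) f g) k =
      conv (C.lact Y) f (conv (C.lact Y) g k) :=
  conv_assoc fun a b c => by simp [mul_smul]

theorem conv_ract_ract (f : C.carrier →ₗ[R] C.Triple Y) (g k : C.carrier →ₗ[R] C.Words) :
    conv (C.ract Y) (conv (C.ract Y) f g) k =
      conv (C.ract Y) f (conv (LinearMap.mul R C.Words) g k) :=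
  conv_assoc fun a b c => by simp [mulRight_mulRight]

theorem conv_ract_lact (f : C.carrier →ₗ[R] C.Words) (g : C.carrier →ₗ[R] C.Triple Y)
    (k : C.carrier →ₗ[R] C.Words) :
    conv (C.ract Y) (conv (C.lact Y) f g) k = conv (C.lact Y) f (conv (C.ract Y) g k) :=
  conv_assoc fun a b c => by simp [mulRight_smul]

theorem mulRight_algebraMap (r : R) (u : C.Triple Y) :
    C.mulRight (algebraMap R _ r) u = r • u := by
  rw [Algebra.algebraMap_eq_smul_one, mulRight_rsmul, mulRight_one]

/-- The curvature part of `D{c'}` acts by scalars, and coassociativity lets the quadratic part act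
one letter at a time. -/
theorem conv_lact_letterD (k : C.carrier →ₗ[R] C.Triple Y) :
    conv (C.lact Y) C.letterD k = conv (LinearMap.lsmul R _) C.curv k -
      conv (C.lact Y) (C.brace ∘ₗ C.bd) k -
      conv (C.lact Y) (C.brace ∘ₗ sgn C.gr) (conv (C.lact Y) C.brace k) := by
  rw [letterD_eq', conv_sub_left, conv_sub_left, conv_lact_mul]
  congr 2
  exact conv_congr fun a b => by simp

variable {τ : Y →ₗ[R] Y} {F : Y →ₗ[R] C.Triple Y} {d : C.Triple Y →ₗ[R] C.Triple Y}

/-- The Leibniz rule in convolution form; the minus sign reflects that the letter `c` has degree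
`|c| - 1`. -/
theorem IsTwisted.comp_conv_lact_brace (h : IsTwisted τ F d) (k : C.carrier →ₗ[R] C.Triple Y) :
    d ∘ₗ conv (C.lact Y) C.brace k = conv (C.lact Y) C.letterD k -
      conv (C.lact Y) (C.brace ∘ₗ sgn C.gr) (d ∘ₗ k) := by
  rw [conv_eq, conv_eq, conv_eq, ← LinearMap.sub_comp, ← LinearMap.comp_assoc]
  congr 1
  ext a b
  simp [h.smul, wordD_brace, wordSgn_brace, sub_eq_add_neg]

theorem IsTwisted.comp_conv_ract_brace (h : IsTwisted τ F d) (k : C.carrier →ₗ[R] C.Triple Y) :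
    d ∘ₗ conv (C.ract Y) k C.brace = conv (C.ract Y) (d ∘ₗ k) C.brace +
      conv (C.ract Y) (C.tripleSgn τ ∘ₗ k) C.letterD := by
  rw [conv_eq, conv_eq, conv_eq, ← LinearMap.add_comp, ← LinearMap.comp_assoc]
  congr 1
  ext a b
  simp [h.mulRight, wordD_brace]

end

theorem qDiff_comp_mid : C.qDiff ∘ₗ C.mid _ = C.qMid :=
  LinearMap.ext fun c => isTwisted_qDiff.one_tmul_one c

/-- The two curvature terms of `∂²` cancel those in `D{c'}` on the left and in `D{c''}` on the
right. The terms with letters on both sides of the middle cancel because the two actions commute,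
and the remaining ones by coassociativity and the coderivation rule. -/
theorem qDiff_comp_qMid : C.qDiff ∘ₗ C.qMid = 0 := by
  have e1 : C.mid _ ∘ₗ C.bd ∘ₗ C.bd = conv (LinearMap.lsmul R _) C.curv (C.mid _) -
      conv (LinearMap.lsmul R _).flip (C.mid _) C.curv := by
    rw [bd_bd_eq, LinearMap.comp_sub]
    congr 1
    · exact comp_conv fun a b => by simp
    · exact comp_conv fun a b => by
        rw [LinearMap.flip_apply, LinearMap.lsmul_apply, map_smul]; rfl
  have e2 : C.tripleSgn (sgn C.gr) ∘ₗ C.mid _ ∘ₗ sgn C.gr = C.mid _ := by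
    ext c; simp [tripleSgn_tmul]
  have e3 : C.qMid ∘ₗ C.bd = C.mid _ ∘ₗ C.bd ∘ₗ C.bd -
      (conv (C.lact _) (C.brace ∘ₗ C.bd) (C.mid _) +
        conv (C.lact _) (C.brace ∘ₗ sgn C.gr) (C.mid _ ∘ₗ C.bd)) +
      (-conv (C.ract _) ((C.mid _ ∘ₗ C.bd) ∘ₗ sgn C.gr) C.brace +
        conv (C.ract _) (C.mid _) (C.brace ∘ₗ C.bd)) := by
    have : (C.mid _ ∘ₗ sgn C.gr) ∘ₗ C.bd = -((C.mid _ ∘ₗ C.bd) ∘ₗ sgn C.gr) := by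
      rw [LinearMap.comp_assoc _ C.bd, bd_comp_sgn, LinearMap.comp_neg, neg_neg,
        LinearMap.comp_assoc]
    rw [qMid, LinearMap.add_comp, LinearMap.sub_comp, conv_comp_bd, conv_comp_bd, this, conv_neg_left,
      LinearMap.comp_assoc (sgn C.gr) (sgn C.gr), LinearMap.comp_assoc C.bd C.bd,
      show sgn C.gr ∘ₗ sgn C.gr = LinearMap.id from LinearMap.ext (sgn_sgn C.gr), LinearMap.comp_id]
  have e4 : C.qMid ∘ₗ sgn C.gr = (C.mid _ ∘ₗ C.bd) ∘ₗ sgn C.gr -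
      conv (C.lact _) (C.brace ∘ₗ sgn C.gr) (C.mid _ ∘ₗ sgn C.gr) +
      conv (C.ract _) (C.mid _) (C.brace ∘ₗ sgn C.gr) := by
    rw [qMid, LinearMap.add_comp, LinearMap.sub_comp, conv_comp_sgn, conv_comp_sgn,
      LinearMap.comp_assoc (sgn C.gr) (sgn C.gr),
      show sgn C.gr ∘ₗ sgn C.gr = LinearMap.id from LinearMap.ext (sgn_sgn C.gr), LinearMap.comp_id]
  have e5 : conv (C.ract _) (C.mid _) C.letterD = conv (LinearMap.lsmul R _).flip (C.mid _) C.curv -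
      conv (C.ract _) (C.mid _) (C.brace ∘ₗ C.bd) -
      conv (C.ract _) (C.mid _) (conv (LinearMap.mul R C.Words) (C.brace ∘ₗ sgn C.gr) C.brace) := by
    rw [letterD_eq', conv_sub_right, conv_sub_right]
    congr 2
    exact conv_congr fun a b => by
      rw [LinearMap.comp_apply, Algebra.linearMap_apply, ract_apply, mulRight_algebraMap]; rfl
  have e6 : C.qDiff ∘ₗ C.mid _ ∘ₗ sgn C.gr = C.qMid ∘ₗ sgn C.gr := by
    rw [← LinearMap.comp_assoc, qDiff_comp_mid]
  have e7 : C.qDiff ∘ₗ C.mid _ ∘ₗ C.bd = C.qMid ∘ₗ C.bd := by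
    rw [← LinearMap.comp_assoc, qDiff_comp_mid]
  nth_rw 1 [qMid]
  rw [LinearMap.comp_add, LinearMap.comp_sub, isTwisted_qDiff.comp_conv_lact_brace,
    isTwisted_qDiff.comp_conv_ract_brace, e2, e5, e6, e4, e7, e3, e1, conv_lact_letterD,
    qDiff_comp_mid, conv_add_left, conv_sub_left, conv_ract_ract, conv_ract_lact, qMid, conv_add_right,
    conv_sub_right]
  abel

theorem qMid_mem {x y : C.Obj} {n : ℕ} {c : C.carrier} (hc : C.homGen x y n c) :
    C.qMid c ∈ lower (C.sandwichGr C.homGen x y) n := by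
  obtain ⟨h, hn⟩ := hc
  rw [qMid]
  refine add_mem (sub_mem ?_ (conv_mem h hn fun z i j a b ha hi hb hj e => ?_))
    (conv_mem h hn fun z i j a b ha hi hb hj e => ?_)
  · rcases mem_lower_iff.1 (C.bd_mem hn) with h0 | ⟨k, rfl, h1⟩
    · rw [LinearMap.comp_apply, h0, map_zero]; exact zero_mem _
    · exact gen_mem_sandwichGr ⟨bd_mem_hom h, h1⟩
  · rw [← e]
    exact lower_smul_mem_sandwichGr (brace_mem_cobarGr ha hi) (gen_mem_sandwichGr ⟨hb, hj⟩)
  · rw [← e, LinearMap.comp_apply, sgn_of_mem C.gr hi, map_smul, map_smul, LinearMap.smul_apply]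
    exact Submodule.smul_mem _ _
      (mulRight_lower_mem_sandwichGr (gen_mem_sandwichGr ⟨ha, hi⟩) (brace_mem_cobarGr hb hj))

/-- `𝒬` is a differential graded bimodule. -/
theorem isDGBimodule_qDiff : IsDGBimodule C C.homGen (sgn C.gr) C.qMid C.qDiff where
  twisted := isTwisted_qDiff
  sign h := sgn_of_mem C.gr h.2
  mem h := qMid_mem h
  sq {_ _ _ g} _ := LinearMap.congr_fun qDiff_comp_qMid g

end CategoricalCoalgebra

namespace CategoricalCoalgebra

open TensorAlgebra TensorProduct Coalgebra Graded

variable {R : Type u} [CommRing R] {C : CategoricalCoalgebra.{u, v} R}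

/-! ### Bar words -/

/-- Induction on the length of words. -/
theorem word_induction {E : Type*} [AddCommGroup E] [Module R E] {p : TensorAlgebra R E → Prop}
    (w : TensorAlgebra R E) (one : p 1) (cons : ∀ e w, p w → p (ι R e * w))
    (add : ∀ a b, p a → p b → p (a + b)) (smul : ∀ (r : R) a, p a → p (r • a)) : p w := by
  suffices h : ∀ v, p v → p (w * v) by simpa using h 1 one
  induction w using TensorAlgebra.induction with
  | algebraMap r => intro v hv; rw [← Algebra.smul_def]; exact smul r v hv
  | ι e => exact fun v hv => cons e v hv
  | mul a b ha hb => intro v hv; rw [mul_assoc]; exact ha _ (hb v hv)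
  | add a b ha hb => intro v hv; rw [add_mul]; exact add _ _ (ha v hv) (hb v hv)

@[simp] theorem barSgn_ι (a : C.Words) : C.barSgn (ι R a) = -ι R (C.wordSgn a) := by
  simp [barSgn]

@[simp] theorem barCoeff_one : C.barCoeff 1 = 1 := map_one (algebraMapInv (R := R) (M := C.Words))

@[simp] theorem barCoeff_ι_mul (a : C.Words) (t : C.BarWords) : C.barCoeff (ι R a * t) = 0 := by
  simp [barCoeff, algebraMapInv]

@[simp] theorem barD_one : C.barD 1 = 0 := wordRec_one _ _

theorem barD_ι_mul (a : C.Words) (t : C.BarWords) : C.barD (ι R a * t) =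
    -(ι R (C.plus (C.wordD a)) * t) - ι R (C.wordSgn a) * C.barD t := wordRec_ι_mul _ _ _ _

@[simp] theorem barFirst_one : C.barFirst 1 = 0 := wordRec_one _ _

@[simp] theorem barFirst_ι_mul (a : C.Words) (t : C.BarWords) :
    C.barFirst (ι R a * t) = a ⊗ₜ[R] t := wordRec_ι_mul _ _ _ _

@[simp] theorem barLast_one : C.barLast 1 = 0 := wordRec_one _ _

theorem barLast_ι_mul (a : C.Words) (t : C.BarWords) : C.barLast (ι R a * t) =
    C.barCoeff t • ((1 : C.BarWords) ⊗ₜ[R] a) + ι R a • C.barLast t := wordRec_ι_mul _ _ _ _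

@[simp] theorem barMul_one : C.barMul 1 = 0 := wordRec_one _ _

theorem barMul_ι_mul (a : C.Words) (t : C.BarWords) : C.barMul (ι R a * t) =
    -C.barCons (C.wordSgn a • C.barFirst t) - ι R (C.wordSgn a) * C.barMul t :=
  wordRec_ι_mul _ _ _ _

@[simp] theorem barCons_tmul (a : C.Words) (t : C.BarWords) :
    C.barCons (a ⊗ₜ[R] t) = ι R a * t := rfl

/-- The normalization of bar words, which drops the constant terms of the letters. -/
noncomputable def barPlus : C.BarWords →ₐ[R] C.BarWords := lift R (ι R ∘ₗ C.plus)

@[simp] theorem barPlus_ι (a : C.Words) : C.barPlus (ι R a) = ι R (C.plus a) := by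
  simp [barPlus]

@[simp] theorem barPlus_barPlus (t : C.BarWords) : C.barPlus (C.barPlus t) = C.barPlus t := by
  have : C.barPlus.comp C.barPlus = C.barPlus := by ext a; simp
  exact AlgHom.congr_fun this t

@[simp] theorem barCoeff_barPlus (t : C.BarWords) : C.barCoeff (C.barPlus t) = C.barCoeff t := by
  have : (algebraMapInv (R := R) (M := C.Words)).comp C.barPlus = algebraMapInv := by
    ext a; simp [algebraMapInv]
  exact AlgHom.congr_fun this t

/-! ### The extra degeneracy -/

/-- The map `a ⊗ [a₁|⋯|a_p] ⊗ b ↦ [a|a₁|⋯|a_p] ⊗ b`. -/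
noncomputable def barPush : C.Triple C.BarWords →ₗ[R] C.BarWords ⊗[R] C.Words :=
  map C.barCons LinearMap.id ∘ₗ (TensorProduct.assoc R _ _ _).symm.toLinearMap ∘ₗ
    map C.plus LinearMap.id

variable (C) in
/-- The extra degeneracy `a[a₁|⋯|a_p]b ↦ 1[a|a₁|⋯|a_p]b`. -/
noncomputable def degen : C.Triple C.BarWords →ₗ[R] C.Triple C.BarWords :=
  TensorProduct.mk R C.Words _ 1 ∘ₗ C.barPush

/-- The augmentation `a[]b ↦ ab`, which vanishes on longer bar words. -/
noncomputable def aug : C.Triple C.BarWords →ₗ[R] C.Words :=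
  LinearMap.mul' R C.Words ∘ₗ
    map LinearMap.id ((TensorProduct.lid R C.Words).toLinearMap ∘ₗ map C.barCoeff LinearMap.id)

/-- The map `b ↦ 1[]b`. -/
noncomputable def unitBar : C.Words →ₗ[R] C.Triple C.BarWords :=
  TensorProduct.mk R C.Words _ 1 ∘ₗ TensorProduct.mk R C.BarWords C.Words 1

/-- The normalization of the bar construction. -/
noncomputable def normalize : C.Triple C.BarWords →ₗ[R] C.Triple C.BarWords :=
  map LinearMap.id (map C.barPlus.toLinearMap LinearMap.id)

@[simp] theorem barPush_tmul (a : C.Words) (t : C.BarWords) (b : C.Words) :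
    C.barPush (a ⊗ₜ[R] (t ⊗ₜ[R] b)) = (ι R (C.plus a) * t) ⊗ₜ[R] b := rfl

theorem degen_apply (u : C.Triple C.BarWords) : C.degen u = 1 ⊗ₜ[R] C.barPush u := rfl

@[simp] theorem degen_tmul (a : C.Words) (t : C.BarWords) (b : C.Words) :
    C.degen (a ⊗ₜ[R] (t ⊗ₜ[R] b)) = 1 ⊗ₜ[R] ((ι R (C.plus a) * t) ⊗ₜ[R] b) := rfl

@[simp] theorem aug_tmul (a : C.Words) (t : C.BarWords) (b : C.Words) :
    C.aug (a ⊗ₜ[R] (t ⊗ₜ[R] b)) = C.barCoeff t • (a * b) := by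
  simp [aug]

theorem unitBar_apply (b : C.Words) : C.unitBar b = 1 ⊗ₜ[R] (1 ⊗ₜ[R] b) := rfl

@[simp] theorem normalize_tmul (a : C.Words) (t : C.BarWords) (b : C.Words) :
    C.normalize (a ⊗ₜ[R] (t ⊗ₜ[R] b)) = a ⊗ₜ[R] (C.barPlus t ⊗ₜ[R] b) := rfl

/-- The first entry would be the class of an identity, which is zero. In particular `s ∘ s = 0`. -/
theorem degen_one_tmul (q : C.BarWords ⊗[R] C.Words) : C.degen (1 ⊗ₜ[R] q) = 0 := by
  induction q using TensorProduct.induction_on with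
  | zero => simp
  | tmul t b => simp
  | add p q hp hq => rw [tmul_add, map_add, hp, hq, add_zero]

theorem degen_mulRight (b : C.Words) (u : C.Triple C.BarWords) :
    C.degen (C.mulRight b u) = C.mulRight b (C.degen u) := by
  induction u using triple_induction with
  | h a t v => simp
  | hadd u v hu hv => simp only [map_add, hu, hv]

theorem aug_smul (a : C.Words) (u : C.Triple C.BarWords) : C.aug (a • u) = a * C.aug u := by
  induction u using triple_induction with
  | h a' t v => simp [smul_triple, mul_assoc]
  | hadd u v hu hv => simp only [smul_add, map_add, hu, hv, mul_add]

theorem aug_mulRight (b : C.Words) (u : C.Triple C.BarWords) :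
    C.aug (C.mulRight b u) = C.aug u * b := by
  induction u using triple_induction with
  | h a' t v => simp [mul_assoc]
  | hadd u v hu hv => simp only [map_add, hu, hv, add_mul]

theorem aug_degen (u : C.Triple C.BarWords) : C.aug (C.degen u) = 0 := by
  induction u using triple_induction with
  | h a t v => simp
  | hadd u v hu hv => simp only [map_add, hu, hv, add_zero]

theorem normalize_smul (a : C.Words) (u : C.Triple C.BarWords) :
    C.normalize (a • u) = a • C.normalize u := by
  induction u using triple_induction with
  | h a' t v => simp [smul_triple]
  | hadd u v hu hv => simp only [smul_add, map_add, hu, hv]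

theorem normalize_mulRight (b : C.Words) (u : C.Triple C.BarWords) :
    C.normalize (C.mulRight b u) = C.mulRight b (C.normalize u) := by
  induction u using triple_induction with
  | h a' t v => simp
  | hadd u v hu hv => simp only [map_add, hu, hv]

/-! ### The differential of the bar construction -/

/-- The differential of `1[a₁|⋯|a_p]1`. -/
noncomputable def barMid : C.BarWords →ₗ[R] C.Triple C.BarWords :=
  C.mid _ ∘ₗ C.barD -
    ((TensorProduct.assoc R C.Words C.BarWords C.Words).toLinearMap ∘ₗ
      (TensorProduct.mk R (C.Words ⊗[R] C.BarWords) C.Words).flip 1 ∘ₗ C.barFirst +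
    C.mid _ ∘ₗ C.barMul -
    TensorProduct.mk R C.Words _ 1 ∘ₗ map C.barSgn.toLinearMap LinearMap.id ∘ₗ C.barLast)

theorem barMid_apply (t : C.BarWords) : C.barMid t = C.mid _ (C.barD t) -
    (TensorProduct.assoc R C.Words C.BarWords C.Words (C.barFirst t ⊗ₜ 1) +
      C.mid _ (C.barMul t) - 1 ⊗ₜ[R] map C.barSgn.toLinearMap LinearMap.id (C.barLast t)) := rfl

theorem isTwisted_barDiff : IsTwisted C.barSgn.toLinearMap C.barMid C.barDiff := by
  intro a t b
  simp only [barDiff, LinearMap.add_apply, LinearMap.sub_apply, LinearMap.comp_apply, map_tmul,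
    AlgHom.toLinearMap_apply, LinearMap.id_apply, insertLeft_tmul, insertRight_tmul, barMid_apply,
    mid_apply, map_sub, map_add, mulRight_tmul, smul_sub, smul_add, smul_triple, one_mul, mul_one]
  abel

@[simp] theorem barMid_one : C.barMid 1 = 0 := by
  simp [barMid_apply]

/-- The letters that are prepended in `[a a₁|⋯|a_p]`. -/
theorem barPush_smul_assoc (a : C.Words) (q : C.Words ⊗[R] C.BarWords) :
    C.degen (a • TensorProduct.assoc R C.Words C.BarWords C.Words (q ⊗ₜ 1)) =
      C.mid _ (C.barCons (C.plus a • q)) +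
        C.wordCoeff a • C.mid _ (C.barCons (map C.plus LinearMap.id q)) := by
  induction q using TensorProduct.induction_on with
  | zero => simp
  | add p q hp hq =>
    simp only [add_tmul, map_add, smul_add, hp, hq]
    abel
  | tmul a' t =>
    have h : C.plus (a * a') = C.plus a * a' + C.wordCoeff a • C.plus a' := by
      simp only [plus_apply, wordCoeff_mul, sub_mul, smul_mul_assoc, one_mul, smul_sub, smul_smul]
      abel
    rw [TensorProduct.assoc_tmul, smul_triple, degen_tmul, h]
    simp only [map_add, map_smul, add_mul, add_tmul, tmul_add, smul_mul_assoc, mid_apply,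
      barCons_tmul, map_tmul, LinearMap.id_apply, smul_tmul', smul_eq_mul]
    simp only [← smul_tmul', tmul_smul]

/-- Removing the first entry and putting it back is the identity except on the empty bar word. The
normalization makes the projection of that entry to positive length harmless. -/
theorem barCons_barFirst (t : C.BarWords) :
    C.barCons (map C.plus LinearMap.id (C.barFirst (C.barPlus t))) =
      C.barPlus t - C.barCoeff t • (1 : C.BarWords) := by
  induction t using word_induction with
  | one => simp
  | cons a t _ => simp
  | add a b ha hb => simp only [map_add, ha, hb, add_smul]; abel
  | smul r a ha => simp only [map_smul, ha, smul_sub, smul_assoc]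

theorem degen_smul_one_tmul (a : C.Words) (q : C.BarWords ⊗[R] C.Words) :
    C.degen (a • (1 ⊗ₜ[R] q)) = 1 ⊗ₜ[R] (ι R (C.plus a) • q) := by
  induction q using TensorProduct.induction_on with
  | zero => simp
  | add p q hp hq => simp only [tmul_add, smul_add, map_add, hp, hq]
  | tmul t b => simp [smul_tmul']

/-- The extra degeneracy is a contracting homotopy of the augmented bar construction, on bar words
with normalized letters. -/
theorem barDiff_degen {u : C.Triple C.BarWords} (hu : C.normalize u = u) :
    C.barDiff (C.degen u) = -u + C.unitBar (C.aug u) - C.degen (C.barDiff u) := by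
  rw [← hu]
  clear hu
  induction u using triple_induction with
  | hadd u v hu hv => simp only [map_add, hu, hv]; abel
  | h a t b =>
    rw [normalize_tmul, degen_tmul, aug_tmul, isTwisted_barDiff 1, isTwisted_barDiff a]
    -- Normalization enters the computation only through this equation, so `C.barPlus t` can be
    -- replaced by a variable afterwards.
    have h0 := barCons_barFirst t
    rw [← barCoeff_barPlus] at h0
    generalize C.barPlus t = t' at h0 ⊢
    -- Among the terms of the differential of `1[a|t']1`, the first face gives `-a[t']`, the last
    -- face gives `1[]a` when `t'` is empty, and the others are mirrored by `s` applied to the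
    -- differential of `a[t']`.
    have h1 : C.barMid (ι R (C.plus a) * t') = -C.mid _ (ι R (C.plus (C.wordD a)) * t') -
        C.mid _ (ι R (C.plus (C.wordSgn a)) * C.barD t') - (C.plus a) ⊗ₜ[R] (t' ⊗ₜ[R] 1) +
        C.mid _ (C.barCons (C.plus (C.wordSgn a) • C.barFirst t')) +
        C.mid _ (ι R (C.plus (C.wordSgn a)) * C.barMul t') +
        C.barCoeff t' • 1 ⊗ₜ[R] (1 ⊗ₜ[R] C.plus a) -
        1 ⊗ₜ[R] (ι R (C.plus (C.wordSgn a)) •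
          map C.barSgn.toLinearMap LinearMap.id (C.barLast t')) := by
      have h2 : ∀ q : C.BarWords ⊗[R] C.Words, map C.barSgn.toLinearMap LinearMap.id
          (ι R (C.plus a) • q) = -(ι R (C.plus (C.wordSgn a)) •
            map C.barSgn.toLinearMap LinearMap.id q) := fun q => by
        induction q using TensorProduct.induction_on with
        | zero => simp
        | add p q hp hq => simp only [smul_add, map_add, hp, hq, neg_add]
        | tmul t b => simp [smul_tmul', plus_wordSgn, neg_tmul]
      rw [barMid_apply, barD_ι_mul, barMul_ι_mul, barLast_ι_mul, barFirst_ι_mul, map_add, h2,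
        wordD_plus, ← plus_wordSgn]
      simp only [map_sub, map_neg, map_smul, tmul_add, tmul_neg, TensorProduct.assoc_tmul, map_tmul,
        map_one, LinearMap.id_apply, tmul_smul, AlgHom.toLinearMap_apply]
      abel
    have h3 : C.degen (C.wordSgn a • C.mulRight b (C.barMid t')) =
        C.mulRight b (C.mid _ (ι R (C.plus (C.wordSgn a)) * C.barD t') -
        C.mid _ (C.barCons (C.plus (C.wordSgn a) • C.barFirst t')) -
        C.wordCoeff a • C.mid _ (t' - C.barCoeff t' • (1 : C.BarWords)) -
        C.mid _ (ι R (C.plus (C.wordSgn a)) * C.barMul t') +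
        1 ⊗ₜ[R] (ι R (C.plus (C.wordSgn a)) •
          map C.barSgn.toLinearMap LinearMap.id (C.barLast t'))) := by
      rw [← mulRight_smul, degen_mulRight, barMid_apply]
      simp only [smul_sub, smul_add, map_sub, map_add, barPush_smul_assoc, degen_smul_one_tmul, h0,
        wordCoeff_wordSgn]
      simp only [mid_apply, smul_triple, mul_one, degen_tmul, mulRight_tmul, one_mul]
      abel
    -- The constant term of `a` produces corrections here and in `h5`; they match the term with
    -- `C.wordCoeff a` in `h3`.
    have h4 : C.plus a ⊗ₜ[R] (t' ⊗ₜ[R] (1 : C.Words)) =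
        a ⊗ₜ[R] (t' ⊗ₜ[R] 1) - C.wordCoeff a • 1 ⊗ₜ[R] (t' ⊗ₜ[R] 1) := by
      rw [plus_apply, sub_tmul, ← smul_tmul']
    have h5 : (1 : C.Words) ⊗ₜ[R] ((1 : C.BarWords) ⊗ₜ[R] C.plus a) =
        1 ⊗ₜ[R] (1 ⊗ₜ[R] a) - C.wordCoeff a • 1 ⊗ₜ[R] (1 ⊗ₜ[R] 1) := by
      rw [plus_apply, tmul_sub, tmul_sub, tmul_smul, tmul_smul]
    rw [h1, map_add C.degen, map_add C.degen, h3, h4, h5]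
    simp only [wordD_one, zero_tmul, map_one, one_smul, zero_add, map_add, map_sub, map_neg,
      map_smul, map_mul, barSgn_ι, degen_tmul, mid_apply, mulRight_tmul, one_mul, unitBar_apply,
      AlgHom.toLinearMap_apply, plus_wordSgn, neg_tmul, tmul_neg, neg_mul]
    module

end CategoricalCoalgebra

namespace CategoricalCoalgebra

open TensorAlgebra TensorProduct Coalgebra Graded

variable {R : Type u} [CommRing R] {C : CategoricalCoalgebra.{u, v} R}

/-! ### The bar construction as a differential graded bimodule -/

theorem IsBarWord.barSgn {x y : C.Obj} {p n : ℕ} {t : C.BarWords} (ht : C.IsBarWord x y p n t) :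
    C.barSgn t = (-1 : R) ^ n • t := by
  induction ht with
  | nil x => simp
  | cons ha _ ih =>
    rw [map_mul, ih, barSgn_ι, ha.wordSgn, map_smul, pow_add, pow_succ, mul_neg_one,
      ← neg_smul, smul_mul_smul_comm]

theorem IsBarWord.barPlus {x y : C.Obj} {p n : ℕ} {t : C.BarWords} (ht : C.IsBarWord x y p n t) :
    C.barPlus t = t := by
  induction ht with
  | nil x => simp
  | cons ha _ ih => rw [map_mul, ih, barPlus_ι, ha.plus]

theorem normalize_mid (t : C.BarWords) : C.normalize (C.mid _ t) = C.mid _ (C.barPlus t) := rfl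

/-- Bar words of actual chains have entries of positive length, so the degeneracy formula applies to
all chains. -/
theorem normalize_of_mem {x y : C.Obj} {n : ℕ} {u : C.Triple C.BarWords}
    (hu : u ∈ C.sandwichGr C.barGen x y n) : C.normalize u = u := by
  refine sandwichGr_ext (L' := LinearMap.id) (fun x' y' i j k a g b _ hg _ _ => ?_) hu
  obtain ⟨p, hg⟩ := hg
  rw [normalize_smul, normalize_mulRight, normalize_tmul, hg.barPlus, LinearMap.id_apply]

theorem normalize_of_mem_lower {x y : C.Obj} {n : ℕ} {u : C.Triple C.BarWords}
    (hu : u ∈ lower (C.sandwichGr C.barGen x y) n) : C.normalize u = u := by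
  rcases mem_lower_iff.1 hu with rfl | ⟨k, -, hu⟩
  · exact map_zero _
  · exact normalize_of_mem hu

/-- A criterion for the values of a linear map on the projection to the words of positive length. -/
theorem cobarGr_plus_mem {N : Type*} [AddCommGroup N] [Module R N] {L : C.Words →ₗ[R] N}
    {S : Submodule R N} {x y : C.Obj} {n : ℕ} (h : ∀ p w, C.IsWord x y (p + 1) n w → L w ∈ S)
    {w : C.Words} (hw : w ∈ C.cobarGr x y n) : L (C.plus w) ∈ S := by
  refine cobarGr_map_mem (L := L ∘ₗ C.plus) (fun p w hw => ?_) hw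
  rw [LinearMap.comp_apply]
  cases p with
  | zero => cases hw; rw [plus_one, map_zero]; exact zero_mem _
  | succ p => rw [hw.plus]; exact h p w hw

theorem degen_mem {x y : C.Obj} {n : ℕ} {u : C.Triple C.BarWords}
    (hu : u ∈ C.sandwichGr C.barGen x y n) : C.degen u ∈ C.sandwichGr C.barGen x y (n + 1) := by
  refine sandwichGr_map_mem (fun x' y' i j k a g b ha hg hb e => ?_) hu
  obtain ⟨p, hg⟩ := hg
  rw [← tmul_eq_smul_mulRight, degen_tmul]
  refine cobarGr_plus_mem (L := TensorProduct.mk R C.Words _ 1 ∘ₗ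
    (TensorProduct.mk R C.BarWords C.Words).flip b ∘ₗ LinearMap.mulRight R g ∘ₗ ι R)
    (fun q w hw => ?_) ha
  exact tmul_mem_sandwichGr (one_mem_cobarGr x) ⟨_, .cons hw hg⟩ hb (by omega)

theorem degen_mem_of_lower {x y : C.Obj} {n : ℕ} {u : C.Triple C.BarWords}
    (hu : u ∈ lower (C.sandwichGr C.barGen x y) n) : C.degen u ∈ C.sandwichGr C.barGen x y n := by
  rcases mem_lower_iff.1 hu with rfl | ⟨k, rfl, hu⟩
  · rw [map_zero]; exact zero_mem _
  · exact degen_mem hu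

theorem unitBar_mem {x y : C.Obj} {n : ℕ} {b : C.Words} (hb : b ∈ C.cobarGr x y n) :
    C.unitBar b ∈ C.sandwichGr C.barGen x y n :=
  tmul_mem_sandwichGr (one_mem_cobarGr x) ⟨0, .nil x⟩ hb (by omega)

theorem aug_mem {x y : C.Obj} {n : ℕ} {u : C.Triple C.BarWords}
    (hu : u ∈ C.sandwichGr C.barGen x y n) : C.aug u ∈ C.cobarGr x y n := by
  refine sandwichGr_map_mem (fun x' y' i j k a g b ha hg hb e => ?_) hu
  obtain ⟨p, hg⟩ := hg
  rw [← tmul_eq_smul_mulRight, aug_tmul]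
  cases hg with
  | nil x => subst e; exact Submodule.smul_mem _ _ (mul_mem_cobarGr ha hb)
  | cons hc ht => rw [barCoeff_ι_mul, zero_smul]; exact zero_mem _

theorem aug_unitBar (b : C.Words) : C.aug (C.unitBar b) = b := by
  rw [unitBar_apply, aug_tmul]; simp

theorem barDiff_unitBar (b : C.Words) : C.barDiff (C.unitBar b) = C.unitBar (C.wordD b) := by
  rw [unitBar_apply, isTwisted_barDiff]; simp [unitBar_apply]

theorem barDiff_mid (t : C.BarWords) : C.barDiff (C.mid _ t) = C.barMid t :=
  isTwisted_barDiff.one_tmul_one t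

theorem degen_smul_mid (a : C.Words) (t : C.BarWords) :
    C.degen (a • C.mid _ t) = C.mid _ (ι R (C.plus a) * t) := by
  simp [smul_triple]

/-- Write a nonempty bar word as `s(u)`. Then `εδs(u) = -ε(u) + εηε(u) - εsδ(u)`, where `εη = 1` and
`εs = 0`. -/
theorem aug_barMid (t : C.BarWords) : C.aug (C.barMid (C.barPlus t)) = 0 := by
  induction t using word_induction with
  | one => simp
  | cons a t _ =>
    rw [map_mul, barPlus_ι, ← barDiff_mid, ← degen_smul_mid,
      barDiff_degen (by rw [normalize_smul, normalize_mid, barPlus_barPlus])]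
    simp [aug_unitBar, aug_degen]
  | add a b ha hb => simp only [map_add, ha, hb, add_zero]
  | smul r a ha => simp only [map_smul, ha, smul_zero]

/-- The augmentation is a chain map. -/
theorem aug_barDiff {u : C.Triple C.BarWords} (hu : C.normalize u = u) :
    C.aug (C.barDiff u) = C.wordD (C.aug u) := by
  rw [← hu]
  clear hu
  induction u using triple_induction with
  | h a t b =>
    rw [normalize_tmul, isTwisted_barDiff, map_add, map_add, aug_smul, aug_mulRight, aug_barMid]
    generalize C.barPlus t = t
    have : C.barCoeff (C.barSgn t) = C.barCoeff t := by
      have : (algebraMapInv (R := R) (M := C.Words)).comp C.barSgn = algebraMapInv := by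
        ext a; simp [algebraMapInv]
      exact AlgHom.congr_fun this t
    simp [this, wordD_mul]
  | hadd u v hu hv => simp only [map_add, hu, hv]

theorem barDiff_smul_mid_mem {x y z : C.Obj} {i j : ℕ} {a : C.Words} {t : C.BarWords}
    (ha : a ∈ C.cobarGr x z i) (ht : C.barGen z y j t)
    (h : C.barMid t ∈ lower (C.sandwichGr C.barGen z y) j) :
    C.barDiff (a • C.mid _ t) ∈ lower (C.sandwichGr C.barGen x y) (i + j) := by
  rw [isTwisted_barDiff.smul, wordSgn_of_mem ha, barDiff_mid, smul_assoc]
  exact add_mem (lower_smul_mem_sandwichGr (wordD_mem ha) (gen_mem_sandwichGr ht))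
    (Submodule.smul_mem _ _ (smul_lower_mem_sandwichGr ha h))

/-- For `[a|t] = s(u)` with `u = a·1[t]1`, each term of `-u + ηε(u) - sδ(u)` has visible degree and
endpoints, so the individual faces need not be inspected. -/
theorem IsBarWord.barMid_mem {x y : C.Obj} {p n : ℕ} {t : C.BarWords}
    (ht : C.IsBarWord x y p n t) : C.barMid t ∈ lower (C.sandwichGr C.barGen x y) n := by
  induction ht with
  | nil x => rw [barMid_one]; exact zero_mem _
  | @cons x y z q p m n a t ha ht ih =>
    have ha' : a ∈ C.cobarGr x y m := Submodule.subset_span ⟨_, ha⟩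
    have hu : a • C.mid _ t ∈ C.sandwichGr C.barGen x z (m + n) :=
      smul_mem_sandwichGr ha' (gen_mem_sandwichGr ⟨_, ht⟩)
    -- Since `a` has positive length it equals `C.plus a`, which displays the generator as a value
    -- of the extra degeneracy.
    rw [← barDiff_mid, ← ha.plus, ← degen_smul_mid]
    rw [barDiff_degen (normalize_of_mem hu)]
    refine mem_lower_of_eq (k := m + n) ?_ (by omega)
    exact sub_mem (add_mem (neg_mem hu) (unitBar_mem (aug_mem hu)))
      (degen_mem_of_lower (barDiff_smul_mid_mem ha' ⟨_, ht⟩ ih))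

/-- Applying the degeneracy formula twice gives `δ²s = ηDε - ηεδ + sδ²`. The first two terms cancel
because `ε` is a chain map, and the last vanishes by induction on the bar length. -/
theorem IsBarWord.barDiff_barMid {x y : C.Obj} {p n : ℕ} {t : C.BarWords}
    (ht : C.IsBarWord x y p n t) : C.barDiff (C.barMid t) = 0 := by
  induction ht with
  | nil x => rw [barMid_one, map_zero]
  | @cons x y z q p m n a t ha ht ih =>
    have ha' : a ∈ C.cobarGr x y m := Submodule.subset_span ⟨_, ha⟩
    have hu : a • C.mid _ t ∈ C.sandwichGr C.barGen x z (m + n) :=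
      smul_mem_sandwichGr ha' (gen_mem_sandwichGr ⟨_, ht⟩)
    have hd := barDiff_smul_mid_mem ha' ⟨_, ht⟩ ht.barMid_mem
    have hn : C.normalize (a • C.mid _ t) = a • C.mid _ t := normalize_of_mem hu
    have h2 : C.barDiff (C.barDiff (a • C.mid _ t)) = 0 := by
      rw [isTwisted_barDiff.smul, barDiff_mid, map_add, isTwisted_barDiff.smul,
        isTwisted_barDiff.smul, ih, barDiff_mid, wordD_wordD, wordSgn_wordD]
      simp
    rw [← barDiff_mid, ← ha.plus, ← degen_smul_mid, barDiff_degen hn, map_sub, map_add, map_neg,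
      barDiff_unitBar, barDiff_degen (normalize_of_mem_lower hd), h2, aug_barDiff hn, map_zero]
    abel

theorem isDGBimodule_barDiff :
    IsDGBimodule C C.barGen C.barSgn.toLinearMap C.barMid C.barDiff where
  twisted := isTwisted_barDiff
  sign := fun ⟨_, h⟩ => h.barSgn
  mem := fun ⟨_, h⟩ => h.barMid_mem
  sq := fun ⟨_, h⟩ => h.barDiff_barMid

end CategoricalCoalgebra

namespace CategoricalCoalgebra

open TensorAlgebra TensorProduct Coalgebra Graded

variable {R : Type u} [CommRing R] {C : CategoricalCoalgebra.{u, v} R}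

/-! ### Iterated coproducts -/

variable (C) in
/-- The map `(a, t) ↦ [a|t]`. -/
noncomputable def consBar : C.Words →ₗ[R] C.BarWords →ₗ[R] C.BarWords :=
  LinearMap.mul R C.BarWords ∘ₗ ι R

@[simp] theorem consBar_apply (a : C.Words) (t : C.BarWords) : C.consBar a t = ι R a * t := rfl

theorem iterCoprod_succ (n : ℕ) :
    C.iterCoprod (n + 1) = conv C.consBar C.brace (C.iterCoprod n) := by
  have h : C.barCons = TensorProduct.lift C.consBar := by ext a t; simp
  rw [conv, iterCoprod, h]

/-- Each entry uses up at least one degree because `{c}` vanishes on `C₀`. -/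
theorem iterCoprod_of_lt {m n : ℕ} (h : n < m) {c : C.carrier} (hc : c ∈ C.gr n) :
    C.iterCoprod m c = 0 := by
  induction m generalizing n c with
  | zero => omega
  | succ m ih =>
    rw [iterCoprod_succ, conv_congr_of_lt (g' := 0) (fun _ => brace_of_mem_zero) hc
      (fun k hk b hb => ih (by omega) hb), conv_zero_right, LinearMap.zero_apply]

/-- Any bound above the degree computes the sum, so elements of different degrees can share one
range of summation. -/
theorem allCoprod_of_mem {n N : ℕ} (h : n < N) {c : C.carrier} (hc : c ∈ C.gr n) :
    C.allCoprod c = ∑ m ∈ Finset.range N, C.iterCoprod m c := by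
  have h1 : C.allCoprod c = ∑ m ∈ Finset.range (n + 1), C.iterCoprod m c := by
    rw [allCoprod, LinearMap.comp_apply, LinearEquiv.coe_coe, DirectSum.decomposeLinearEquiv_apply]
    lift c to C.gr n using hc
    rw [DirectSum.decompose_coe, ← DirectSum.lof_eq_of R, DirectSum.toModule_lof,
      LinearMap.comp_apply, LinearMap.sum_apply, Submodule.subtype_apply]
  rw [h1]
  refine Finset.sum_subset (Finset.range_mono h) fun m _ hm => iterCoprod_of_lt ?_ hc
  simpa using hm

/-- The sum of all iterated coproducts is a geometric series for convolution; its first entry is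
split off. -/
theorem allCoprod_eq : C.allCoprod = Algebra.linearMap R C.BarWords ∘ₗ counit +
    conv C.consBar C.brace C.allCoprod := by
  refine linearMap_ext C.gr fun n c hc => ?_
  rw [allCoprod_of_mem (Nat.lt_succ_self n) hc, Finset.sum_range_succ', add_comm,
    LinearMap.add_apply]
  congr 1
  -- After a nonzero first entry the other leg has degree below `n`, so `n` terms suffice for it;
  -- this matches the shifted sum on the left.
  rw [conv_congr_of_lt (g' := ∑ m ∈ Finset.range n, C.iterCoprod m)
    (fun _ => brace_of_mem_zero) hc fun k hk b hb => by
      rw [allCoprod_of_mem hk hb, LinearMap.sum_apply]]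
  simp only [iterCoprod_succ, conv_eq, LinearMap.comp_apply]
  generalize (comul c : C.carrier ⊗[R] C.carrier) = q
  induction q using TensorProduct.induction_on with
  | zero => simp
  | add p q hp hq => simp only [map_add, Finset.sum_add_distrib, hp, hq]
  | tmul a b => simp [LinearMap.sum_apply]

theorem plus_brace (c : C.carrier) : C.plus (C.brace c) = C.brace c := by
  rw [brace_apply, plus_ι]

/-- The map `c ↦ ∑ 1[{c⁽¹⁾}|⋯|{c⁽ⁿ⁾}] q`. -/
noncomputable def spread (q : C.BarWords ⊗[R] C.Words) : C.carrier →ₗ[R] C.Triple C.BarWords :=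
  TensorProduct.mk R C.Words _ 1 ∘ₗ
    (LinearMap.toSpanSingleton C.BarWords _ q).restrictScalars R ∘ₗ C.allCoprod

theorem spread_apply (q : C.BarWords ⊗[R] C.Words) (c : C.carrier) :
    C.spread q c = 1 ⊗ₜ[R] (C.allCoprod c • q) := rfl

/-- The recursion for all iterated coproducts, rewritten so that the first entry is created by the
extra degeneracy. In this form `barDiff_degen` computes the differential. -/
theorem spread_eq (q : C.BarWords ⊗[R] C.Words) : C.spread q =
    C.degen ∘ₗ conv (C.lact _) C.brace (C.spread q) +
      LinearMap.toSpanSingleton R (C.Triple C.BarWords) (1 ⊗ₜ q) ∘ₗ counit := by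
  conv_lhs => rw [spread, allCoprod_eq]
  rw [LinearMap.comp_add, LinearMap.comp_add, add_comm, ← LinearMap.comp_assoc,
    ← LinearMap.comp_assoc]
  congr 1
  · have h : ∀ a b, (TensorProduct.mk R C.Words _ 1 ∘ₗ
        (LinearMap.toSpanSingleton C.BarWords _ q).restrictScalars R)
          (C.consBar (C.brace a) (C.allCoprod b)) =
        (C.lact C.BarWords).compr₂ C.degen (C.brace a) (C.spread q b) := fun a b => by
      simp [spread_apply, degen_smul_one_tmul, plus_brace, mul_smul]
    rw [comp_conv h]
    exact (comp_conv fun a b => rfl).symm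
  · ext c
    simp [Algebra.algebraMap_eq_smul_one]

theorem degen_spread (q : C.BarWords ⊗[R] C.Words) (c : C.carrier) : C.degen (C.spread q c) = 0 :=
  degen_one_tmul _

/-- This is the uniqueness principle for such recursions: two maps with the same recursion have a
difference that satisfies the homogeneous one. -/
theorem eq_zero_of_degen_conv {E : C.carrier →ₗ[R] C.Triple C.BarWords}
    {f : C.carrier →ₗ[R] C.Words} (hf : ∀ c ∈ C.gr 0, f c = 0)
    (h : E = C.degen ∘ₗ conv (C.lact _) f E) : E = 0 := by
  refine eq_zero_of_conv (β := (C.lact C.BarWords).compr₂ C.degen) hf (h.trans ?_)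
  exact comp_conv fun a b => rfl

theorem barPlus_allCoprod (c : C.carrier) : C.barPlus (C.allCoprod c) = C.allCoprod c := by
  have : C.barPlus.toLinearMap ∘ₗ C.allCoprod - C.allCoprod = 0 := by
    refine eq_zero_of_conv (f := C.brace) (β := C.consBar) (fun _ => brace_of_mem_zero) ?_
    rw [conv_sub_right]
    have h1 : C.barPlus.toLinearMap ∘ₗ conv C.consBar C.brace C.allCoprod =
        conv C.consBar C.brace (C.barPlus.toLinearMap ∘ₗ C.allCoprod) :=
      comp_conv fun a b => by simp [plus_brace]
    have h2 : C.barPlus.toLinearMap ∘ₗ Algebra.linearMap R C.BarWords ∘ₗ counit =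
        Algebra.linearMap R C.BarWords ∘ₗ (counit : C.carrier →ₗ[R] R) := by
      ext c; simp
    have h3 := congrArg (C.barPlus.toLinearMap ∘ₗ ·) (allCoprod_eq (C := C))
    simp only [LinearMap.comp_add, h1, h2] at h3
    linear_combination (norm := abel) h3 - allCoprod_eq (C := C)
  exact sub_eq_zero.1 (LinearMap.congr_fun this c)

theorem normalize_one_tmul_smul (t : C.BarWords) (q : C.BarWords ⊗[R] C.Words) :
    C.normalize (1 ⊗ₜ[R] (t • q)) =
      1 ⊗ₜ[R] (C.barPlus t • map C.barPlus.toLinearMap LinearMap.id q) := by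
  induction q using TensorProduct.induction_on with
  | zero => simp
  | add p q hp hq => simp only [smul_add, tmul_add, map_add, hp, hq]
  | tmul t b => simp [smul_tmul']

/-- Induction on the degree through the recursion. The counit term contributes only in degree zero,
and there an element with distinct endpoints is zero. -/
theorem spread_mem {x z y : C.Obj} {n m : ℕ} {q : C.BarWords ⊗[R] C.Words}
    (hq : 1 ⊗ₜ[R] q ∈ C.sandwichGr C.barGen z y m) {c : C.carrier} (hc : c ∈ C.hom x z)
    (hn : c ∈ C.gr n) : C.spread q c ∈ C.sandwichGr C.barGen x y (n + m) := by
  induction n using Nat.strong_induction_on generalizing x c with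
  | h n ih =>
    rw [spread_eq]
    refine add_mem (degen_mem_of_lower ?_) ?_
    · refine conv_mem hc hn fun z' i j a b ha hi hb hj e => ?_
      rcases mem_lower_iff.1 (brace_mem_cobarGr ha hi) with h | ⟨k, rfl, h⟩
      · rw [h, map_zero]; exact zero_mem _
      · exact mem_lower_of_eq (smul_mem_sandwichGr h (ih j (by omega) hb hj)) (by omega)
    · rw [LinearMap.comp_apply, LinearMap.toSpanSingleton_apply]
      rcases Nat.eq_zero_or_pos n with rfl | h
      · rw [zero_add]
        rcases eq_or_ne x z with rfl | hxz
        · exact Submodule.smul_mem _ _ hq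
        · rw [(hom_zero hc hn).2 hxz, map_zero, zero_smul]; exact zero_mem _
      · rw [C.counit_eq_zero hn (by omega), zero_smul]; exact zero_mem _

theorem aug_comp_spread (q : C.BarWords ⊗[R] C.Words) : C.aug ∘ₗ C.spread q =
    LinearMap.toSpanSingleton R C.Words (C.aug (1 ⊗ₜ q)) ∘ₗ counit := by
  rw [spread_eq]
  ext c
  simp [aug_degen]

/-- A recursion for the differential of `spread q`. -/
theorem barDiff_comp_spread {q : C.BarWords ⊗[R] C.Words}
    (hq : map C.barPlus.toLinearMap LinearMap.id q = q) :
    C.barDiff ∘ₗ C.spread q + conv (C.lact _) C.brace (C.spread q) =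
      C.unitBar ∘ₗ LinearMap.mulRight R (C.aug (1 ⊗ₜ q)) ∘ₗ C.brace +
      C.degen ∘ₗ conv (C.lact _) (C.brace ∘ₗ C.bd) (C.spread q) +
      C.degen ∘ₗ conv (C.lact _) (C.brace ∘ₗ sgn C.gr)
        (C.barDiff ∘ₗ C.spread q + conv (C.lact _) C.brace (C.spread q)) +
      LinearMap.toSpanSingleton R _ (C.barDiff (1 ⊗ₜ q)) ∘ₗ counit := by
  have hn : C.normalize ∘ₗ conv (C.lact _) C.brace (C.spread q) =
      conv (C.lact _) C.brace (C.spread q) := comp_conv fun a b => by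
    rw [lact_apply, normalize_smul, spread_apply, normalize_one_tmul_smul, hq, barPlus_allCoprod]
  have h1 : C.barDiff ∘ₗ C.degen ∘ₗ conv (C.lact _) C.brace (C.spread q) =
      -conv (C.lact _) C.brace (C.spread q) +
        C.unitBar ∘ₗ C.aug ∘ₗ conv (C.lact _) C.brace (C.spread q) -
        C.degen ∘ₗ C.barDiff ∘ₗ conv (C.lact _) C.brace (C.spread q) :=
    LinearMap.ext fun c => barDiff_degen (LinearMap.congr_fun hn c)
  have h2 : C.aug ∘ₗ conv (C.lact _) C.brace (C.spread q) =
      LinearMap.mulRight R (C.aug (1 ⊗ₜ q)) ∘ₗ C.brace := by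
    rw [comp_conv (β' := LinearMap.mul R C.Words) (f' := C.brace) (g' := C.aug ∘ₗ C.spread q)
      (fun a b => by simp [aug_smul]), aug_comp_spread, conv_counit_right]
    rfl
  -- The curvature in `D{c'}` leaves the identity as left word, which the extra degeneracy kills;
  -- hence curvature does not enter this recursion.
  have h3 : C.degen ∘ₗ conv (LinearMap.lsmul R _) C.curv (C.spread q) = 0 := by
    rw [comp_conv (β' := LinearMap.lsmul R _) (f' := C.curv)
      (g' := (0 : C.carrier →ₗ[R] C.Triple C.BarWords)) (fun a b => by simp [degen_spread]),
      conv_zero_right]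
  conv_lhs => enter [1]; rw [spread_eq]
  rw [LinearMap.comp_add, h1, isTwisted_barDiff.comp_conv_lact_brace, conv_lact_letterD,
    LinearMap.comp_sub, LinearMap.comp_sub, LinearMap.comp_sub, h3, h2, conv_add_right,
    LinearMap.comp_add]
  have h4 : C.barDiff ∘ₗ LinearMap.toSpanSingleton R (C.Triple C.BarWords) (1 ⊗ₜ q) ∘ₗ counit =
      LinearMap.toSpanSingleton R _ (C.barDiff (1 ⊗ₜ q)) ∘ₗ (counit : C.carrier →ₗ[R] R) := by
    ext c; simp
  rw [h4]
  abel

theorem spread_comp_bd (q : C.BarWords ⊗[R] C.Words) : C.spread q ∘ₗ C.bd =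
    C.degen ∘ₗ conv (C.lact _) (C.brace ∘ₗ C.bd) (C.spread q) +
      C.degen ∘ₗ conv (C.lact _) (C.brace ∘ₗ sgn C.gr) (C.spread q ∘ₗ C.bd) := by
  conv_lhs => rw [spread_eq]
  rw [LinearMap.add_comp, LinearMap.comp_assoc, LinearMap.comp_assoc, counit_comp_bd, conv_comp_bd,
    LinearMap.comp_zero, add_zero, LinearMap.comp_add]

theorem spread_comp_sgn (q : C.BarWords ⊗[R] C.Words) : C.spread q ∘ₗ sgn C.gr =
    C.degen ∘ₗ conv (C.lact _) (C.brace ∘ₗ sgn C.gr) (C.spread q ∘ₗ sgn C.gr) +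
      LinearMap.toSpanSingleton R (C.Triple C.BarWords) (1 ⊗ₜ q) ∘ₗ counit := by
  conv_lhs => rw [spread_eq]
  rw [LinearMap.add_comp, LinearMap.comp_assoc, LinearMap.comp_assoc, counit_comp_sgn,
    conv_comp_sgn]

theorem alphaLin_smul (a : C.Words) (u : C.Triple C.carrier) :
    C.alphaLin (a • u) = a • C.alphaLin u := by
  induction u using triple_induction with
  | h a' t v => rfl
  | hadd u v hu hv => simp only [smul_add, map_add, hu, hv]

theorem alphaLin_mulRight (b : C.Words) (u : C.Triple C.carrier) :
    C.alphaLin (C.mulRight b u) = C.mulRight b (C.alphaLin u) := by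
  induction u using triple_induction with
  | h a' t v => rfl
  | hadd u v hu hv => simp only [map_add, hu, hv]

theorem alphaLin_comp_mid : C.alphaLin ∘ₗ C.mid _ = C.spread (1 ⊗ₜ 1) := by
  ext c
  simp [alphaLin, spread_apply, smul_tmul']

/-- With `A` for `α` on generators, `δA` plus left multiplication by letters and `A∂` plus signed
right multiplication by letters solve the same recursion, so they agree. This is the chain map
equation with the left letters moved across. -/
theorem alphaLin_qMid (c : C.carrier) :
    C.alphaLin (C.qMid c) = C.barDiff (C.alphaLin (C.mid _ c)) := by
  set A := C.spread (1 ⊗ₜ[R] (1 : C.Words)) with hA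
  have hd : C.barDiff (1 ⊗ₜ[R] ((1 : C.BarWords) ⊗ₜ[R] (1 : C.Words))) = 0 := by
    rw [← mid_apply, barDiff_mid, barMid_one]
  have h1 : C.alphaLin ∘ₗ C.qMid = A ∘ₗ C.bd - conv (C.lact _) C.brace A +
      conv (C.ract _) (A ∘ₗ sgn C.gr) C.brace := by
    rw [qMid, LinearMap.comp_add, LinearMap.comp_sub, ← LinearMap.comp_assoc, alphaLin_comp_mid]
    rw [comp_conv (β' := C.lact _) (f' := C.brace) (g' := A), comp_conv (β' := C.ract _)
      (f' := A ∘ₗ sgn C.gr) (g' := C.brace)]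
    · intro a b
      rw [ract_apply, alphaLin_mulRight, hA, ← alphaLin_comp_mid]; rfl
    · intro a b
      rw [lact_apply, alphaLin_smul, hA, ← alphaLin_comp_mid]; rfl
  have h2 := barDiff_comp_spread (C := C) (q := 1 ⊗ₜ[R] (1 : C.Words)) (by simp)
  rw [← hA, hd] at h2
  have h3 := spread_comp_bd (C := C) (1 ⊗ₜ[R] (1 : C.Words))
  -- The inhomogeneous term `1[]{c}` here is the one produced by the augmentation in `h2`.
  have h4 : conv (C.ract _) (A ∘ₗ sgn C.gr) C.brace = C.degen ∘ₗ conv (C.lact _)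
      (C.brace ∘ₗ sgn C.gr) (conv (C.ract _) (A ∘ₗ sgn C.gr) C.brace) +
      C.unitBar ∘ₗ C.brace := by
    conv_lhs => rw [hA, spread_comp_sgn, ← hA]
    rw [conv_add_left, conv_counit_left, ← conv_ract_lact]
    congr 1
    · exact (comp_conv fun a b => by simp [degen_mulRight]).symm
    · ext c; simp [unitBar_apply]
  have h5 : C.barDiff ∘ₗ A + conv (C.lact _) C.brace A -
      (A ∘ₗ C.bd + conv (C.ract _) (A ∘ₗ sgn C.gr) C.brace) = 0 := by
    refine eq_zero_of_degen_conv (f := C.brace ∘ₗ sgn C.gr) (fun _ => brace_sgn_of_mem_zero) ?_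
    rw [conv_sub_right, conv_add_right _ _ (A ∘ₗ C.bd), LinearMap.comp_sub, LinearMap.comp_add]
    have h6 : LinearMap.mulRight R (C.aug (1 ⊗ₜ[R] ((1 : C.BarWords) ⊗ₜ[R] (1 : C.Words)))) =
        LinearMap.id := by
      ext a; simp
    rw [h6, LinearMap.id_comp] at h2
    rw [← hA] at h3
    have h7 : LinearMap.toSpanSingleton R (C.Triple C.BarWords) 0 = 0 := by ext; simp
    rw [h7, LinearMap.zero_comp] at h2
    linear_combination (norm := abel) h2 - h3 - h4
  have h8 : C.barDiff ∘ₗ A = C.alphaLin ∘ₗ C.qMid := by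
    rw [h1, ← sub_eq_zero, ← h5]; abel
  have h9 := LinearMap.congr_fun h8 c
  rw [hA, ← alphaLin_comp_mid] at h9
  exact h9.symm

theorem isBimoduleMap_alphaLin :
    IsBimoduleMap C C.homGen C.barGen 0 fun _ => C.alphaLin where
  mem_gen := fun {x y n c} ⟨hc, hn⟩ => by
    have h := spread_mem (q := 1 ⊗ₜ 1) (gen_mem_sandwichGr (G := C.barGen) ⟨0, .nil y⟩) hc hn
    rw [← alphaLin_comp_mid] at h
    exact h
  smul _ _ := by rw [zero_mul, pow_zero, one_smul, alphaLin_smul]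
  mulRight _ _ := alphaLin_mulRight _ _

end CategoricalCoalgebra

namespace CategoricalCoalgebra

open TensorAlgebra TensorProduct Coalgebra Graded

variable {R : Type u} [CommRing R] {C : CategoricalCoalgebra.{u, v} R}

/-! ### The projection to `𝒬` -/

@[simp] theorem targetAux_one : C.targetAux 1 = 0 := wordRec_one _ _

theorem targetAux_ι_mul (c : C.carrier) (w : C.Words) : C.targetAux (ι R c * w) =
    C.wordCoeff w • map (ι R) (zeroPart C.gr) (comul c) + ι R c • C.targetAux w :=
  wordRec_ι_mul _ _ _ _

theorem target_apply (x : C.Obj) (w : C.Words) : C.target x w =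
    C.targetAux w + C.wordCoeff w • ((1 : C.Words) ⊗ₜ[R] (x : C.carrier)) := rfl

theorem map_ι_zeroPart_comul {x y : C.Obj} {c : C.carrier} (hc : c ∈ C.hom x y) :
    map (ι R) (zeroPart C.gr) (comul c) = ι R c ⊗ₜ[R] (y : C.carrier) := by
  have h := congrArg (map (ι R) LinearMap.id) (mem_hom.1 hc).2
  rwa [← LinearMap.comp_apply, ← map_comp, map_tmul, LinearMap.comp_id, LinearMap.id_comp] at h

theorem IsWord.targetAux {x y : C.Obj} {p n : ℕ} {w : C.Words} (hw : C.IsWord x y (p + 1) n w) :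
    C.targetAux w = w ⊗ₜ[R] (y : C.carrier) := by
  induction p generalizing x n w with
  | zero =>
    cases hw with
    | cons hc hm hw =>
      cases hw
      rw [targetAux_ι_mul, map_ι_zeroPart_comul hc]
      simp
  | succ p ih =>
    cases hw with
    | cons hc hm hw =>
      rw [targetAux_ι_mul, ih hw, hw.wordCoeff, zero_smul, zero_add]
      rfl

/-- For positive length the right coaction of the last letter shows the target. The empty word
forgets its object, which is why the starting object has to be supplied. -/
theorem target_of_mem {x y : C.Obj} {n : ℕ} {a : C.Words} (ha : a ∈ C.cobarGr x y n) :
    C.target x a = a ⊗ₜ[R] (y : C.carrier) := by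
  refine cobarGr_ext (g := (TensorProduct.mk R C.Words C.carrier).flip (y : C.carrier))
    (fun p w hw => ?_) ha
  rw [LinearMap.flip_apply, TensorProduct.mk_apply, target_apply]
  cases p with
  | zero => cases hw; simp
  | succ p => rw [hw.targetAux, hw.wordCoeff, zero_smul, add_zero]

@[simp] theorem splitWord_one : C.splitWord 1 = 0 := wordRec_one _ _

theorem splitWord_ι_mul (c : C.carrier) (w : C.Words) : C.splitWord (ι R c * w) =
    (1 : C.Words) ⊗ₜ[R] (c ⊗ₜ[R] w) - ι R (sgn C.gr c) • C.splitWord w := wordRec_ι_mul _ _ _ _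

@[simp] theorem splitWord_ι (c : C.carrier) : C.splitWord (ι R c) = C.mid _ c := by
  simpa using splitWord_ι_mul c 1

theorem splitWord_plus (w : C.Words) : C.splitWord (C.plus w) = C.splitWord w := by
  simp [plus_apply]

/-- `splitWord` is a derivation up to sign. -/
theorem splitWord_mul (a b : C.Words) :
    C.splitWord (a * b) = C.mulRight b (C.splitWord a) + C.wordSgn a • C.splitWord b := by
  induction a using word_induction with
  | one => simp
  | cons c w ih =>
    rw [mul_assoc, splitWord_ι_mul, ih, splitWord_ι_mul, map_mul, wordSgn_ι, map_sub,
      mulRight_tmul, mulRight_smul, smul_add, mul_smul, neg_smul]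
    abel
  | add a a' ha ha' => rw [add_mul, map_add, ha, ha', map_add, map_add, map_add, add_smul]; abel
  | smul r a ha => rw [smul_mul_assoc, map_smul, ha, map_smul, map_smul, map_smul, smul_add,
      smul_assoc]

theorem IsWord.splitWord_mem {x y : C.Obj} {p n : ℕ} {w : C.Words} (hw : C.IsWord x y p n w) :
    C.splitWord w ∈ C.sandwichGr C.homGen x y (n + 1) := by
  induction hw with
  | nil x => rw [splitWord_one]; exact zero_mem _
  | cons hc hm hw ih =>
    rw [splitWord_ι_mul, sgn_of_mem C.gr hm, map_smul, smul_assoc]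
    refine sub_mem (tmul_mem_sandwichGr (one_mem_cobarGr _) ⟨hc, hm⟩
      (Submodule.subset_span ⟨_, hw⟩) (by omega)) (Submodule.smul_mem _ _ ?_)
    have h := smul_mem_sandwichGr (ι_mem_cobarGr hc hm) ih
    rwa [← add_assoc] at h

/-- Splitting the quadratic part of `D{c}` at either letter reproduces the two twisting terms of
`d(1 □ c □ 1)`, except where the leg placed in the middle has degree zero. The right side is this
leftover. -/
theorem qMid_add_splitWord_letterD : C.qMid + C.splitWord ∘ₗ C.letterD =
    conv (C.ract _) (C.mid _ ∘ₗ zeroPart C.gr) C.brace -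
      conv (C.lact _) C.brace (C.mid _ ∘ₗ zeroPart C.gr) := by
  have h1 : C.splitWord ∘ₗ conv (LinearMap.mul R C.Words) (C.brace ∘ₗ sgn C.gr) C.brace =
      conv (C.ract _) (C.mid _ ∘ₗ posPart C.gr ∘ₗ sgn C.gr) C.brace -
        conv (C.lact _) C.brace (C.mid _ ∘ₗ posPart C.gr) := by
    have h : C.splitWord ∘ₗ TensorProduct.lift ((LinearMap.mul R C.Words).compl₁₂
        (C.brace ∘ₗ sgn C.gr) C.brace) =
      TensorProduct.lift ((C.ract _).compl₁₂ (C.mid _ ∘ₗ posPart C.gr ∘ₗ sgn C.gr) C.brace) -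
        TensorProduct.lift ((C.lact _).compl₁₂ C.brace (C.mid _ ∘ₗ posPart C.gr)) := by
      ext a b
      have hs : C.wordSgn (C.brace (sgn C.gr a)) = -C.brace a := by rw [wordSgn_brace, sgn_sgn]
      have hb : ∀ c, C.splitWord (C.brace c) = C.mid _ (posPart C.gr c) := fun c => by
        rw [brace_apply, splitWord_ι]
      simp [splitWord_mul, hs, hb, sub_eq_add_neg]
    rw [conv_eq, ← LinearMap.comp_assoc, h, LinearMap.sub_comp, conv_eq, conv_eq]
  have h2 : C.splitWord ∘ₗ Algebra.linearMap R C.Words ∘ₗ C.curv = 0 := by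
    ext c; simp [Algebra.algebraMap_eq_smul_one]
  have h3 : C.splitWord ∘ₗ ι R ∘ₗ C.bd = C.mid _ ∘ₗ C.bd := by
    ext c; simp
  have hz : C.mid C.carrier ∘ₗ posPart C.gr = C.mid _ - C.mid _ ∘ₗ zeroPart C.gr := by
    rw [eq_sub_iff_add_eq, add_comm, ← LinearMap.comp_add, zeroPart_add_posPart, LinearMap.comp_id]
  rw [letterD_eq, LinearMap.comp_sub, LinearMap.comp_sub, h1, h2, h3, qMid, ← LinearMap.comp_assoc,
    hz, LinearMap.sub_comp, LinearMap.comp_assoc, zeroPart_sgn, conv_sub_left, conv_sub_right]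
  abel

/-- Legs of degree zero are given by the coactions, so for an element with endpoints the leftover is
`x □ {c}` minus `{c} □ y`. -/
theorem qMid_add_splitWord_letterD_of_mem {x y : C.Obj} {m : ℕ} {c : C.carrier}
    (hc : c ∈ C.hom x y) (hm : c ∈ C.gr (m + 1)) : C.qMid c + C.splitWord (C.letterD c) =
      C.mulRight (ι R c) (C.mid _ (x : C.carrier)) - ι R c • C.mid _ (y : C.carrier) := by
  have h := LinearMap.congr_fun (qMid_add_splitWord_letterD (C := C)) c
  have hb : C.brace c = ι R c := brace_of_mem hm (by omega)
  rw [LinearMap.add_apply, LinearMap.comp_apply] at h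
  rw [h, LinearMap.sub_apply, ← hb]
  congr 1
  · have h1 := congrArg (TensorProduct.lift ((C.ract _).compl₁₂ (C.mid _) C.brace))
      (mem_hom.1 hc).1
    rw [← LinearMap.comp_apply, TensorProduct.lift_comp_map] at h1
    rw [conv_eq]
    exact h1
  · have h1 := congrArg (TensorProduct.lift ((C.lact _).compl₁₂ C.brace (C.mid _)))
      (mem_hom.1 hc).2
    rw [← LinearMap.comp_apply, TensorProduct.lift_comp_map] at h1
    rw [conv_eq]
    exact h1

/-- The differential of `splitWord`. -/
theorem IsWord.qDiff_splitWord {x y : C.Obj} {p n : ℕ} {w : C.Words} (hw : C.IsWord x y p n w) :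
    C.qDiff (C.splitWord w) = -C.splitWord (C.wordD w) - w • C.mid _ (y : C.carrier) +
      C.mulRight w (C.mid _ (x : C.carrier)) := by
  induction hw with
  | nil x => simp
  | @cons x z y p m n c w hc hm hw ih =>
    have h1 : C.wordSgn (C.letterD c) = C.letterD (sgn C.gr c) :=
      LinearMap.congr_fun wordSgn_comp_letterD c
    have h2 := congrArg (C.mulRight w) (qMid_add_splitWord_letterD_of_mem hc hm)
    have h3 : (1 : C.Words) ⊗ₜ[R] (c ⊗ₜ[R] w) = C.mulRight w (C.mid _ c) := by simp
    -- The leftover of the letter `c` and that of the shorter word share the intermediate object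
    -- `z`; those contributions telescope.
    rw [splitWord_ι_mul, h3, map_sub, isTwisted_qDiff.mulRight, isTwisted_qDiff.smul, mid_apply,
      isTwisted_qDiff.one_tmul_one, ih, wordD_ι_mul, map_sub, splitWord_mul, splitWord_mul, h1,
      tripleSgn_tmul, splitWord_ι, wordD_ι, wordSgn_ι, sgn_sgn, map_one, ← mid_apply]
    simp only [map_add, map_sub, mulRight_mulRight, mulRight_smul] at h2
    simp only [smul_add, smul_sub, smul_neg, neg_smul, mul_smul]
    have h4 : ι R c • C.mulRight w (C.mid _ (z : C.carrier)) =
      C.mulRight w (ι R c • C.mid _ (z : C.carrier)) := (mulRight_smul _ _ _).symm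
    linear_combination (norm := abel) h2

@[simp] theorem barSingle_one : C.barSingle 1 = 0 := wordRec_one _ _

@[simp] theorem barSingle_ι_mul (a : C.Words) (t : C.BarWords) :
    C.barSingle (ι R a * t) = C.barCoeff t • a := wordRec_ι_mul _ _ _ _

theorem piLin_tmul (x : C.Obj) (a : C.Words) (t : C.BarWords) (b : C.Words) :
    C.piLin x (a ⊗ₜ[R] (t ⊗ₜ[R] b)) =
      C.barCoeff t • C.mulRight b (TensorProduct.assoc R C.Words C.carrier C.Words
        (C.target x a ⊗ₜ 1)) + a • C.mulRight b (C.splitWord (C.barSingle t)) := by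
  rw [piLin, LinearMap.add_apply, insertBoth_tmul, ← assoc_tmul]
  simp

/-- The value of `π` on `1[a₁|⋯|a_p]1`. -/
noncomputable def piMid (x : C.Obj) : C.BarWords →ₗ[R] C.Triple C.carrier :=
  LinearMap.toSpanSingleton R _ (C.mid _ (x : C.carrier)) ∘ₗ C.barCoeff +
    C.splitWord ∘ₗ C.barSingle

theorem piMid_apply (x : C.Obj) (t : C.BarWords) : C.piMid x t =
    C.barCoeff t • C.mid _ (x : C.carrier) + C.splitWord (C.barSingle t) := rfl

theorem piLin_smul_mulRight_mid {x z : C.Obj} {i : ℕ} {a : C.Words} (ha : a ∈ C.cobarGr x z i)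
    (t : C.BarWords) (b : C.Words) :
    C.piLin x (a • C.mulRight b (1 ⊗ₜ[R] (t ⊗ₜ[R] 1))) = a • C.mulRight b (C.piMid z t) := by
  rw [← tmul_eq_smul_mulRight, piLin_tmul, target_of_mem ha, piMid_apply, map_add, map_smul,
    smul_add, smul_comm a]
  simp [smul_triple]

theorem piLin_mulRight (x : C.Obj) (b : C.Words) (u : C.Triple C.BarWords) :
    C.piLin x (C.mulRight b u) = C.mulRight b (C.piLin x u) := by
  induction u using triple_induction with
  | h a t v => simp only [mulRight_tmul, piLin_tmul, map_add, map_smul, mulRight_smul, mulRight_mulRight]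
  | hadd u v hu hv => simp only [map_add, hu, hv]

theorem piLin_mid (x : C.Obj) (t : C.BarWords) :
    C.piLin x (1 ⊗ₜ[R] (t ⊗ₜ[R] 1)) = C.piMid x t := by
  simpa using piLin_smul_mulRight_mid (one_mem_cobarGr x) t 1

theorem IsBarWord.piMid_mem {x y : C.Obj} {p n : ℕ} {t : C.BarWords}
    (ht : C.IsBarWord x y p n t) : C.piMid x t ∈ C.sandwichGr C.homGen x y n := by
  rw [piMid_apply]
  cases ht with
  | nil x =>
    rw [barCoeff_one, barSingle_one, map_zero, one_smul, add_zero]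
    exact gen_mem_sandwichGr ⟨object_mem_hom x, object_mem x⟩
  | cons ha ht =>
    rw [barCoeff_ι_mul, barSingle_ι_mul, zero_smul, zero_add]
    cases ht with
    | nil y => rw [barCoeff_one, one_smul]; exact ha.splitWord_mem
    | cons _ _ => rw [barCoeff_ι_mul, zero_smul, map_zero]; exact zero_mem _

theorem piLin_smul {x z y : C.Obj} {i j : ℕ} {a : C.Words} {u : C.Triple C.BarWords}
    (ha : a ∈ C.cobarGr x z i) (hu : u ∈ C.sandwichGr C.barGen z y j) :
    C.piLin x (a • u) = a • C.piLin z u := by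
  refine sandwichGr_ext (L := C.piLin x ∘ₗ C.lact _ a) (L' := C.lact _ a ∘ₗ C.piLin z)
    (fun x' y' i j k a' g b ha' hg hb _ => ?_) hu
  rw [LinearMap.comp_apply, LinearMap.comp_apply, lact_apply, lact_apply, ← mul_smul,
    piLin_smul_mulRight_mid ha', piLin_smul_mulRight_mid (mul_mem_cobarGr ha ha'), mul_smul]

theorem isBimoduleMap_piLin : IsBimoduleMap C C.barGen C.homGen 0 C.piLin where
  mem_gen := fun ⟨_, h⟩ => by rw [piLin_mid]; exact h.piMid_mem
  smul ha hu := by rw [zero_mul, pow_zero, one_smul, piLin_smul ha hu]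
  mulRight _ _ := piLin_mulRight _ _ _

/-- The map `π` after the extra degeneracy. -/
theorem piLin_degen (x : C.Obj) (a : C.Words) (t : C.BarWords) (b : C.Words) :
    C.piLin x (C.degen (a ⊗ₜ[R] (t ⊗ₜ[R] b))) =
      C.barCoeff t • C.mulRight b (C.splitWord a) := by
  rw [degen_tmul, piLin_tmul, barCoeff_ι_mul, barSingle_ι_mul, zero_smul, zero_add, one_smul,
    map_smul, map_smul, splitWord_plus]

/-- Two applications of the extra degeneracy produce bar length at least two, where `π` vanishes. -/
theorem piLin_degen_smul_degen (x : C.Obj) (a : C.Words) (u : C.Triple C.BarWords) :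
    C.piLin x (C.degen (a • C.degen u)) = 0 := by
  induction u using triple_induction with
  | h a' t v => rw [degen_tmul, smul_triple, piLin_degen, barCoeff_ι_mul, zero_smul]
  | hadd u v hu hv => simp only [smul_add, map_add, hu, hv, add_zero]

theorem piLin_degen_smul_unitBar (x : C.Obj) (a b : C.Words) :
    C.piLin x (C.degen (a • C.unitBar b)) = C.mulRight b (C.splitWord a) := by
  rw [unitBar_apply, smul_triple, piLin_degen, barCoeff_one, one_smul, mul_one]

theorem piLin_unitBar (x : C.Obj) (b : C.Words) :
    C.piLin x (C.unitBar b) = C.mulRight b (C.mid _ (x : C.carrier)) := by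
  have h : C.unitBar b = C.mulRight b (1 ⊗ₜ[R] (1 ⊗ₜ[R] 1)) := by
    rw [mulRight_tmul, one_mul, unitBar_apply]
  rw [h, piLin_mulRight, piLin_mid, piMid_apply]
  simp

theorem qMid_object (x : C.Obj) : C.qMid (x : C.carrier) = 0 := by
  have hb : C.brace (x : C.carrier) = 0 := brace_of_mem_zero (object_mem x)
  rw [qMid, LinearMap.add_apply, LinearMap.sub_apply, LinearMap.comp_apply,
    bd_of_mem_zero (object_mem x), map_zero, conv_eq, conv_eq, LinearMap.comp_apply,
    LinearMap.comp_apply, comul_obj]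
  simp [hb]

/-- In bar length zero both sides vanish, in bar length one the claim is the formula for the
differential of a split word, and in bar length at least two the right side is zero and the left
side has to cancel. -/
theorem IsBarWord.piLin_barMid {x y : C.Obj} {p n : ℕ} {t : C.BarWords}
    (ht : C.IsBarWord x y p n t) :
    C.piLin x (C.barMid t) = C.qDiff (C.piLin x (1 ⊗ₜ[R] (t ⊗ₜ[R] 1))) := by
  rw [piLin_mid, piMid_apply]
  cases ht with
  | nil x =>
    simp only [barMid_one, map_zero, barCoeff_one, barSingle_one, one_smul, add_zero]
    rw [mid_apply, isTwisted_qDiff.one_tmul_one, qMid_object]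
  | @cons _ z _ q p m n a t ha ht =>
    have ha' : a ∈ C.cobarGr x z m := Submodule.subset_span ⟨_, ha⟩
    have hu : a • C.mid _ t ∈ C.sandwichGr C.barGen x y (m + n) :=
      smul_mem_sandwichGr ha' (gen_mem_sandwichGr ⟨_, ht⟩)
    have h1 : ∀ (a : C.Words) (t : C.BarWords), C.aug (a • C.mid _ t) = C.barCoeff t • a := by
      intro a t; rw [aug_smul, mid_apply, aug_tmul]; simp
    have h2 : C.piLin x (a • C.mid _ t) = a • C.piMid z t := by
      simpa using piLin_smul_mulRight_mid ha' t 1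
    have h4 : ∀ (a : C.Words) (t : C.BarWords), C.piLin x (C.degen (a • C.mid _ t)) =
        C.barCoeff t • C.splitWord a := by
      intro a t; rw [mid_apply, smul_triple, piLin_degen, mulRight_one, mul_one]
    rw [← barDiff_mid, ← ha.plus, ← degen_smul_mid, barDiff_degen (normalize_of_mem hu), map_sub,
      map_add, map_neg, h1, piLin_unitBar, isTwisted_barDiff.smul, map_add C.degen, map_add (C.piLin x), barDiff_mid,
      h2, h4, barCoeff_ι_mul, barSingle_ι_mul, zero_smul, zero_add, map_smul C.splitWord, ha.plus,
      piMid_apply]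
    cases ht with
    | nil =>
      simp only [barCoeff_one, one_smul, barMid_one, smul_zero, map_zero, barSingle_one, add_zero,
        ha.qDiff_splitWord]
      abel
    | @cons _ z' _ q' p' m' n' a' t ha' ht =>
      have hu' : a' • C.mid _ t ∈ C.sandwichGr C.barGen z y (m' + n') :=
        smul_mem_sandwichGr (Submodule.subset_span ⟨_, ha'⟩) (gen_mem_sandwichGr ⟨_, ht⟩)
      -- This is nonzero only for the bar word `[a|a']`. Since splitting is a derivation, the faces
      -- with `aa'` and with `a'` on the right leave just `a` times the split of `a'`, which cancels
      -- the first face.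
      have h3 : C.piLin x (C.degen (C.wordSgn a • C.barMid (ι R a' * t))) =
          -(C.barCoeff t • a • C.splitWord a') := by
        rw [← barDiff_mid, ← ha'.plus, ← degen_smul_mid, barDiff_degen (normalize_of_mem hu'),
          smul_sub, smul_add, smul_neg, map_sub, map_sub, map_add, map_add, piLin_degen_smul_degen,
          piLin_degen_smul_unitBar, h1, ← mul_smul, map_neg, map_neg, h4, splitWord_mul,
          wordSgn_wordSgn, mulRight_rsmul, ha'.plus, smul_add]
        abel
      rw [h3]
      simp only [barCoeff_ι_mul, zero_smul, map_zero, barSingle_ι_mul, mulRight_zero, map_smul]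
      rw [smul_add, smul_zero, smul_comm a]
      abel

theorem barCoeff_comp_allCoprod : C.barCoeff ∘ₗ C.allCoprod = counit := by
  rw [allCoprod_eq, LinearMap.comp_add, comp_conv (β' := C.consBar.compr₂ C.barCoeff)
    (f' := (0 : C.carrier →ₗ[R] C.Words)) (g' := C.allCoprod) (fun a b => by simp), conv_zero_left]
  ext c
  simp [barCoeff]

theorem barSingle_comp_allCoprod : C.barSingle ∘ₗ C.allCoprod = C.brace := by
  rw [allCoprod_eq, LinearMap.comp_add, comp_conv (β' := (LinearMap.lsmul R C.Words).flip)
    (f' := C.brace) (g' := C.barCoeff ∘ₗ C.allCoprod) (fun a b => by simp),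
    barCoeff_comp_allCoprod]
  have h : (counit : C.carrier →ₗ[R] R) = LinearMap.toSpanSingleton R R 1 ∘ₗ counit := by
    ext c; simp
  nth_rw 2 [h]
  rw [conv_counit_right]
  ext c
  simp [Algebra.algebraMap_eq_smul_one]

/-- Of all iterated coproducts `π` sees only the empty one, which is the counit, and the single
entry `{c}`. Exactly one of them survives, according to whether `c` has degree zero. -/
theorem piLin_alphaLin {x y : C.Obj} {n : ℕ} {c : C.carrier} (hc : c ∈ C.hom x y)
    (hn : c ∈ C.gr n) : C.piLin x (C.alphaLin (1 ⊗ₜ[R] (c ⊗ₜ[R] 1))) = 1 ⊗ₜ[R] (c ⊗ₜ[R] 1) := by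
  have h : C.alphaLin (1 ⊗ₜ[R] (c ⊗ₜ[R] 1)) = 1 ⊗ₜ[R] (C.allCoprod c ⊗ₜ[R] 1) := rfl
  have h1 : C.barCoeff (C.allCoprod c) = counit c := LinearMap.congr_fun barCoeff_comp_allCoprod c
  have h2 : C.barSingle (C.allCoprod c) = C.brace c := LinearMap.congr_fun barSingle_comp_allCoprod c
  rw [h, piLin_mid, piMid_apply, h1, h2]
  rcases Nat.eq_zero_or_pos n with rfl | h0
  · rw [brace_of_mem_zero hn, map_zero, add_zero, ← map_smul, ← (hom_zero hc hn).1, mid_apply]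
  · rw [C.counit_eq_zero hn (by omega), zero_smul, zero_add, brace_of_mem hn (by omega),
      splitWord_ι, mid_apply]

end CategoricalCoalgebra

namespace CategoricalCoalgebra

open TensorAlgebra TensorProduct Coalgebra Graded

variable {R : Type u} [CommRing R] {C : CategoricalCoalgebra.{u, v} R}

/-! ### The homotopy -/

@[simp] theorem splitOff_one : C.splitOff 1 = 0 := wordRec_one _ _

theorem splitOff_ι_mul (c : C.carrier) (w : C.Words) : C.splitOff (ι R c * w) =
    (1 : C.Words) ⊗ₜ[R] (C.allCoprod (sgn C.gr c) * ι R (C.plus w)) + ι R c • C.splitOff w :=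
  wordRec_ι_mul _ _ _ _

theorem splitOff_plus (w : C.Words) : C.splitOff (C.plus w) = C.splitOff w := by
  simp [plus_apply]

theorem homotopyLin_smul (a : C.Words) (u : C.Triple C.BarWords) :
    C.homotopyLin (a • u) = C.wordSgn a • C.homotopyLin u := by
  induction u using triple_induction with
  | h a' t b =>
    simp only [homotopyLin, smul_triple, LinearMap.comp_apply, map_tmul, AlgHom.toLinearMap_apply,
      map_mul, LinearMap.id_apply]
    rw [← smul_triple, insertLeft_smul]
  | hadd u v hu hv => simp only [smul_add, map_add, hu, hv]

theorem homotopyLin_mulRight (b : C.Words) (u : C.Triple C.BarWords) :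
    C.homotopyLin (C.mulRight b u) = C.mulRight b (C.homotopyLin u) := by
  induction u using triple_induction with
  | h a' t b' =>
    simp only [homotopyLin, mulRight_tmul, LinearMap.comp_apply, map_tmul,
      LinearMap.id_apply]
    rw [← insertLeft_mulRight, mulRight_tmul]
  | hadd u v hu hv => simp only [map_add, hu, hv]

theorem homotopyLin_unitBar (b : C.Words) : C.homotopyLin (C.unitBar b) = 0 := by
  rw [unitBar_apply, homotopyLin, LinearMap.comp_apply, map_tmul, LinearMap.id_apply,
    insertLeft_tmul]
  simp

theorem homotopyLin_degen_tmul (a : C.Words) (t : C.BarWords) (b : C.Words) :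
    C.homotopyLin (C.degen (a ⊗ₜ[R] (t ⊗ₜ[R] b))) = C.mulRight b
      (TensorProduct.assoc R C.Words C.BarWords C.Words
        (map LinearMap.id (LinearMap.mulRight R t) (C.splitOff a) ⊗ₜ 1)) := by
  have h : ∀ q : C.Words ⊗[R] C.BarWords, map LinearMap.id (LinearMap.mul' R C.BarWords)
      (TensorProduct.assoc R C.Words C.BarWords C.BarWords (q ⊗ₜ t)) =
      map LinearMap.id (LinearMap.mulRight R t) q := fun q => by
    induction q using TensorProduct.induction_on with
    | zero => simp
    | add p q hp hq => simp only [add_tmul, map_add, hp, hq]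
    | tmul a s => simp
  rw [degen_tmul, homotopyLin, LinearMap.comp_apply, map_tmul, LinearMap.id_apply, insertLeft_tmul,
    AlgHom.toLinearMap_apply, map_one, one_smul]
  simp only [LinearMap.comp_apply, barFirst_ι_mul, map_tmul, LinearMap.id_apply,
    LinearEquiv.coe_coe, splitOff_plus, h]

/-- The recursion for the homotopy after the extra degeneracy. -/
theorem homotopyLin_degen_ι_smul (c : C.carrier) (v : C.Triple C.BarWords) :
    C.homotopyLin (C.degen (ι R c • v)) =
      C.spread (C.barPush v) (sgn C.gr c) + ι R c • C.homotopyLin (C.degen v) := by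
  induction v using triple_induction with
  | h a t b =>
    have h : ∀ q : C.Words ⊗[R] C.BarWords,
        TensorProduct.assoc R C.Words C.BarWords C.Words
          (map LinearMap.id (LinearMap.mulRight R t) (ι R c • q) ⊗ₜ 1) =
        ι R c • TensorProduct.assoc R C.Words C.BarWords C.Words
          (map LinearMap.id (LinearMap.mulRight R t) q ⊗ₜ 1) := fun q => by
      induction q using TensorProduct.induction_on with
      | zero => simp
      | add p q hp hq => simp only [add_tmul, map_add, hp, hq, smul_add]
      | tmul a s => simp [smul_tmul']
    rw [smul_triple, homotopyLin_degen_tmul, homotopyLin_degen_tmul, splitOff_ι_mul, map_add,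
      add_tmul, map_add, map_add, h, mulRight_smul, spread_apply, barPush_tmul, smul_tmul',
      smul_eq_mul]
    simp [mul_assoc]
  | hadd u v hu hv =>
    simp only [smul_add, map_add, hu, hv, spread_apply, tmul_add]
    abel

/-- The shift by two is one for the extra degeneracy and one for `H`. The induction follows the
recursion for `H s`. -/
theorem homotopyLin_degen_smul_mem {x z y : C.Obj} {p m n : ℕ} {a : C.Words} {t : C.BarWords}
    (ha : C.IsWord x z p m a) (ht : C.barGen z y n t) :
    C.homotopyLin (C.degen (a • C.mid _ t)) ∈ C.sandwichGr C.barGen x y (m + n + 2) := by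
  induction ha with
  | nil x => rw [one_smul, mid_apply, degen_one_tmul, map_zero]; exact zero_mem _
  | @cons x z' z p m n' c w hc hm hw ih =>
    rw [mul_smul, homotopyLin_degen_ι_smul, sgn_of_mem C.gr hm, map_smul]
    have hw' : w ∈ C.cobarGr z' z n' := Submodule.subset_span ⟨_, hw⟩
    refine add_mem (Submodule.smul_mem _ _ ?_) ?_
    · have h := spread_mem (degen_mem (smul_mem_sandwichGr hw' (gen_mem_sandwichGr ht))) hc hm
      rwa [show m + 1 + (n' + n + 1) = m + n' + n + 2 by omega] at h
    · have h := smul_mem_sandwichGr (ι_mem_cobarGr hc hm) (ih ht)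
      rwa [show m + (n' + n + 2) = m + n' + n + 2 by omega] at h

theorem isBimoduleMap_homotopyLin :
    IsBimoduleMap C C.barGen C.barGen 1 fun _ => C.homotopyLin where
  mem_gen := fun ⟨_, h⟩ => by
    cases h with
    | nil x => rw [← unitBar_apply, homotopyLin_unitBar]; exact zero_mem _
    | @cons x z y q p m n a t ha ht =>
      have h := homotopyLin_degen_smul_mem ha ⟨_, ht⟩
      rw [degen_smul_mid, ha.plus, mid_apply, show m + n + 2 = m + 1 + n + 1 by omega] at h
      exact h
  smul ha _ := by rw [one_mul, homotopyLin_smul, wordSgn_of_mem ha, smul_assoc]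
  mulRight _ _ := homotopyLin_mulRight _ _

/-! ### The homotopy equation -/

/-- The bilinear map `([a₁|⋯|a_p], b₀[b₁|⋯|b_q]b) ↦ 1[a₁|⋯|a_p|b₀|⋯|b_q]b`. -/
noncomputable def prepend : C.BarWords →ₗ[R] C.Triple C.BarWords →ₗ[R] C.Triple C.BarWords :=
  LinearMap.mk₂ R (fun t u => 1 ⊗ₜ[R] (t • C.barPush u))
    (fun s t u => by rw [add_smul, tmul_add])
    (fun r t u => by rw [smul_assoc, tmul_smul])
    (fun t u v => by rw [map_add, smul_add, tmul_add])
    (fun r t u => by rw [map_smul, smul_comm, tmul_smul])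

theorem prepend_apply (t : C.BarWords) (u : C.Triple C.BarWords) :
    C.prepend t u = 1 ⊗ₜ[R] (t • C.barPush u) := rfl

theorem map_barPlus_barPush (u : C.Triple C.BarWords) :
    map C.barPlus.toLinearMap LinearMap.id (C.barPush u) = C.barPush (C.normalize u) := by
  induction u using triple_induction with
  | h a t b => simp
  | hadd u v hu hv => simp only [map_add, hu, hv]

theorem allCoprod_comp_sgn : C.allCoprod ∘ₗ sgn C.gr =
    Algebra.linearMap R C.BarWords ∘ₗ counit +
      conv C.consBar (C.brace ∘ₗ sgn C.gr) (C.allCoprod ∘ₗ sgn C.gr) := by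
  conv_lhs => rw [allCoprod_eq]
  rw [LinearMap.add_comp, LinearMap.comp_assoc, counit_comp_sgn, conv_comp_sgn]

/-- The same kind of recursion as for `spread`, now with the inhomogeneous term `s ∘ k` and with a
second argument that depends on the last leg. -/
theorem conv_prepend (k : C.carrier →ₗ[R] C.Triple C.BarWords) :
    conv C.prepend (C.allCoprod ∘ₗ sgn C.gr) k = C.degen ∘ₗ k +
      C.degen ∘ₗ conv (C.lact _) (C.brace ∘ₗ sgn C.gr)
        (conv C.prepend (C.allCoprod ∘ₗ sgn C.gr) k) := by
  conv_lhs => rw [allCoprod_comp_sgn]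
  have h1 : Algebra.linearMap R C.BarWords = LinearMap.toSpanSingleton R C.BarWords 1 := by
    ext; simp
  rw [conv_add_left, h1, conv_counit_left]
  congr 1
  · ext c; simp [prepend_apply, degen_apply]
  · rw [conv_assoc (β₃ := (C.lact _).compr₂ C.degen) (β₄ := C.prepend)]
    · exact (comp_conv fun a b => rfl).symm
    · intro a b c
      simp only [LinearMap.compr₂_apply, lact_apply, prepend_apply, consBar_apply,
        degen_smul_one_tmul, LinearMap.comp_apply, plus_brace, mul_smul]

/-- The differential of `∑ 1[{c⁽¹⁾}|⋯|{c⁽ⁿ⁾}|v₀|⋯|v_p]b`, for `v = v₀[v₁|⋯|v_p]b`. -/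
theorem barDiff_comp_spread_barPush {v : C.Triple C.BarWords} (hv : C.normalize v = v) :
    C.barDiff ∘ₗ C.spread (C.barPush v) =
      C.spread (C.barPush v) ∘ₗ C.bd - conv (C.lact _) C.brace (C.spread (C.barPush v)) -
      C.spread (C.barPush (C.barDiff v)) ∘ₗ sgn C.gr +
      C.spread (1 ⊗ₜ C.aug v) ∘ₗ sgn C.gr -
      conv C.prepend (C.allCoprod ∘ₗ sgn C.gr) ((C.lact _).flip v ∘ₗ C.brace ∘ₗ sgn C.gr) -
      LinearMap.toSpanSingleton R _ v ∘ₗ counit := by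
  have h1 := barDiff_comp_spread (q := C.barPush v) (by rw [map_barPlus_barPush, hv])
  have h2 := spread_comp_bd (C.barPush v)
  have h3 := spread_comp_sgn (C.barPush (C.barDiff v))
  have h4 := spread_comp_sgn (1 ⊗ₜ C.aug v)
  have h5 := conv_prepend ((C.lact _).flip v ∘ₗ C.brace ∘ₗ sgn C.gr)
  have h6 : C.degen ∘ₗ conv (C.lact _) (C.brace ∘ₗ sgn C.gr)
      (LinearMap.toSpanSingleton R _ v ∘ₗ counit) =
      C.degen ∘ₗ (C.lact _).flip v ∘ₗ C.brace ∘ₗ sgn C.gr := by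
    rw [conv_counit_right]
  have h7 : LinearMap.toSpanSingleton R (C.Triple C.BarWords) (C.barDiff (1 ⊗ₜ C.barPush v)) =
      -LinearMap.toSpanSingleton R _ v +
        LinearMap.toSpanSingleton R _ (1 ⊗ₜ (1 ⊗ₜ C.aug v)) -
        LinearMap.toSpanSingleton R _ (1 ⊗ₜ C.barPush (C.barDiff v)) := by
    ext
    rw [← degen_apply, barDiff_degen hv, unitBar_apply, ← degen_apply]
    simp
  -- Here `1 ⊗ C.barPush v` is `s(v)`, and the augmentation vanishes on the image of `s`.
  have h8 : C.unitBar ∘ₗ LinearMap.mulRight R (C.aug (1 ⊗ₜ C.barPush v)) ∘ₗ C.brace = 0 := by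
    rw [← degen_apply, aug_degen]
    ext; simp
  rw [h7, h8, zero_add, LinearMap.sub_comp, LinearMap.add_comp, LinearMap.neg_comp] at h1
  have h9 : C.barDiff ∘ₗ C.spread (C.barPush v) +
      conv (C.lact _) C.brace (C.spread (C.barPush v)) -
      (C.spread (C.barPush v) ∘ₗ C.bd - C.spread (C.barPush (C.barDiff v)) ∘ₗ sgn C.gr +
      C.spread (1 ⊗ₜ C.aug v) ∘ₗ sgn C.gr -
      conv C.prepend (C.allCoprod ∘ₗ sgn C.gr) ((C.lact _).flip v ∘ₗ C.brace ∘ₗ sgn C.gr) -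
      LinearMap.toSpanSingleton R _ v ∘ₗ counit) = 0 := by
    -- Both sides obey the recursion with the signed letter in front. By `h7` the constant terms are
    -- those of `δs(v)`, and `h6` accounts for the term in which `v` itself appears.
    refine eq_zero_of_degen_conv (f := C.brace ∘ₗ sgn C.gr) (fun _ => brace_sgn_of_mem_zero) ?_
    rw [conv_sub_right, conv_sub_right, conv_sub_right, conv_add_right _ _ (_ - _), conv_sub_right]
    simp only [LinearMap.comp_sub, LinearMap.comp_add _ _ C.degen] at h1 h2 h3 h4 h5 h6 ⊢
    linear_combination (norm := abel) h1 - h2 + h3 - h4 + h5 - h6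
  linear_combination (norm := abel) h9

end CategoricalCoalgebra

namespace CategoricalCoalgebra

open TensorAlgebra TensorProduct Coalgebra Graded

variable {R : Type u} [CommRing R] {C : CategoricalCoalgebra.{u, v} R}

theorem allCoprod_object (x : C.Obj) : C.allCoprod (x : C.carrier) = 1 := by
  have hb : C.brace (x : C.carrier) = 0 := brace_of_mem_zero (object_mem x)
  rw [allCoprod_eq, LinearMap.add_apply, conv_eq, LinearMap.comp_apply, LinearMap.comp_apply,
    comul_obj, counit_obj]
  simp [hb]

theorem allCoprod_comp_zeroPart : C.allCoprod ∘ₗ zeroPart C.gr =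
    LinearMap.toSpanSingleton R _ 1 ∘ₗ counit := by
  refine linearMap_ext_objects (fun x => ?_) fun n hn c hc => ?_
  · simp [zeroPart_of_mem_zero C.gr (object_mem x), allCoprod_object, counit_obj]
  · simp [zeroPart_of_mem C.gr hc hn, C.counit_eq_zero hc hn]

theorem posPart_eq : posPart C.gr = LinearMap.id - zeroPart C.gr := by
  rw [← zeroPart_add_posPart (gr := C.gr), add_sub_cancel_left]

theorem allCoprod_comp_posPart : C.allCoprod ∘ₗ posPart C.gr =
    C.allCoprod - LinearMap.toSpanSingleton R _ 1 ∘ₗ counit := by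
  rw [posPart_eq, LinearMap.comp_sub, allCoprod_comp_zeroPart, LinearMap.comp_id]

/-- Letters vanish on `C₀`, while the recursion for `H s` needs an element of `C` itself; replacing
one by the other costs a counit term. -/
theorem spread_comp_sgn_posPart (q : C.BarWords ⊗[R] C.Words) :
    C.spread q ∘ₗ sgn C.gr ∘ₗ posPart C.gr = C.spread q ∘ₗ sgn C.gr -
      LinearMap.toSpanSingleton R (C.Triple C.BarWords) (1 ⊗ₜ q) ∘ₗ counit := by
  have h : C.spread q ∘ₗ zeroPart C.gr =
      LinearMap.toSpanSingleton R (C.Triple C.BarWords) (1 ⊗ₜ q) ∘ₗ counit := by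
    rw [spread, LinearMap.comp_assoc, LinearMap.comp_assoc, allCoprod_comp_zeroPart]
    ext c
    simp
  rw [posPart_eq, LinearMap.comp_sub, LinearMap.comp_sub, sgn_zeroPart, h, LinearMap.comp_id]

/-- The homotopy after the extra degeneracy and the multiplication by the differential of a letter. -/
theorem homotopyLin_degen_letterD (v : C.Triple C.BarWords) :
    (C.homotopyLin ∘ₗ C.degen) ∘ₗ (C.lact _).flip v ∘ₗ C.letterD =
      (C.lact _).flip (C.homotopyLin (C.degen v)) ∘ₗ C.letterD -
      C.spread (C.barPush v) ∘ₗ sgn C.gr ∘ₗ C.bd -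
      conv C.prepend C.allCoprod ((C.lact _).flip v ∘ₗ C.brace) +
      C.degen ∘ₗ (C.lact _).flip v ∘ₗ C.brace -
      conv (C.lact _) (C.brace ∘ₗ sgn C.gr) (C.spread (C.barPush v) ∘ₗ sgn C.gr) +
      (C.lact _).flip (C.degen v) ∘ₗ C.brace ∘ₗ sgn C.gr := by
  set L := C.homotopyLin ∘ₗ C.degen with hL
  have hι : ∀ c v, L (ι R c • v) = C.spread (C.barPush v) (sgn C.gr c) + ι R c • L v :=
    homotopyLin_degen_ι_smul
  have hp : ∀ t u, C.prepend t u = 1 ⊗ₜ[R] (t • C.barPush u) := prepend_apply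
  have h1 : (L ∘ₗ (C.lact _).flip v) ∘ₗ
      conv (LinearMap.mul R C.Words) (C.brace ∘ₗ sgn C.gr) C.brace =
      conv C.prepend (C.allCoprod ∘ₗ posPart C.gr) ((C.lact _).flip v ∘ₗ C.brace) +
      conv (C.lact _) (C.brace ∘ₗ sgn C.gr)
        (C.spread (C.barPush v) ∘ₗ sgn C.gr ∘ₗ posPart C.gr) +
      (C.lact _).flip (L v) ∘ₗ conv (LinearMap.mul R C.Words) (C.brace ∘ₗ sgn C.gr) C.brace := by
    simp only [conv_eq, ← LinearMap.comp_assoc]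
    rw [← LinearMap.add_comp, ← LinearMap.add_comp]
    congr 1
    ext a b
    have hs : sgn C.gr (posPart C.gr (sgn C.gr a)) = posPart C.gr a := by
      have := LinearMap.congr_fun (posPart_sgn C.gr) a
      rw [LinearMap.comp_apply, LinearMap.comp_apply] at this
      rw [this, sgn_sgn]
    simp only [TensorProduct.AlgebraTensorModule.curry_apply, LinearMap.restrictScalars_self,
      TensorProduct.curry_apply, LinearMap.comp_apply, TensorProduct.lift.tmul,
      LinearMap.compl₁₂_apply, LinearMap.mul_apply', LinearMap.flip_apply, lact_apply,
      LinearMap.add_apply, hp, mul_smul]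
    -- For a product of two letters the recursion is used twice. The cut at the first letter gives
    -- the prepended term, the cut at the second gives a spread multiplied by the first letter, and
    -- the last term has both letters in front.
    rw [brace_apply (sgn C.gr a), hι, hs, brace_apply b, hι, spread_apply, smul_add]
    abel
  have h2 : (L ∘ₗ (C.lact _).flip v) ∘ₗ Algebra.linearMap R C.Words ∘ₗ C.curv =
      (C.lact _).flip (L v) ∘ₗ Algebra.linearMap R C.Words ∘ₗ C.curv := by
    ext c
    simp [Algebra.algebraMap_eq_smul_one]
  have h3 : (L ∘ₗ (C.lact _).flip v) ∘ₗ ι R ∘ₗ C.bd =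
      C.spread (C.barPush v) ∘ₗ sgn C.gr ∘ₗ C.bd + (C.lact _).flip (L v) ∘ₗ ι R ∘ₗ C.bd :=
    LinearMap.ext fun c => hι _ _
  have h4 : conv C.prepend (LinearMap.toSpanSingleton R _ 1 ∘ₗ counit)
      ((C.lact _).flip v ∘ₗ C.brace) = C.degen ∘ₗ (C.lact _).flip v ∘ₗ C.brace := by
    rw [conv_counit_left]
    ext c
    simp [hp, degen_apply]
  have h5 : conv (C.lact _) (C.brace ∘ₗ sgn C.gr)
      (LinearMap.toSpanSingleton R (C.Triple C.BarWords) (1 ⊗ₜ C.barPush v) ∘ₗ counit) =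
      (C.lact _).flip (C.degen v) ∘ₗ C.brace ∘ₗ sgn C.gr := conv_counit_right _ _ _
  rw [allCoprod_comp_posPart, spread_comp_sgn_posPart, conv_sub_left, conv_sub_right, h4, h5] at h1
  rw [← LinearMap.comp_assoc, letterD_eq, LinearMap.comp_sub, LinearMap.comp_sub,
    LinearMap.comp_sub, LinearMap.comp_sub, h1, h2, h3, hL, LinearMap.comp_apply]
  abel

theorem piLin_degen_ι_smul (x : C.Obj) (c : C.carrier) (v : C.Triple C.BarWords) :
    C.piLin x (C.degen (ι R c • v)) = C.mulRight (C.aug v) (C.mid _ c) -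
      ι R (sgn C.gr c) • C.piLin x (C.degen v) := by
  induction v using triple_induction with
  | h a t b =>
    rw [smul_triple, piLin_degen, piLin_degen, splitWord_ι_mul, aug_tmul, mulRight_rsmul, map_sub,
      mulRight_smul, smul_sub, smul_comm (ι R (sgn C.gr c))]
    simp
  | hadd u v hu hv => simp only [smul_add, map_add, hu, hv, mulRight_add]; abel

/-- The general formula evaluated at the signed element; in positive degree the counit term drops
out. -/
theorem barDiff_spread_sgn {v : C.Triple C.BarWords} (hv : C.normalize v = v) {m : ℕ}
    {c : C.carrier} (hc : c ∈ C.gr (m + 1)) :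
    C.barDiff (C.spread (C.barPush v) (sgn C.gr c)) =
      -C.spread (C.barPush v) (sgn C.gr (C.bd c)) -
      conv (C.lact _) (C.brace ∘ₗ sgn C.gr) (C.spread (C.barPush v) ∘ₗ sgn C.gr) c -
      C.spread (C.barPush (C.barDiff v)) c + C.spread (1 ⊗ₜ C.aug v) c -
      conv C.prepend C.allCoprod ((C.lact _).flip v ∘ₗ C.brace) c := by
  have h := LinearMap.congr_fun (congrArg (· ∘ₗ sgn C.gr) (barDiff_comp_spread_barPush hv)) c
  have hs : sgn C.gr ∘ₗ sgn C.gr = (LinearMap.id : C.carrier →ₗ[R] C.carrier) :=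
    LinearMap.ext fun c => sgn_sgn C.gr c
  simp only [LinearMap.sub_comp, LinearMap.add_comp, conv_comp_sgn, LinearMap.comp_assoc, hs,
    LinearMap.comp_id, counit_comp_sgn, bd_comp_sgn, LinearMap.comp_neg] at h
  simpa [C.counit_eq_zero hc] using h

/-- The homotopy equation at `1[{c}v₀|⋯|v_p]b` follows from the one at `1[v₀|⋯|v_p]b`. -/
theorem homotopy_step (x : C.Obj) {v : C.Triple C.BarWords} (hv : C.normalize v = v) {m : ℕ}
    {c : C.carrier} (hc : c ∈ C.gr (m + 1))
    (ih : C.barDiff (C.homotopyLin (C.degen v)) = C.homotopyLin v +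
      C.homotopyLin (C.degen (C.barDiff v)) + C.alphaLin (C.piLin x (C.degen v)) - C.degen v) :
    C.barDiff (C.homotopyLin (C.degen (ι R c • v))) = C.homotopyLin (ι R c • v) +
      C.homotopyLin (C.degen (C.barDiff (ι R c • v))) +
      C.alphaLin (C.piLin x (C.degen (ι R c • v))) - C.degen (ι R c • v) := by
  have hb : C.brace c = ι R c := brace_of_mem hc (by omega)
  have hbs : C.brace (sgn C.gr c) = ι R (sgn C.gr c) := by
    rw [sgn_of_mem C.gr hc, map_smul, map_smul, hb]
  have h1 := barDiff_spread_sgn hv hc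
  have h2 := LinearMap.congr_fun (homotopyLin_degen_letterD v) c
  simp only [LinearMap.comp_apply, LinearMap.sub_apply, LinearMap.add_apply, LinearMap.flip_apply,
    lact_apply, hb, hbs] at h2
  have h3 : C.mulRight (C.aug v) (C.spread (1 ⊗ₜ 1) c) = C.spread (1 ⊗ₜ C.aug v) c := by
    simp [spread_apply, smul_tmul']
  have h4 : C.alphaLin (C.mulRight (C.aug v) (C.mid _ c)) = C.spread (1 ⊗ₜ C.aug v) c := by
    rw [alphaLin_mulRight, ← h3, ← alphaLin_comp_mid]
    rfl
  have h5 := congrArg (ι R (sgn C.gr c) • ·) ih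
  simp only [smul_add, smul_sub] at h5
  rw [homotopyLin_degen_ι_smul, map_add, isTwisted_barDiff.smul, isTwisted_barDiff.smul,
    homotopyLin_smul, piLin_degen_ι_smul, map_sub C.alphaLin, h4, alphaLin_smul, wordSgn_ι,
    map_add C.degen, map_add C.homotopyLin, neg_smul, neg_smul, neg_smul, map_neg, map_neg,
    homotopyLin_degen_ι_smul, sgn_sgn, h1, wordD_ι, h2]
  -- The differential of the spread cancels the terms with `D{c}`, and the term `1[{c⁽¹⁾}|⋯]ε(v)`
  -- matches `α` of the new summand of `π`. What remains is the equation at `v` multiplied by the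
  -- signed letter.
  linear_combination (norm := abel) -h5

/-- Because `s(1 ⊗ q) = 0`, the degeneracy formula can be solved for `sδ`. -/
theorem degen_barDiff_one_tmul {q : C.BarWords ⊗[R] C.Words}
    (hq : C.normalize (1 ⊗ₜ q) = 1 ⊗ₜ q) :
    C.degen (C.barDiff (1 ⊗ₜ q)) = -(1 ⊗ₜ q) + C.unitBar (C.aug (1 ⊗ₜ q)) := by
  have h := barDiff_degen hq
  rw [degen_one_tmul, map_zero] at h
  linear_combination (norm := abel) h

/-- This is the homotopy equation at `s(u)` with `δs(u)` eliminated through the degeneracy formula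
and `Hη = 0`, a form suited to induction on the letters of `a`. The object `x₀` is arbitrary because
`π` on the image of `s` does not depend on the starting object. -/
theorem IsWord.homotopy {x y z : C.Obj} {p m n : ℕ} {a : C.Words} {t : C.BarWords}
    (ha : C.IsWord x z p m a) (ht : C.barGen z y n t) (x₀ : C.Obj) :
    C.barDiff (C.homotopyLin (C.degen (a • C.mid _ t))) = C.homotopyLin (a • C.mid _ t) +
      C.homotopyLin (C.degen (C.barDiff (a • C.mid _ t))) +
      C.alphaLin (C.piLin x₀ (C.degen (a • C.mid _ t))) - C.degen (a • C.mid _ t) := by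
  induction ha with
  | nil x =>
    have hn : C.normalize (C.mid _ t) = C.mid _ t := normalize_of_mem (gen_mem_sandwichGr ht)
    rw [one_smul]
    rw [mid_apply] at hn ⊢
    rw [degen_barDiff_one_tmul hn, degen_one_tmul, map_add, homotopyLin_unitBar]
    simp
  | cons hc hm hw ih =>
    rw [mul_smul]
    refine homotopy_step x₀ ?_ hm (ih ht)
    exact normalize_of_mem (smul_mem_sandwichGr (Submodule.subset_span ⟨_, hw⟩)
      (gen_mem_sandwichGr ht))

/-- A nonempty bar word is in the image of `s`, so the previous form is translated back by the
degeneracy formula. For the empty one `H` vanishes and `απ` is the identity. -/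
theorem IsBarWord.homotopy {x y : C.Obj} {p n : ℕ} {t : C.BarWords} (ht : C.IsBarWord x y p n t) :
    C.barDiff (C.homotopyLin (1 ⊗ₜ[R] (t ⊗ₜ[R] 1))) + C.homotopyLin (C.barMid t) =
      C.alphaLin (C.piLin x (1 ⊗ₜ[R] (t ⊗ₜ[R] 1))) - 1 ⊗ₜ[R] (t ⊗ₜ[R] 1) := by
  cases ht with
  | nil x =>
    have h : C.alphaLin (C.mid _ (x : C.carrier)) = 1 ⊗ₜ[R] (C.allCoprod x ⊗ₜ[R] 1) := rfl
    rw [← unitBar_apply, homotopyLin_unitBar, piLin_unitBar, mulRight_one, h, allCoprod_object]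
    simp [unitBar_apply]
  | @cons x z y q p m n a t ha ht =>
    have h := ha.homotopy (C := C) ⟨_, ht⟩ x
    have hu : a • C.mid _ t ∈ C.sandwichGr C.barGen x y (m + n) :=
      smul_mem_sandwichGr (Submodule.subset_span ⟨_, ha⟩) (gen_mem_sandwichGr ⟨_, ht⟩)
    have e : 1 ⊗ₜ[R] ((ι R a * t) ⊗ₜ[R] 1) = C.degen (a • C.mid _ t) := by
      rw [degen_smul_mid, ha.plus, mid_apply]
    rw [← barDiff_mid, mid_apply, e, barDiff_degen (normalize_of_mem hu), map_sub, map_add, map_neg,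
      homotopyLin_unitBar, h]
    abel

theorem isChainContraction (C : CategoricalCoalgebra.{u, v} R) :
    (∀ x y, PresentedComplex.IsChainContraction (C.barComplex x y) (C.qComplex x y)
      (C.piLin x) C.alphaLin C.homotopyLin) ∧
    PresentedComplex.IsChainContraction C.hoch C.coHoch
      (C.cyclicMap C.piLin) (C.cyclicMap fun _ => C.alphaLin)
      (C.cyclicMap fun _ => C.homotopyLin) :=
  isChainContraction_of_gen isDGBimodule_barDiff isDGBimodule_qDiff isBimoduleMap_piLin
    isBimoduleMap_alphaLin isBimoduleMap_homotopyLin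
    (fun _ _ _ _ ⟨_, h⟩ => h.piLin_barMid) (fun _ _ _ c _ => alphaLin_qMid c)
    (fun _ _ _ _ h => piLin_alphaLin h.1 h.2) (fun _ _ _ _ ⟨_, h⟩ => h.homotopy)

end CategoricalCoalgebra

namespace CategoricalCoalgebra

open TensorAlgebra TensorProduct Coalgebra Graded

variable {R : Type u} [CommRing R] {C D : CategoricalCoalgebra.{u, v} R}

/-! ### Naturality of the contraction -/

namespace Hom

variable (f : Hom C D)

theorem onWords_ι_sgn (c : C.carrier) : f.onWords (ι R (sgn C.gr c)) =
    ι R (sgn D.gr (f.lin c)) - algebraMap R _ (f.eps c) := by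
  have h1 := LinearMap.congr_fun f.lin_comp_sgn c
  have h2 := LinearMap.congr_fun f.eps_comp_sgn c
  simp only [LinearMap.comp_apply, LinearMap.neg_apply] at h1 h2
  rw [onWords_ι, h1, h2, map_neg, sub_eq_add_neg]

@[simp] theorem onBarWords_ι (a : C.Words) :
    f.onBarWords (ι R a) = ι R (D.plus (f.onWords a)) := by
  simp [onBarWords]

theorem plus_onWords_plus (a : C.Words) :
    D.plus (f.onWords (C.plus a)) = D.plus (f.onWords a) := by
  simp [plus_apply a]

theorem barCoeff_onBarWords (t : C.BarWords) : D.barCoeff (f.onBarWords t) = C.barCoeff t := by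
  have : (algebraMapInv (R := R) (M := D.Words)).comp f.onBarWords = algebraMapInv := by
    ext a; simp [algebraMapInv]
  exact AlgHom.congr_fun this t

theorem barPlus_onBarWords (t : C.BarWords) :
    D.barPlus (f.onBarWords t) = f.onBarWords t := by
  have : D.barPlus.comp f.onBarWords = f.onBarWords := by ext a; simp
  exact AlgHom.congr_fun this t

@[simp] theorem onBar_tmul (a : C.Words) (t : C.BarWords) (b : C.Words) :
    f.onBar (a ⊗ₜ[R] (t ⊗ₜ[R] b)) =
      f.onWords a ⊗ₜ[R] (f.onBarWords t ⊗ₜ[R] f.onWords b) := rfl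

@[simp] theorem onQ_tmul (a : C.Words) (c : C.carrier) (b : C.Words) :
    f.onQ (a ⊗ₜ[R] (c ⊗ₜ[R] b)) = f.onWords a ⊗ₜ[R] (f.lin c ⊗ₜ[R] f.onWords b) := rfl

theorem onBar_smul (a : C.Words) (u : C.Triple C.BarWords) :
    f.onBar (a • u) = f.onWords a • f.onBar u := by
  induction u using triple_induction with
  | h a' t b => simp [smul_triple]
  | hadd u v hu hv => simp only [smul_add, map_add, hu, hv]

theorem onBar_mulRight (b : C.Words) (u : C.Triple C.BarWords) :
    f.onBar (C.mulRight b u) = D.mulRight (f.onWords b) (f.onBar u) := by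
  induction u using triple_induction with
  | h a' t b => simp
  | hadd u v hu hv => simp only [map_add, hu, hv]

theorem onQ_smul (a : C.Words) (u : C.Triple C.carrier) :
    f.onQ (a • u) = f.onWords a • f.onQ u := by
  induction u using triple_induction with
  | h a' t b => simp [smul_triple]
  | hadd u v hu hv => simp only [smul_add, map_add, hu, hv]

theorem onQ_mulRight (b : C.Words) (u : C.Triple C.carrier) :
    f.onQ (C.mulRight b u) = D.mulRight (f.onWords b) (f.onQ u) := by
  induction u using triple_induction with
  | h a' t b => simp
  | hadd u v hu hv => simp only [map_add, hu, hv]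

theorem onBar_degen (u : C.Triple C.BarWords) : f.onBar (C.degen u) = D.degen (f.onBar u) := by
  induction u using triple_induction with
  | h a t b => simp [plus_onWords_plus]
  | hadd u v hu hv => simp only [map_add, hu, hv]

theorem normalize_onBar (u : C.Triple C.BarWords) : D.normalize (f.onBar u) = f.onBar u := by
  induction u using triple_induction with
  | h a t b => simp [barPlus_onBarWords]
  | hadd u v hu hv => simp only [map_add, hu, hv]

theorem aug_onBar (u : C.Triple C.BarWords) : D.aug (f.onBar u) = f.onWords (C.aug u) := by
  induction u using triple_induction with
  | h a t b => simp [barCoeff_onBarWords]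
  | hadd u v hu hv => simp only [map_add, hu, hv]

theorem onBar_unitBar (b : C.Words) : f.onBar (C.unitBar b) = D.unitBar (f.onWords b) := by
  simp [unitBar_apply]

theorem onBar_mid (t : C.BarWords) : f.onBar (C.mid _ t) = D.mid _ (f.onBarWords t) := by
  simp

/-- Since `Ωf` commutes with `s`, `η`, `ε` and `D`, the degeneracy formula reduces the claim to a
bar word that is one entry shorter. -/
theorem onBar_barMid {x y : C.Obj} {p n : ℕ} {t : C.BarWords} (ht : C.IsBarWord x y p n t) :
    f.onBar (C.barMid t) = D.barDiff (f.onBar (C.mid _ t)) := by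
  induction ht with
  | nil x => rw [onBar_mid, map_one f.onBarWords, barDiff_mid, barMid_one, barMid_one, map_zero]
  | @cons x y z q p m n a t ha ht ih =>
    have hu : a • C.mid _ t ∈ C.sandwichGr C.barGen x z (m + n) :=
      smul_mem_sandwichGr (Submodule.subset_span ⟨_, ha⟩) (gen_mem_sandwichGr ⟨_, ht⟩)
    have h : f.onBar (C.barDiff (a • C.mid _ t)) = D.barDiff (f.onBar (a • C.mid _ t)) := by
      rw [isTwisted_barDiff.smul, map_add, onBar_smul, onBar_smul, onBar_smul,
        isTwisted_barDiff.smul, barDiff_mid, ih, onWords_wordD, onWords_wordSgn]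
    rw [← barDiff_mid, ← ha.plus, ← degen_smul_mid, barDiff_degen (normalize_of_mem hu), map_sub,
      map_add, map_neg, onBar_unitBar, onBar_degen, onBar_degen, h,
      barDiff_degen (f.normalize_onBar _), aug_onBar]

theorem onBar_mid_mem {x y : C.Obj} {p n : ℕ} {t : C.BarWords} (ht : C.IsBarWord x y p n t) :
    f.onBar (C.mid _ t) ∈ D.sandwichGr D.barGen (f.obj x) (f.obj y) n := by
  induction ht with
  | nil x =>
    rw [onBar_mid, map_one f.onBarWords]
    exact gen_mem_sandwichGr ⟨0, .nil _⟩
  | @cons x y z q p m n a t ha ht ih =>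
    rw [← ha.plus, ← degen_smul_mid, onBar_degen, onBar_smul, add_right_comm]
    exact degen_mem (smul_mem_sandwichGr (f.onWords_mem (Submodule.subset_span ⟨_, ha⟩)) ih)

theorem isSemilinearMap_onBar : IsSemilinearMap f C.barGen D.barGen f.onBar where
  mem_gen := fun ⟨_, h⟩ => f.onBar_mid_mem h
  smul := f.onBar_smul
  mulRight := f.onBar_mulRight

theorem isSemilinearMap_onQ : IsSemilinearMap f C.homGen D.homGen f.onQ where
  mem_gen := fun ⟨hc, hn⟩ => by
    rw [onQ_tmul, map_one]
    exact gen_mem_sandwichGr ⟨f.lin_mem_hom hc, f.lin_mem hn⟩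
  smul := f.onQ_smul
  mulRight := f.onQ_mulRight

theorem onQ_mid (c : C.carrier) : f.onQ (C.mid _ c) = D.mid _ (f.lin c) := by
  simp

/-- The scalars `ε f₁` from the letters on the left and on the right are exactly the two correction
terms in `f₀∂`. -/
theorem onQ_comp_qMid : f.onQ ∘ₗ C.qMid = D.qMid ∘ₗ f.lin := by
  have h1 : f.onQ ∘ₗ conv (C.lact _) C.brace (C.mid _) =
      conv (D.lact _) (D.brace ∘ₗ f.lin + Algebra.linearMap R _ ∘ₗ f.eps) (D.mid _ ∘ₗ f.lin) :=
    comp_conv fun a b => by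
      rw [lact_apply, onQ_smul, onWords_brace, onQ_mid]; rfl
  have h2 : f.onQ ∘ₗ conv (C.ract _) (C.mid _ ∘ₗ sgn C.gr) C.brace =
      conv (D.ract _) (D.mid _ ∘ₗ f.lin ∘ₗ sgn C.gr)
        (D.brace ∘ₗ f.lin + Algebra.linearMap R _ ∘ₗ f.eps) :=
    comp_conv fun a b => by
      rw [ract_apply, onQ_mulRight, onWords_brace, LinearMap.comp_apply, onQ_mid]; rfl
  have h3 : f.onQ ∘ₗ C.mid _ = D.mid _ ∘ₗ f.lin := LinearMap.ext f.onQ_mid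
  have h4 : D.mid _ ∘ₗ conv (LinearMap.lsmul R D.carrier) f.eps f.lin =
      conv (D.lact _) (Algebra.linearMap R _ ∘ₗ f.eps) (D.mid _ ∘ₗ f.lin) :=
    comp_conv fun a b => by simp
  have h5 : D.mid _ ∘ₗ conv (LinearMap.lsmul R D.carrier).flip (f.lin ∘ₗ sgn C.gr) f.eps =
      conv (D.ract _) (D.mid _ ∘ₗ f.lin ∘ₗ sgn C.gr) (Algebra.linearMap R _ ∘ₗ f.eps) :=
    comp_conv fun a b => by
      simp only [LinearMap.flip_apply, LinearMap.lsmul_apply, map_smul, LinearMap.comp_apply,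
        ract_apply, Algebra.linearMap_apply, mulRight_algebraMap]
  rw [qMid, qMid, LinearMap.comp_add, LinearMap.comp_sub, h1, h2, ← LinearMap.comp_assoc, h3,
    LinearMap.comp_assoc, f.lin_comp_bd, LinearMap.comp_sub, LinearMap.comp_add, h4, h5,
    LinearMap.add_comp, LinearMap.sub_comp, conv_comp_lin, conv_comp_lin, conv_add_left,
    conv_add_right, LinearMap.comp_assoc, LinearMap.comp_assoc, lin_comp_sgn]
  abel

/-- Constants are dropped in bar entries, so `f₁` does not contribute and both sides solve the same
recursion. -/
theorem onBarWords_comp_allCoprod :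
    f.onBarWords.toLinearMap ∘ₗ C.allCoprod = D.allCoprod ∘ₗ f.lin := by
  have hb : ∀ c : C.carrier, D.plus (f.onWords (C.brace c)) = D.brace (f.lin c) := fun c => by
    rw [onWords_brace, map_add, plus_brace, Algebra.algebraMap_eq_smul_one, map_smul, plus_one,
      smul_zero, add_zero]
  have h1 : f.onBarWords.toLinearMap ∘ₗ conv C.consBar C.brace C.allCoprod =
      conv D.consBar (D.brace ∘ₗ f.lin) (f.onBarWords.toLinearMap ∘ₗ C.allCoprod) :=
    comp_conv fun a b => by simp [hb]
  have h2 : f.onBarWords.toLinearMap ∘ₗ Algebra.linearMap R C.BarWords ∘ₗ counit =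
      (Algebra.linearMap R D.BarWords ∘ₗ counit) ∘ₗ f.lin := by
    ext c; simp
  have h3 := congrArg (f.onBarWords.toLinearMap ∘ₗ ·) (allCoprod_eq (C := C))
  have h4 := congrArg (· ∘ₗ f.lin) (allCoprod_eq (C := D))
  simp only [LinearMap.comp_add, h1, h2] at h3
  simp only [LinearMap.add_comp, conv_comp_lin] at h4
  rw [← sub_eq_zero]
  refine eq_zero_of_conv (f := D.brace ∘ₗ f.lin) (β := D.consBar)
    (fun c hc => brace_of_mem_zero (f.lin_mem hc)) ?_
  rw [conv_sub_right]
  linear_combination (norm := abel) h3 - h4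

theorem onBar_alphaLin (c : C.carrier) :
    f.onBar (C.alphaLin (C.mid _ c)) = D.alphaLin (f.onQ (C.mid _ c)) := by
  have h : ∀ (E : CategoricalCoalgebra.{u, v} R) (e : E.carrier),
      E.alphaLin (E.mid _ e) = E.mid _ (E.allCoprod e) := fun E e => rfl
  rw [onQ_mid, h, h, onBar_mid]
  exact congrArg _ (LinearMap.congr_fun f.onBarWords_comp_allCoprod c)

/-- The scalar part of `Ωf{c}` passes through splitting. It reappears with the correct sign because
`ε f₁` changes sign under the parity operator. -/
theorem onQ_splitWord (w : C.Words) : f.onQ (C.splitWord w) = D.splitWord (f.onWords w) := by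
  induction w using word_induction with
  | one => simp
  | cons c w ih =>
    rw [splitWord_ι_mul, map_sub, onQ_smul, ih, onQ_tmul, map_one, onWords_ι_sgn, map_mul,
      onWords_ι, add_mul, map_add, splitWord_ι_mul, ← Algebra.smul_def, map_smul, sub_smul,
      algebraMap_smul]
    abel
  | add a b ha hb => simp only [map_add, ha, hb]
  | smul r a ha => simp only [map_smul, ha]

theorem barSingle_onBarWords (t : C.BarWords) :
    D.barSingle (f.onBarWords t) = D.plus (f.onWords (C.barSingle t)) := by
  induction t using word_induction with
  | one => simp
  | cons a t _ => simp [barCoeff_onBarWords]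
  | add a b ha hb => simp only [map_add, ha, hb]
  | smul r a ha => simp only [map_smul, ha]

theorem onQ_piLin (x : C.Obj) (t : C.BarWords) :
    f.onQ (C.piLin x (C.mid _ t)) = D.piLin (f.obj x) (f.onBar (C.mid _ t)) := by
  rw [onBar_mid, mid_apply, mid_apply, piLin_mid, piLin_mid, piMid_apply, piMid_apply, map_add,
    map_smul, onQ_mid, onQ_splitWord, barCoeff_onBarWords, barSingle_onBarWords, splitWord_plus]
  rfl

theorem onBar_spread (q : C.BarWords ⊗[R] C.Words) (c : C.carrier) :
    f.onBar (C.spread q c) =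
      D.spread (map f.onBarWords.toLinearMap f.onWords.toLinearMap q) (f.lin c) := by
  have h : f.onBarWords (C.allCoprod c) = D.allCoprod (f.lin c) :=
    LinearMap.congr_fun f.onBarWords_comp_allCoprod c
  rw [spread_apply, spread_apply, ← h]
  induction q using TensorProduct.induction_on with
  | zero => simp
  | add p q hp hq => simp only [smul_add, tmul_add, map_add, hp, hq]
  | tmul t b => simp [smul_tmul']

theorem map_barPush (u : C.Triple C.BarWords) :
    map f.onBarWords.toLinearMap f.onWords.toLinearMap (C.barPush u) =
      D.barPush (f.onBar u) := by
  induction u using triple_induction with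
  | h a t b => simp [plus_onWords_plus]
  | hadd u v hu hv => simp only [map_add, hu, hv]

/-- Induction on the letters of `a` through the recursion for `H s`; the scalar part of `Ωf{c}`
multiplies both sides alike, since `s` and `H` are linear. -/
theorem onBar_homotopyLin_degen (a : C.Words) (t : C.BarWords) (b : C.Words) :
    f.onBar (C.homotopyLin (C.degen (a ⊗ₜ[R] (t ⊗ₜ[R] b)))) =
      D.homotopyLin (D.degen (f.onBar (a ⊗ₜ[R] (t ⊗ₜ[R] b)))) := by
  induction a using word_induction with
  | one => rw [onBar_tmul, map_one, degen_one_tmul, degen_one_tmul, map_zero, map_zero, map_zero]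
  | cons c w ih =>
    have h := LinearMap.congr_fun f.lin_comp_sgn c
    simp only [LinearMap.comp_apply] at h
    rw [← smul_triple, homotopyLin_degen_ι_smul, map_add, onBar_spread, map_barPush, onBar_smul, ih,
      onBar_smul, onWords_ι, add_smul, add_smul, map_add D.degen, map_add D.homotopyLin,
      homotopyLin_degen_ι_smul, algebraMap_smul, algebraMap_smul, map_smul D.degen,
      map_smul D.homotopyLin, h, add_assoc]
  | add a b ha hb => simp only [add_tmul, map_add, ha, hb]
  | smul r a ha => simp only [← smul_tmul', map_smul, ha]

theorem onBar_homotopyLin {x y : C.Obj} {p n : ℕ} {t : C.BarWords}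
    (ht : C.IsBarWord x y p n t) :
    f.onBar (C.homotopyLin (C.mid _ t)) = D.homotopyLin (f.onBar (C.mid _ t)) := by
  cases ht with
  | nil x =>
    rw [onBar_mid, map_one f.onBarWords, mid_apply, mid_apply, ← unitBar_apply, ← unitBar_apply,
      homotopyLin_unitBar, homotopyLin_unitBar, map_zero]
  | @cons x y z q p m n a t ha ht =>
    rw [← ha.plus, ← degen_smul_mid, onBar_degen, mid_apply, smul_triple, onBar_homotopyLin_degen]

theorem isContractionMap :
    (∀ x y : C.Obj, PresentedComplex.IsContractionMap
      (C.barComplex x y) (C.qComplex x y) (C.piLin x) C.alphaLin C.homotopyLin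
      (D.barComplex (f.obj x) (f.obj y)) (D.qComplex (f.obj x) (f.obj y))
      (D.piLin (f.obj x)) D.alphaLin D.homotopyLin f.onBar f.onQ) ∧
    PresentedComplex.IsContractionMap
      C.hoch C.coHoch (C.cyclicMap C.piLin) (C.cyclicMap fun _ => C.alphaLin)
      (C.cyclicMap fun _ => C.homotopyLin)
      D.hoch D.coHoch (D.cyclicMap D.piLin) (D.cyclicMap fun _ => D.alphaLin)
      (D.cyclicMap fun _ => D.homotopyLin)
      (f.onCyclic f.onBar) (f.onCyclic f.onQ) :=
  isContractionMap_of_gen isDGBimodule_barDiff isDGBimodule_qDiff isDGBimodule_barDiff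
    isDGBimodule_qDiff isBimoduleMap_piLin isBimoduleMap_alphaLin isBimoduleMap_homotopyLin
    isBimoduleMap_piLin isBimoduleMap_alphaLin isBimoduleMap_homotopyLin
    f.isSemilinearMap_onBar f.isSemilinearMap_onQ
    (fun _ _ _ _ ⟨_, h⟩ => f.onBar_barMid h)
    (fun _ _ _ c _ => (LinearMap.congr_fun f.onQ_comp_qMid c).trans <| by
      rw [← mid_apply, onQ_mid, mid_apply, isTwisted_qDiff.one_tmul_one]; rfl)
    (fun x _ _ t _ => f.onQ_piLin x t) (fun _ _ _ c _ => f.onBar_alphaLin c)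
    (fun _ _ _ _ ⟨_, h⟩ => f.onBar_homotopyLin h)

end Hom

end CategoricalCoalgebra

theorem mainTheorem6 (R : Type u) [CommRing R] :
    -- the contraction between the bar construction and `𝒬`
    (∀ (C : CategoricalCoalgebra.{u, v} R) (x y : C.Obj),
      PresentedComplex.IsChainContraction (C.barComplex x y) (C.qComplex x y)
        (C.piLin x) C.alphaLin C.homotopyLin) ∧
    -- it is natural
    (∀ (C D : CategoricalCoalgebra.{u, v} R) (f : CategoricalCoalgebra.Hom C D) (x y : C.Obj),
      PresentedComplex.IsContractionMap
        (C.barComplex x y) (C.qComplex x y) (C.piLin x) C.alphaLin C.homotopyLin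
        (D.barComplex (f.obj x) (f.obj y)) (D.qComplex (f.obj x) (f.obj y))
        (D.piLin (f.obj x)) D.alphaLin D.homotopyLin
        f.onBar f.onQ) ∧
    -- the induced contraction between the Hochschild and the coHochschild complex
    (∀ C : CategoricalCoalgebra.{u, v} R,
      PresentedComplex.IsChainContraction C.hoch C.coHoch
        (C.cyclicMap C.piLin) (C.cyclicMap fun _ => C.alphaLin)
        (C.cyclicMap fun _ => C.homotopyLin)) ∧
    -- it is natural
    (∀ (C D : CategoricalCoalgebra.{u, v} R) (f : CategoricalCoalgebra.Hom C D),
      PresentedComplex.IsContractionMap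
        C.hoch C.coHoch (C.cyclicMap C.piLin) (C.cyclicMap fun _ => C.alphaLin)
        (C.cyclicMap fun _ => C.homotopyLin)
        D.hoch D.coHoch (D.cyclicMap D.piLin) (D.cyclicMap fun _ => D.alphaLin)
        (D.cyclicMap fun _ => D.homotopyLin)
        (f.onCyclic f.onBar) (f.onCyclic f.onQ)) :=
  ⟨fun C => C.isChainContraction.1, fun _ _ f => f.isContractionMap.1,
    fun C => C.isChainContraction.2, fun _ _ f => f.isContractionMap.2⟩
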